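/- Let $n_t\ge 2$, $M\ge 1$, $\nu_1,\dots,\nu_M\in\mathbb{Z}_{\ge 0}$, $\nu_0=0$, and $\delta>0$. Let $H=H_M\cdots H_1$, where $H_1,\dots,H_M$ are independent, $H_j$ has size $(n_t+\nu_j)\times(n_t+\nu_{j-1})$, and all its entries are i.i.d. standard circularly symmetric complex Gaussian (density $\pi^{-1}e^{-|z|^2}$ on $\mathbb{C}$). For $k=1,\dots,n_t$ let $$\gamma_k=\frac{1}{\left[(I+\delta H^\dagger H)^{-1}\right]_{kk}}-1$$ be the output SINR of the $k$-th stream at the MMSE receiver, and let $R=\sum_{k=1}^{n_t}\mathbb{E}[\ln(1+\gamma_k)]$ be the ergodic sum rate. For $x>0$ the Meijer G-function is $$G^{m,n}_{n+p,m+q}\left(\left.\begin{array}{c}a_1,\dots,a_n;\,b_1,\dots,b_p\\ c_1,\dots,c_m;\,d_1,\dots,d_q\end{array}\right|x\right)=\int_{\mathcal C}\frac{ds}{2\pi i}\,\frac{\prod_{j=1}^m\Gamma(c_j-s)\prod_{j=1}^n\Gamma(1-a_j+s)}{\prod_{j=1}^p\Gamma(b_j-s)\prod_{j=1}^q\Gamma(1-d_j+s)}\,x^s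 ,$$ where Gamma factors occurring identically in the numerator and in the denominator (some $a_j=d_k$, or some $c_j=b_k$) are first cancelled, and $\mathcal C$ runs from $-i\infty$ to $+i\infty$ and has the poles of the remaining factors $\Gamma(c_j-s)$ on its right and those of the remaining factors $\Gamma(1-a_j+s)$ on its left. For all G-functions below, $\mathcal C$ can be taken to be a vertical line; along every vertical line separating the poles the integral converges absolutely, and its value does not depend on the line. (i) For every $k$, the SINR $\gamma_k$ has a probability density $\rho_M$ that vanishes on $(-\infty,0]$ and is given for $\gamma>0$ by $$\rho_M(\gamma)=\left(\frac{\gamma}{\gamma+1}\right)^{n_t-1}\sum_{j=0}^{n_t-1}\binom{n_t-1}{j}\frac{\delta^{-j-1}}{\prod_{l=1}^M(\nu_l+j)!}\;G^{M,2}_{2,M+2}\left(\left.\begin{array}{c}-j,\,-\frac{\gamma+n_t}{\gamma+1};\,-\\ \nu_1,\dots,\nu_M;\,-1-j,\,1-\frac{\gamma+n_t}{\gamma+1}\end{array}\right|\frac{\gamma}{\delta}\right).$$ (ii) Each $\ln(1+\gamma_k)$ is integrable, and with $\gamma_E$ the Euler constant and $\Psi$ the digamma function, $$R=n_t\left(\gamma_E+\Psi(n_t)\right)+\sum_{j=0}^{n_t-1}\frac{n_t\,\delta^{-j-1}}{j!\,(n_t-1-j)!\,\prod_{l=1}^M(\nu_l+j)!}\;G^{M+2,3}_{4,M+4}\left(\left.\begin{array}{c}-1,\,-n_t,\,-j;\,0\\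 -1,\,-1,\,\nu_1,\dots,\nu_M;\,0,\,-1-j\end{array}\right|\frac{1}{\delta}\right).$$ -/

import Mathlib

open MeasureTheory ProbabilityTheory

noncomputable section

/-! ### Meijer G-functions -/

/-- The four parameter lists of a Meijer G-function
`G^{m,n}_{n+p,m+q} ( a₁,…,aₙ ; b₁,…,b_p | c₁,…,c_m ; d₁,…,d_q )`. -/
structure MeijerParams where
  a : Multiset ℂ
  b : Multiset ℂ
  c : Multiset ℂ
  d : Multiset ℂ

namespace MeijerParams

open Classical in
/-- Cancellation of Gamma factors that occur identically in the numerator and in the denominator of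
the Mellin-Barnes integrand: an upper parameter `a_j` equal to a lower parameter `d_k`, or a lower
parameter `c_j` equal to an upper parameter `b_k`, is removed together with its partner (the usual
reduction of the order of a Meijer G-function). -/
def reduce (p : MeijerParams) : MeijerParams where
  a := p.a - p.d
  b := p.b - p.c
  c := p.c - p.b
  d := p.d - p.a

/-- The Mellin-Barnes integrand
`∏ Γ(c_j - s) ∏ Γ(1 - a_j + s) / (∏ Γ(b_j - s) ∏ Γ(1 - d_j + s)) * x ^ s`. -/
def integrand (p : MeijerParams) (x : ℝ) (s : ℂ) : ℂ :=
  ((p.c.map fun c => Complex.Gamma (c - s)).prod *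
      (p.a.map fun a => Complex.Gamma (1 - a + s)).prod) /
    ((p.b.map fun b => Complex.Gamma (b - s)).prod *
      (p.d.map fun d => Complex.Gamma (1 - d + s)).prod) * (x : ℂ) ^ s

/-- The vertical line `Re s = σ` has all poles `c_j, c_j + 1, …` of the `Γ(c_j - s)` strictly on its
right and all poles `a_j - 1, a_j - 2, …` of the `Γ(1 - a_j + s)` strictly on its left. -/
def Separates (p : MeijerParams) (σ : ℝ) : Prop :=
  (∀ c ∈ p.c, σ < c.re) ∧ ∀ a ∈ p.a, a.re - 1 < σ

/-- `(2πi)⁻¹ ∫ integrand ds` over the line `Re s = σ`, run through from `σ - i∞` to `σ + i∞`. -/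
def lineIntegral (p : MeijerParams) (x σ : ℝ) : ℂ :=
  (2 * Real.pi : ℂ)⁻¹ * ∫ t : ℝ, p.integrand x ((σ : ℂ) + (t : ℂ) * Complex.I)

open Classical in
/-- The value at `x > 0` of the Meijer G-function: the contour integral of the Mellin-Barnes
integrand along a vertical line that separates the two families of poles, equal Gamma factors of
numerator and denominator having been cancelled. (The default value `0` is taken where no vertical
line separates the poles; see `IsWellDefined`.) -/
def G (p : MeijerParams) (x : ℝ) : ℂ :=
  if h : ∃ σ : ℝ, p.reduce.Separates σ then p.reduce.lineIntegral x h.choose else 0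

/-- The contour integral that defines `p.G x` makes sense: there is a separating vertical line, and
along each such line the integral converges absolutely and has the value `p.G x`. -/
def IsWellDefined (p : MeijerParams) (x : ℝ) : Prop :=
  (∃ σ : ℝ, p.reduce.Separates σ) ∧
    ∀ σ : ℝ, p.reduce.Separates σ →
      Integrable (fun t : ℝ => p.reduce.integrand x ((σ : ℂ) + (t : ℂ) * Complex.I)) ∧
      p.reduce.lineIntegral x σ = p.G x

end MeijerParams

/-- The list `ν₁, …, ν_M` as complex parameters. -/
def nuParams {M : ℕ} (ν : Fin M → ℕ) : Multiset ℂ :=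
  (Finset.univ : Finset (Fin M)).val.map fun l => (ν l : ℂ)

/-- Parameters `-j, -(g+n)/(g+1) ; - | ν₁, …, ν_M ; -1-j, 1-(g+n)/(g+1)`
(a function of type `G^{M,2}_{2,M+2}`). -/
def sinrParams (n : ℕ) {M : ℕ} (ν : Fin M → ℕ) (j : ℕ) (g : ℝ) : MeijerParams where
  a := {-(j : ℂ), -(((g : ℂ) + n) / (g + 1))}
  b := 0
  c := nuParams ν
  d := {-1 - (j : ℂ), 1 - ((g : ℂ) + n) / (g + 1)}

/-- Parameters `-1, -n, -j ; 0 | -1, -1, ν₁, …, ν_M ; 0, -1-j`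
(a function of type `G^{M+2,3}_{4,M+4}`). -/
def rateParams (n : ℕ) {M : ℕ} (ν : Fin M → ℕ) (j : ℕ) : MeijerParams where
  a := {-1, -(n : ℂ), -(j : ℂ)}
  b := {0}
  c := {-1, -1} + nuParams ν
  d := {0, -1 - (j : ℂ)}

/-! ### The channel -/

/-- The standard circularly symmetric complex Gaussian law, with density `π⁻¹ exp(-|z|²)` on `ℂ`
(so that `E|z|² = 1`). -/
def stdComplexGaussian : Measure ℂ :=
  volume.withDensity fun z => ENNReal.ofReal (Real.pi⁻¹ * Real.exp (-‖z‖ ^ 2))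

/-- The dimensions `n, n + ν₁, …, n + ν_M`. -/
def chainDim (n : ℕ) {M : ℕ} (ν : Fin M → ℕ) : Fin (M + 1) → ℕ :=
  Fin.cons n fun j => n + ν j

/-- The product `A_M ⋯ A₁` of a chain of rectangular matrices, where `A_{j+1}`, here `A j`, has size
`d (j+1) × d j`. -/
def chainProd : {M : ℕ} → (d : Fin (M + 1) → ℕ) →
    ((j : Fin M) → Matrix (Fin (d j.succ)) (Fin (d j.castSucc)) ℂ) →
    Matrix (Fin (d (Fin.last M))) (Fin (d 0)) ℂ
  | 0, d, _ => (1 : Matrix (Fin (d 0)) (Fin (d 0)) ℂ)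
  | M + 1, d, A =>
      A (Fin.last M) * chainProd (M := M) (fun i => d i.castSucc) fun j => A j.castSucc

/-- The channel matrix `H = H_M ⋯ H₁` of size `(n + ν_M) × n`. -/
def channelMatrix (n : ℕ) {M : ℕ} (ν : Fin M → ℕ)
    (A : (j : Fin M) →
      Matrix (Fin (chainDim n ν j.succ)) (Fin (chainDim n ν j.castSucc)) ℂ) :
    Matrix (Fin (chainDim n ν (Fin.last M))) (Fin n) ℂ :=
  chainProd (chainDim n ν) A

open scoped Matrix in
/-- The output SINR of the MMSE receiver for the `k`-th stream,
`1 / [(I + δ Hᴴ H)⁻¹]_{kk} - 1` (the diagonal entry is real). -/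
def mmseSINR {n m : ℕ} (δ : ℝ) (H : Matrix (Fin m) (Fin n) ℂ) (k : Fin n) : ℝ :=
  1 / (((1 : Matrix (Fin n) (Fin n) ℂ) + (δ : ℂ) • (Hᴴ * H))⁻¹ k k).re - 1

end

/-! Let W = δ HᴴH, and let D(F, S) be the determinant of the matrix whose i-th row is W_i for i ∈ S,
W_i + e_i for i ∈ F \ S and e_i otherwise. Cramer's rule gives γ_k = D(F, {k}) / D(F, ∅), where F
consists of all streams other than k. The proof studies the general ratio `sir` = D(F, S ∪ {k}) /
D(F, S), in which the streams in F interfere with unit power, those in S are nulled out and the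
others are absent.

The probabilistic core is that interferers can be removed one at a time. The law of H is invariant
under right multiplication by unitaries, so it may be averaged over rotations that mix only the
columns k and i. All three ratios, with i interfering, nulled out or absent, are expressed through
one 2 × 2 Hermitian matrix V: they are (det V + V₀₀)/(V₁₁ + 1), det V / V₁₁ and V₀₀. Rotation keeps
trace and determinant of V and makes V₀₀ uniform between the two eigenvalues. An elementary identity
between values of the uniform distribution function (`uniformCdf_mix`) then gives, at each x > 0,
P(interfering ≤ x) = x/(1+x) · P(nulled ≤ x) + 1/(1+x) · P(absent ≤ x). Iteration
(`measure_sir_eq_sum`) turns the law of γ_k into a binomial mixture of ratios without interferers.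

Without interferers the ratio is δ times the squared distance of column k from the span of the
columns in S. Each Gaussian factor of H multiplies this quantity by an independent Gamma variable,
whose shape is the number of rows minus |S| (`lintegral_sir_ginibre`). With j = n - 1 - |S| this
yields P(γ_k ≤ x) = Σ_j C(n-1, j) (x/(1+x))^(n-1-j) (1+x)^(-j) P(δ ∏ Γ_l ≤ x), where Γ_l has shape
ν_l + j + 1 (`sinrLaw_real_Iic`).

The rest is Mellin analysis. Complex moments of a product of Gamma variables are products of Gamma
functions, and Mellin inversion writes P(δ ∏ Γ_l ≤ x) as a Barnes integral with kernel (1+j+s)⁻¹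
(x/δ)^s ∏ Γ(ν_l - s). Differentiating in x multiplies the kernel by (x+n)/(x+1) + s, a quotient of
Gamma functions; this is the G-function of the density. For the rate, E ln(1+γ) = ∫ P(γ > x)/(1+x)
dx. The weights collapse to (x/(1+x))^n, and Euler's Beta integral contributes Γ(-1-s) Γ(1+n+s). It
converges only for Re s < -1. For j = 0 such a line is to the left of the pole s = -1 and represents
minus the tail instead of the distribution function; the compensating term is ∫ (1 -
(x/(1+x))^(n-1))/(1+x) dx, the harmonic number H_{n-1} = γ_E + Ψ(n). -/

noncomputable section

set_option linter.unusedSectionVars false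

/-! ### Principal minors and interference cancellation -/

section Minors

open scoped Matrix ComplexOrder

variable {n m α : Type*} [Fintype n] [DecidableEq n] [Fintype m] [DecidableEq m]
  [Fintype α] [DecidableEq α]

/-- The diagonal `0`-`1` matrix that projects onto the coordinates in `s`. -/
def coordProj (s : Finset n) : Matrix n n ℂ :=
  Matrix.diagonal fun i => if i ∈ s then 1 else 0

theorem coordProj_mul (s t : Finset n) : coordProj s * coordProj t = coordProj (s ∩ t) := by
  unfold coordProj
  rw [Matrix.diagonal_mul_diagonal]
  congr 1
  ext i
  by_cases h1 : i ∈ s <;> by_cases h2 : i ∈ t <;> simp [h1, h2]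

theorem coordProj_compl (s : Finset n) : coordProj sᶜ = 1 - coordProj s := by
  unfold coordProj
  rw [← Matrix.diagonal_one, Matrix.diagonal_sub]
  congr 1
  ext i
  by_cases h1 : i ∈ s <;> simp [h1]

theorem coordProj_isHermitian (s : Finset n) : (coordProj s)ᴴ = coordProj s := by
  unfold coordProj
  rw [Matrix.diagonal_conjTranspose]
  congr 1
  ext i
  by_cases h1 : i ∈ s <;> simp [h1]

theorem coordProj_idem (s : Finset n) : coordProj s * coordProj s = coordProj s := by
  rw [coordProj_mul, Finset.inter_self]

theorem coordProj_disjoint {s t : Finset n} (h : Disjoint s t) :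
    coordProj s * coordProj t = 0 := by
  rw [coordProj_mul, Finset.disjoint_iff_inter_eq_empty.1 h]
  simp [coordProj]

theorem coordProj_union {s t : Finset n} (h : Disjoint s t) :
    coordProj (s ∪ t) = coordProj s + coordProj t := by
  unfold coordProj
  rw [Matrix.diagonal_add]
  congr 1
  ext i
  by_cases h1 : i ∈ s
  · have := Finset.disjoint_left.1 h h1
    simp [h1, this]
  · simp [h1]

/-- The matrix with rows `W_i` for `i ∈ S`, `W_i + e_i` for `i ∈ F \ S`, and `e_i` otherwise. -/
def mixedMatrix (W : Matrix n n ℂ) (F S : Finset n) : Matrix n n ℂ :=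
  coordProj Sᶜ + coordProj (S ∪ F) * W

/-- The compression of `mixedMatrix` to the coordinates in `S ∪ F`. -/
def symmMixedMatrix (W : Matrix n n ℂ) (F S : Finset n) : Matrix n n ℂ :=
  coordProj Sᶜ + coordProj (S ∪ F) * W * coordProj (S ∪ F)

theorem one_sub_coordProj_mul (F S : Finset n) :
    (1 - coordProj (S ∪ F)) * coordProj Sᶜ = 1 - coordProj (S ∪ F) := by
  rw [← coordProj_compl, coordProj_mul]
  congr 1
  ext i
  simp only [Finset.mem_inter, Finset.mem_compl, Finset.mem_union]
  tauto

theorem coordProj_comm (s t : Finset n) :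
    coordProj s * coordProj t = coordProj t * coordProj s := by
  rw [coordProj_mul, coordProj_mul, Finset.inter_comm]

/-- The matrix is block triangular with respect to S ∪ F and its complement. Splitting off a
unipotent left factor leaves the symmetric compression with the same determinant, to which
positivity arguments apply. -/
theorem mixedMatrix_eq_mul (W : Matrix n n ℂ) (F S : Finset n) :
    mixedMatrix W F S =
      (1 + coordProj (S ∪ F) * W * (1 - coordProj (S ∪ F))) * symmMixedMatrix W F S := by
  unfold mixedMatrix symmMixedMatrix
  have h1 := one_sub_coordProj_mul F S
  have h2 := coordProj_idem (S ∪ F)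
  generalize coordProj (S ∪ F) = J at *
  generalize coordProj Sᶜ = E at *
  have h3 : (1 - J) * J = 0 := by rw [sub_mul, h2, one_mul, sub_self]
  -- Left multiplication by 1 - J annihilates J and fixes E on the left, since the complement of S ∪
  -- F is contained in that of S.
  have h4 : J * W * (1 - J) * (E + J * W * J) = J * W * (1 - J) := by
    calc J * W * (1 - J) * (E + J * W * J)
        = J * W * ((1 - J) * E) + J * W * ((1 - J) * J) * W * J := by noncomm_ring
      _ = _ := by rw [h1, h3]; simp
  rw [add_mul, one_mul, h4]
  noncomm_ring

theorem det_mixedMatrix (W : Matrix n n ℂ) (F S : Finset n) :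
    (mixedMatrix W F S).det = (symmMixedMatrix W F S).det := by
  rw [mixedMatrix_eq_mul, Matrix.det_mul, mul_assoc (coordProj (S ∪ F)),
    Matrix.det_one_add_mul_comm]
  have : W * (1 - coordProj (S ∪ F)) * coordProj (S ∪ F) = 0 := by
    rw [mul_assoc, sub_mul, coordProj_idem, one_mul, sub_self, mul_zero]
  rw [this, add_zero, Matrix.det_one, one_mul]

theorem symmMixedMatrix_posDef {W : Matrix n n ℂ} (hW : W.PosDef) (F S : Finset n) :
    (symmMixedMatrix W F S).PosDef := by
  have hJ := coordProj_isHermitian (S ∪ F)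
  have h1 : (coordProj Sᶜ).PosSemidef := by
    have := Matrix.posSemidef_conjTranspose_mul_self (coordProj Sᶜ : Matrix n n ℂ)
    rwa [coordProj_isHermitian, coordProj_idem] at this
  have h2 : (coordProj (S ∪ F) * W * coordProj (S ∪ F)).PosSemidef := by
    have := hW.posSemidef.conjTranspose_mul_mul_same (coordProj (S ∪ F))
    rwa [hJ] at this
  refine Matrix.PosDef.of_dotProduct_mulVec_pos (h1.add h2).1 fun x hx => ?_
  have hform : star x ⬝ᵥ (symmMixedMatrix W F S *ᵥ x) = star x ⬝ᵥ (coordProj Sᶜ *ᵥ x) +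
      star (coordProj (S ∪ F) *ᵥ x) ⬝ᵥ (W *ᵥ (coordProj (S ∪ F) *ᵥ x)) := by
    unfold symmMixedMatrix
    rw [Matrix.add_mulVec, dotProduct_add, Matrix.star_mulVec, hJ, ← Matrix.dotProduct_mulVec,
      Matrix.mulVec_mulVec, Matrix.mulVec_mulVec]
  rw [hform]
  -- If x vanishes on S ∪ F the term from W is zero, but then x is supported off S and the other
  -- term equals the squared norm of x.
  by_cases h0 : coordProj (S ∪ F) *ᵥ x = 0
  · have hx' : coordProj Sᶜ *ᵥ x = x := by
      have e := congrArg (· *ᵥ x) (one_sub_coordProj_mul F S)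
      simp only [sub_mul, one_mul, Matrix.sub_mulVec, coordProj_comm (S ∪ F),
        ← Matrix.mulVec_mulVec, h0, Matrix.mulVec_zero, Matrix.one_mulVec, sub_zero] at e
      exact e
    rw [h0, hx']
    simpa using hx
  · exact add_pos_of_nonneg_of_pos (h1.dotProduct_mulVec_nonneg x) (hW.dotProduct_mulVec_pos h0)

theorem det_mixedMatrix_pos {W : Matrix n n ℂ} (hW : W.PosDef) (F S : Finset n) :
    0 < (mixedMatrix W F S).det := by
  rw [det_mixedMatrix]
  exact (symmMixedMatrix_posDef hW F S).det_pos

/-- `I - HJ (E + J Hᴴ H J)⁻¹ J Hᴴ`: what remains of the received signal once the streams in `S` are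
projected out and those in `F` are treated as noise. -/
def residualForm (H : Matrix m n ℂ) (F S : Finset n) : Matrix m m ℂ :=
  1 - H * coordProj (S ∪ F) * (symmMixedMatrix (Hᴴ * H) F S)⁻¹ * coordProj (S ∪ F) * Hᴴ

theorem symmMixedMatrix_isHermitian (H : Matrix m n ℂ) (F S : Finset n) :
    (symmMixedMatrix (Hᴴ * H) F S)ᴴ = symmMixedMatrix (Hᴴ * H) F S := by
  simp [symmMixedMatrix, coordProj_isHermitian, mul_assoc]

theorem residualForm_isHermitian (H : Matrix m n ℂ) (F S : Finset n) :
    (residualForm H F S)ᴴ = residualForm H F S := by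
  simp [residualForm, coordProj_isHermitian, Matrix.conjTranspose_nonsing_inv,
    symmMixedMatrix_isHermitian, Matrix.mul_assoc]

/-- Only the columns of H in S ∪ F enter the residual form. Other columns can therefore be rotated
or resampled without changing it. -/
theorem residualForm_congr {H H' : Matrix m n ℂ} {F S : Finset n}
    (h : H * coordProj (S ∪ F) = H' * coordProj (S ∪ F)) : residualForm H F S = residualForm H' F S := by
  have key : ∀ A : Matrix m n ℂ, residualForm A F S = 1 - (A * coordProj (S ∪ F)) *
      (coordProj Sᶜ + (A * coordProj (S ∪ F))ᴴ * (A * coordProj (S ∪ F)))⁻¹ *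
        (A * coordProj (S ∪ F))ᴴ := by
    intro A
    simp [residualForm, symmMixedMatrix, coordProj_isHermitian, Matrix.mul_assoc]
  rw [key H, key H', h]

theorem symmMixedMatrix_comm (W : Matrix n n ℂ) (F S : Finset n) :
    symmMixedMatrix W F S * coordProj (S ∪ F) = coordProj (S ∪ F) * symmMixedMatrix W F S := by
  have h2 := coordProj_idem (S ∪ F)
  unfold symmMixedMatrix
  rw [add_mul, mul_add, coordProj_comm Sᶜ, mul_assoc _ _ (coordProj (S ∪ F)), h2, ← mul_assoc,
    ← mul_assoc, h2]

theorem symmMixedMatrix_inv_comm {W : Matrix n n ℂ} {F S : Finset n}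
    (h : IsUnit (symmMixedMatrix W F S).det) :
    (symmMixedMatrix W F S)⁻¹ * coordProj (S ∪ F) =
      coordProj (S ∪ F) * (symmMixedMatrix W F S)⁻¹ := by
  have e := symmMixedMatrix_comm W F S
  generalize symmMixedMatrix W F S = M at *
  generalize coordProj (S ∪ F) = J at *
  calc M⁻¹ * J = M⁻¹ * (J * M) * M⁻¹ := by
        rw [mul_assoc, mul_assoc, Matrix.mul_nonsing_inv _ h, mul_one]
    _ = J * M⁻¹ := by rw [← e, ← mul_assoc, Matrix.nonsing_inv_mul _ h, one_mul]

theorem mixedMatrix_inv_mul {W : Matrix n n ℂ} {F S : Finset n}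
    (h : IsUnit (symmMixedMatrix W F S).det) :
    (mixedMatrix W F S)⁻¹ * coordProj (S ∪ F) =
      coordProj (S ∪ F) * (symmMixedMatrix W F S)⁻¹ * coordProj (S ∪ F) := by
  have h' : IsUnit (mixedMatrix W F S).det := by rwa [det_mixedMatrix]
  have e : mixedMatrix W F S * (coordProj (S ∪ F) * (symmMixedMatrix W F S)⁻¹ *
      coordProj (S ∪ F)) = coordProj (S ∪ F) := by
    rw [← symmMixedMatrix_inv_comm h, mul_assoc _ _ (coordProj _), coordProj_idem,
      mixedMatrix_eq_mul, mul_assoc, ← mul_assoc (symmMixedMatrix W F S),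
      Matrix.mul_nonsing_inv _ h, one_mul, add_mul, one_mul, mul_assoc _ (1 - _), sub_mul,
      coordProj_idem, one_mul, sub_self, mul_zero, add_zero]
  calc _ = (mixedMatrix W F S)⁻¹ * (mixedMatrix W F S * (coordProj (S ∪ F) *
        (symmMixedMatrix W F S)⁻¹ * coordProj (S ∪ F))) := by rw [e]
    _ = _ := by rw [← mul_assoc, Matrix.nonsing_inv_mul _ h', one_mul]

/-- The columns `e_{f a}` of the identity matrix. -/
def selection (f : α → n) : Matrix n α ℂ := (1 : Matrix n n ℂ).submatrix id f

theorem mul_selection (H : Matrix m n ℂ) (f : α → n) : H * selection f = H.submatrix id f := by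
  unfold selection
  have := Matrix.submatrix_mul_equiv H (1 : Matrix n n ℂ) id (Equiv.refl n) f
  rw [Matrix.mul_one] at this
  simpa using this

theorem selection_conjTranspose_mul_self {f : α → n} (hf : f.Injective) :
    (selection f)ᴴ * selection f = 1 := by
  rw [mul_selection]
  ext a b
  simp [selection, Matrix.one_apply, hf.eq_iff]

theorem selection_mul_conjTranspose {f : α → n} (hf : f.Injective) :
    selection f * (selection f)ᴴ = coordProj (Finset.univ.image f) := by
  ext i j
  simp only [selection, coordProj, Matrix.mul_apply, Matrix.conjTranspose_apply,
    Matrix.submatrix_apply, Matrix.one_apply, id, Matrix.diagonal_apply, Finset.mem_image,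
    Finset.mem_univ, true_and]
  by_cases h : ∃ a, f a = i
  · obtain ⟨a, rfl⟩ := h
    rw [Finset.sum_eq_single a]
    · simp [eq_comm]
    · intro b _ hb
      simp [hf.eq_iff, hb.symm]
    · simp
  · simp only [h, if_false, ite_self]
    refine Finset.sum_eq_zero fun a _ => ?_
    rw [if_neg fun e => h ⟨a, e.symm⟩, zero_mul]

theorem coordProj_mul_selection {f : α → n} {s : Finset n} (h : ∀ a, f a ∉ s) :
    coordProj s * selection f = 0 := by
  rw [mul_selection]
  ext i a
  simp only [coordProj, Matrix.submatrix_apply, Matrix.diagonal_apply, id, Matrix.zero_apply]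
  by_cases hi : i = f a
  · subst hi; simp [h a]
  · simp [hi]

/-- Switching on the streams `f a` multiplies the determinant by the Gram determinant of the
corresponding columns with respect to the residualForm form. -/
theorem det_mixedMatrix_union (H : Matrix m n ℂ) {F S : Finset n} {f : α → n}
    (hf : f.Injective) (hfs : ∀ a, f a ∉ S ∪ F)
    (hM : (mixedMatrix (Hᴴ * H) F S).det ≠ 0) :
    (mixedMatrix (Hᴴ * H) F (S ∪ Finset.univ.image f)).det =
      (mixedMatrix (Hᴴ * H) F S).det *
        ((H.submatrix id f)ᴴ * residualForm H F S * H.submatrix id f).det := by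
  set W := Hᴴ * H with hW
  set R := mixedMatrix W F S with hR
  set P : Matrix n α ℂ := selection f with hP
  have hRu : IsUnit R.det := isUnit_iff_ne_zero.2 hM
  have hMu : IsUnit (symmMixedMatrix W F S).det := by
    rw [← det_mixedMatrix]; exact hRu
  have hd1 : Disjoint (Finset.univ.image f) (S ∪ F) := by
    rw [Finset.disjoint_left]
    intro i hi
    obtain ⟨a, -, rfl⟩ := Finset.mem_image.1 hi
    exact hfs a
  have hd2 : Disjoint S (Finset.univ.image f) :=
    (hd1.mono_right Finset.subset_union_left).symm
  have hPP : P * Pᴴ = coordProj (Finset.univ.image f) := selection_mul_conjTranspose hf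
  have hPP1 : Pᴴ * P = 1 := selection_conjTranspose_mul_self hf
  have hJP : coordProj (S ∪ F) * P = 0 := coordProj_mul_selection hfs
  have hSP : coordProj S * P = 0 :=
    coordProj_mul_selection fun a h => hfs a (Finset.mem_union_left _ h)
  have hPJ : Pᴴ * coordProj (S ∪ F) = 0 := by
    have := congrArg Matrix.conjTranspose hJP
    simpa [coordProj_isHermitian] using this
  have hPS : Pᴴ * coordProj S = 0 := by
    have := congrArg Matrix.conjTranspose hSP
    simpa [coordProj_isHermitian] using this
  have hR' : mixedMatrix W F (S ∪ Finset.univ.image f) = R + P * (Pᴴ * W - Pᴴ) := by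
    rw [hR]
    unfold mixedMatrix
    have e1 : S ∪ Finset.univ.image f ∪ F = (S ∪ F) ∪ Finset.univ.image f := by
      ext; simp only [Finset.mem_union]; tauto
    rw [coordProj_compl, coordProj_union hd2, coordProj_compl, e1, coordProj_union hd1.symm, ← hPP]
    simp only [Matrix.mul_sub, ← Matrix.mul_assoc, add_mul]; abel
  have hPR : Pᴴ * R = Pᴴ := by
    rw [hR, mixedMatrix, Matrix.mul_add, ← Matrix.mul_assoc, hPJ, Matrix.zero_mul, add_zero,
      coordProj_compl, Matrix.mul_sub, hPS, Matrix.mul_one, sub_zero]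
  have hPR' : Pᴴ * R⁻¹ = Pᴴ := by
    conv_lhs => rw [← hPR]
    rw [Matrix.mul_assoc, Matrix.mul_nonsing_inv _ hRu, Matrix.mul_one]
  have hRP : R * P = P + coordProj (S ∪ F) * W * P := by
    rw [hR, mixedMatrix, Matrix.add_mul, coordProj_compl, Matrix.sub_mul, Matrix.one_mul, hSP,
      sub_zero]
  have hRP' : R⁻¹ * P = P - R⁻¹ * coordProj (S ∪ F) * W * P := by
    have : R⁻¹ * (R * P) = R⁻¹ * P + R⁻¹ * coordProj (S ∪ F) * W * P := by
      rw [hRP, Matrix.mul_add]; simp only [Matrix.mul_assoc]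
    rw [← Matrix.mul_assoc, Matrix.nonsing_inv_mul _ hRu, Matrix.one_mul] at this
    exact eq_sub_iff_add_eq.2 this.symm
  -- The update exchanges the rows e_{f a} for rows of W and has rank at most |α|, so Sylvester's
  -- identity det(1 + AB) = det(1 + BA) reduces the quotient of determinants to one of size α.
  have hfac : R + P * (Pᴴ * W - Pᴴ) = (1 + P * ((Pᴴ * W - Pᴴ) * R⁻¹)) * R := by
    rw [add_mul, one_mul, Matrix.mul_assoc, Matrix.mul_assoc, Matrix.nonsing_inv_mul _ hRu,
      Matrix.mul_one]
  rw [hR', hfac, Matrix.det_mul, Matrix.det_one_add_mul_comm, mul_comm]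
  congr 2
  have hB : H.submatrix id f = H * P := (mul_selection H f).symm
  calc 1 + (Pᴴ * W - Pᴴ) * R⁻¹ * P = 1 + Pᴴ * W * (R⁻¹ * P) - Pᴴ * R⁻¹ * P := by
        simp only [Matrix.sub_mul, Matrix.mul_assoc]; abel
    _ = Pᴴ * W * (R⁻¹ * P) := by rw [hPR', hPP1]; abel
    _ = (H * P)ᴴ * residualForm H F S * (H * P) := by
        rw [hRP', mixedMatrix_inv_mul hMu, residualForm, hW, Matrix.conjTranspose_mul]
        simp only [Matrix.mul_sub, Matrix.sub_mul, Matrix.mul_assoc, Matrix.one_mul]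
    _ = _ := by rw [hB]

/-- Multilinearity in row i, which is W_i + e_i when stream i interferes: the summand W_i puts i
into S and the summand e_i removes it. -/
theorem det_mixedMatrix_insert (W : Matrix n n ℂ) {F S : Finset n} {i : n} (hS : i ∉ S)
    (hF : i ∉ F) :
    (mixedMatrix W (insert i F) S).det =
      (mixedMatrix W F (insert i S)).det + (mixedMatrix W F S).det := by
  have e1 : mixedMatrix W F (insert i S) = (mixedMatrix W F S).updateRow i (W i) := by
    ext a b
    by_cases h : a = i
    · subst h
      simp [mixedMatrix, coordProj, hS, Matrix.diagonal_apply]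
    · simp [mixedMatrix, coordProj, h, Matrix.diagonal_apply, Matrix.updateRow_ne]
  have e2 : mixedMatrix W F S = (mixedMatrix W F S).updateRow i ((1 : Matrix n n ℂ) i) := by
    ext a b
    by_cases h : a = i
    · subst h
      simp [mixedMatrix, coordProj, hS, hF, Matrix.diagonal_apply, Matrix.one_apply]
    · simp [Matrix.updateRow_ne h]
  have e3 : mixedMatrix W (insert i F) S =
      (mixedMatrix W F S).updateRow i (W i + (1 : Matrix n n ℂ) i) := by
    ext a b
    by_cases h : a = i
    · subst h
      simp [mixedMatrix, coordProj, hS, Matrix.diagonal_apply, Matrix.one_apply, add_comm]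
    · simp [mixedMatrix, coordProj, h, Matrix.diagonal_apply, Matrix.updateRow_ne]
  rw [e3, Matrix.det_updateRow_add, ← e1, ← e2]

/-- Cramer's rule: the cofactor replaces row k of 1 + W by e_k, and multilinearity in that row
splits det(1 + W) into the two terms of the denominator. -/
theorem inv_one_add_diag (W : Matrix n n ℂ) (k : n) :
    ((1 + W)⁻¹ k k) =
      (mixedMatrix W (Finset.univ.erase k) ∅).det /
        ((mixedMatrix W (Finset.univ.erase k) ∅).det +
          (mixedMatrix W (Finset.univ.erase k) {k}).det) := by
  have h1 := det_mixedMatrix_insert W (F := Finset.univ.erase k) (S := ∅) (i := k)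
    (by simp) (by simp)
  have h2 : mixedMatrix W (insert k (Finset.univ.erase k)) ∅ = 1 + W := by
    rw [Finset.insert_erase (Finset.mem_univ k)]
    simp [mixedMatrix, coordProj, Matrix.diagonal_one]
  have h3 : mixedMatrix W (Finset.univ.erase k) ∅ =
      (1 + W).updateRow k (Pi.single k 1) := by
    ext a b
    by_cases h : a = k
    · subst h
      simp [mixedMatrix, coordProj, Pi.single_apply, Matrix.one_apply, eq_comm]
    · simp [mixedMatrix, coordProj, h, Matrix.updateRow_ne, Matrix.one_apply]
  rw [h2] at h1
  rw [← insert_empty_eq k, add_comm (Matrix.det _), ← h1, Matrix.inv_def, Matrix.smul_apply, Matrix.adjugate_apply, ← h3,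
    Ring.inverse_eq_inv', smul_eq_mul, div_eq_inv_mul]

/-- The signal-to-interference ratio of stream `k` when the streams in `F` have unit power and those
in `S` are nulled out. -/
def sir (W : Matrix n n ℂ) (k : n) (F S : Finset n) : ℝ :=
  (mixedMatrix W F (insert k S)).det.re / (mixedMatrix W F S).det.re

end Minors

/-! ### Complex Gaussian vectors -/

section Gauss

open scoped ENNReal

/-- Density of the gamma law with natural shape parameter. -/
theorem lintegral_gammaMeasure_natCast (a : ℕ) (f : ℝ → ℝ≥0∞) (hf : Measurable f) :
    ∫⁻ x, f x ∂(gammaMeasure (a + 1 : ℕ) 1) =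
      ∫⁻ x in Set.Ioi (0 : ℝ), ENNReal.ofReal (x ^ a / a.factorial * Real.exp (-x)) * f x := by
  rw [gammaMeasure, lintegral_withDensity_eq_lintegral_mul _
    (show Measurable (gammaPDF _ _) from (measurable_gammaPDFReal _ _).ennreal_ofReal) hf,
    ← lintegral_indicator measurableSet_Ioi]
  refine lintegral_congr_ae ?_
  have : ∀ᵐ x : ℝ, x ≠ 0 := by simp [ae_iff, measure_singleton]
  filter_upwards [this] with x hx
  by_cases h : 0 < x
  · rw [Set.indicator_of_mem (Set.mem_Ioi.2 h), Pi.mul_apply, gammaPDF_of_nonneg h.le]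
    congr 2
    rw [show ((a + 1 : ℕ) : ℝ) = (a : ℝ) + 1 by push_cast; ring, Real.Gamma_nat_eq_factorial,
      add_sub_cancel_right, Real.rpow_natCast, Real.one_rpow, one_mul]
    ring
  · have h' : x < 0 := lt_of_le_of_ne (not_lt.1 h) hx
    rw [Set.indicator_of_notMem (by simpa using h), Pi.mul_apply, gammaPDF_of_neg h', zero_mul]

instance (a : ℕ) : IsProbabilityMeasure (gammaMeasure (a + 1 : ℕ) 1) :=
  isProbabilityMeasure_gammaMeasure (by positivity) one_pos

/-- In polar coordinates the angle contributes 2π, and the substitution r ↦ r² turns 2r exp(-r²) dr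
into the exponential density. -/
theorem map_normSq_stdComplexGaussian :
    Measure.map (fun z : ℂ => ‖z‖ ^ 2) stdComplexGaussian = gammaMeasure (0 + 1 : ℕ) 1 := by
  refine Measure.ext_of_lintegral _ fun f hf => ?_
  have hm : Measurable fun z : ℂ => ‖z‖ ^ 2 := by fun_prop
  have hd : Measurable fun z : ℂ => ENNReal.ofReal (Real.pi⁻¹ * Real.exp (-‖z‖ ^ 2)) := by fun_prop
  rw [lintegral_map hf hm, stdComplexGaussian, lintegral_withDensity_eq_lintegral_mul _ hd
    (show Measurable fun z : ℂ => f (‖z‖ ^ 2) from hf.comp hm), lintegral_gammaMeasure_natCast 0 f hf, ← Complex.lintegral_comp_polarCoord_symm]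
  have himg : (fun r : ℝ => r ^ 2) '' Set.Ioi 0 = Set.Ioi 0 := by
    ext y
    constructor
    · rintro ⟨r, hr, rfl⟩
      exact Set.mem_Ioi.2 (by have : 0 < r := hr; positivity)
    · intro hy
      exact ⟨√y, Real.sqrt_pos.2 hy, Real.sq_sqrt (le_of_lt hy)⟩
  have hsub := lintegral_image_eq_lintegral_abs_deriv_mul (s := Set.Ioi (0 : ℝ))
    (f := fun r => r ^ 2) (f' := fun r => 2 * r) measurableSet_Ioi
    (fun x _ => by simpa using (hasDerivAt_pow 2 x).hasDerivWithinAt)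
    (fun x hx y hy h => by
      have hx' : 0 < x := hx
      have hy' : 0 < y := hy
      exact (pow_left_inj₀ hx'.le hy'.le two_ne_zero).1 h)
    (fun x => ENNReal.ofReal (x ^ 0 / (Nat.factorial 0 : ℕ) * Real.exp (-x)) * f x)
  rw [himg] at hsub
  simp only [Pi.mul_apply, Complex.norm_polarCoord_symm, sq_abs]
  rw [hsub, polarCoord_target, Measure.volume_eq_prod, ← Measure.prod_restrict, lintegral_prod]
  · refine setLIntegral_congr_fun measurableSet_Ioi fun r hr => ?_
    have hr' : (0 : ℝ) < r := hr
    simp only [lintegral_const, Measure.restrict_apply_univ, Real.volume_Ioo, smul_eq_mul]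
    rw [← mul_assoc, ← mul_assoc, ← ENNReal.ofReal_mul (abs_nonneg _),
      ← ENNReal.ofReal_mul hr'.le, mul_right_comm, ← ENNReal.ofReal_mul (by positivity)]
    congr 2
    rw [abs_of_pos (by positivity)]
    have := Real.pi_ne_zero
    simp
    field_simp
    ring
  · exact Measurable.aemeasurable (by fun_prop)

instance : IsProbabilityMeasure stdComplexGaussian := by
  have h := congrArg (fun μ : Measure ℝ => μ Set.univ) map_normSq_stdComplexGaussian
  simp only [measure_univ] at h
  rw [Measure.map_apply (by fun_prop) MeasurableSet.univ, Set.preimage_univ] at h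
  exact ⟨h⟩

/-- The law of independent standard complex Gaussians indexed by `κ`. -/
def gauss (κ : Type*) [Fintype κ] : Measure (κ → ℂ) := Measure.pi fun _ => stdComplexGaussian

variable {κ : Type*} [Fintype κ]

instance : IsProbabilityMeasure (gauss κ) := by unfold gauss; infer_instance

theorem gauss_eq_withDensity : gauss κ = volume.withDensity fun z : κ → ℂ =>
    ENNReal.ofReal (Real.pi⁻¹ ^ Fintype.card κ * Real.exp (-∑ i, ‖z i‖ ^ 2)) := by
  refine (Measure.pi_eq fun s hs => ?_)
  have hint : Integrable fun z : ℂ => Real.pi⁻¹ * Real.exp (-‖z‖ ^ 2) := by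
    refine ⟨by fun_prop, ?_⟩
    rw [hasFiniteIntegral_iff_ofReal (ae_of_all _ fun z => by positivity)]
    have := (measure_univ : stdComplexGaussian Set.univ = 1)
    rw [stdComplexGaussian, withDensity_apply _ MeasurableSet.univ, Measure.restrict_univ] at this
    rw [this]; exact ENNReal.one_lt_top
  have key : ∀ z : κ → ℂ, (Set.univ.pi s).indicator
      (fun z => Real.pi⁻¹ ^ Fintype.card κ * Real.exp (-∑ i, ‖z i‖ ^ 2)) z =
      ∏ i, (s i).indicator (fun z : ℂ => Real.pi⁻¹ * Real.exp (-‖z‖ ^ 2)) (z i) := by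
    intro z
    by_cases hz : z ∈ Set.univ.pi s
    · rw [Set.indicator_of_mem hz]
      have : ∀ i, z i ∈ s i := fun i => hz i (Set.mem_univ i)
      simp only [Set.indicator_of_mem (this _)]
      rw [Finset.prod_mul_distrib, Finset.prod_const, Finset.card_univ, ← Real.exp_sum,
        Finset.sum_neg_distrib]
    · rw [Set.indicator_of_notMem hz]
      simp only [Set.mem_pi, Set.mem_univ, true_implies, not_forall] at hz
      obtain ⟨i, hi⟩ := hz
      exact (Finset.prod_eq_zero (Finset.mem_univ i) (Set.indicator_of_notMem hi _)).symm
  have hpos : ∀ (i : κ) (z : ℂ),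
      0 ≤ (s i).indicator (fun z : ℂ => Real.pi⁻¹ * Real.exp (-‖z‖ ^ 2)) z :=
    fun i z => Set.indicator_nonneg (fun _ _ => by positivity) _
  have e1 : ∀ i, stdComplexGaussian (s i) = ENNReal.ofReal
      (∫ z, (s i).indicator (fun z : ℂ => Real.pi⁻¹ * Real.exp (-‖z‖ ^ 2)) z) := by
    intro i
    rw [ofReal_integral_eq_lintegral_ofReal (hint.indicator (hs i)) (ae_of_all _ (hpos i)),
      stdComplexGaussian, withDensity_apply _ (hs i), ← lintegral_indicator (hs i)]
    refine lintegral_congr fun z => ?_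
    by_cases h : z ∈ s i <;> simp [h]
  simp only [e1]
  rw [← ENNReal.ofReal_prod_of_nonneg fun i _ => integral_nonneg (hpos i),
    ← integral_fintype_prod_volume_eq_prod (𝕜 := ℝ) (E := fun _ => ℂ), withDensity_apply _
      (MeasurableSet.univ_pi hs), ← lintegral_indicator (MeasurableSet.univ_pi hs),
    ofReal_integral_eq_lintegral_ofReal]
  · refine lintegral_congr fun z => ?_
    rw [← key z]
    by_cases h : z ∈ Set.univ.pi s <;> simp [h]
  · exact Integrable.fintype_prod (𝕜 := ℝ) fun i => hint.indicator (hs i)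
  · exact ae_of_all _ fun z => Finset.prod_nonneg fun i _ => hpos i _

/-- A real-linear map that preserves the Euclidean norm preserves the Gaussian law. -/
theorem measurePreserving_gauss (L : (κ → ℂ) →ₗ[ℝ] (κ → ℂ))
    (hL : ∀ z, ∑ i, ‖L z i‖ ^ 2 = ∑ i, ‖z i‖ ^ 2) : MeasurePreserving L (gauss κ) (gauss κ) := by
  have hLc : Continuous L := LinearMap.continuous_of_finiteDimensional L
  refine ⟨hLc.measurable, ?_⟩
  have hinj : Function.Injective L := by
    rw [injective_iff_map_eq_zero]
    intro z hz
    have := hL z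
    rw [hz] at this
    simp only [Pi.zero_apply, norm_zero, ne_eq, OfNat.ofNat_ne_zero, not_false_eq_true, zero_pow,
      Finset.sum_const_zero] at this
    have h0 := (Finset.sum_eq_zero_iff_of_nonneg fun i _ => by positivity).1 this.symm
    ext i
    simpa using h0 i (Finset.mem_univ i)
  have hdet : LinearMap.det L ≠ 0 := by
    have := (LinearEquiv.ofInjectiveEndo L hinj).isUnit_det'
    exact this.ne_zero
  have hvol := Measure.map_linearMap_addHaar_eq_smul_addHaar (volume : Measure (κ → ℂ)) hdet
  set c := ENNReal.ofReal |(LinearMap.det L)⁻¹|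
  set g : (κ → ℂ) → ℝ≥0∞ := fun z =>
    ENNReal.ofReal (Real.pi⁻¹ ^ Fintype.card κ * Real.exp (-∑ i, ‖z i‖ ^ 2)) with hg
  have hgm : Measurable g := by fun_prop
  have hmap : Measure.map L (gauss κ) = c • gauss κ := by
    rw [gauss_eq_withDensity]
    ext s hs
    rw [Measure.map_apply hLc.measurable hs, withDensity_apply _ (hLc.measurable hs),
      Measure.smul_apply, withDensity_apply _ hs, ← lintegral_smul_measure,
      ← Measure.restrict_smul, ← hvol, Measure.restrict_map hLc.measurable hs,
      lintegral_map hgm hLc.measurable]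
    simp only [hg, hL]
  -- The Jacobian is never computed: both sides are probability measures, so comparison of total
  -- masses fixes the constant.
  have hc : c = 1 := by
    have := congrArg (fun μ => μ Set.univ) hmap
    simp only [Measure.smul_apply, measure_univ, smul_eq_mul, mul_one] at this
    rw [← this, Measure.map_apply hLc.measurable MeasurableSet.univ, Set.preimage_univ,
      measure_univ]
  rw [hmap, hc, one_smul]

open Classical in
/-- Replacing the coordinates in `A` by an independent copy does not change the law. -/
theorem measurePreserving_resample (A : Set κ) : MeasurePreserving
    (fun p : (κ → ℂ) × (κ → ℂ) => fun i => if i ∈ A then p.2 i else p.1 i)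
    ((gauss κ).prod (gauss κ)) (gauss κ) := by
  have hm : Measurable fun p : (κ → ℂ) × (κ → ℂ) =>
      (fun i => if i ∈ A then p.2 i else p.1 i : κ → ℂ) := by
    refine measurable_pi_lambda _ fun i => ?_
    by_cases h : i ∈ A <;> simp only [h, if_true, if_false] <;> fun_prop
  refine ⟨hm, (Measure.pi_eq fun s hs => ?_).symm⟩
  rw [Measure.map_apply hm (MeasurableSet.univ_pi hs)]
  have : (fun p : (κ → ℂ) × (κ → ℂ) => (fun i => if i ∈ A then p.2 i else p.1 i : κ → ℂ)) ⁻¹'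
      (Set.univ.pi s) = (Set.univ.pi fun i => if i ∈ A then Set.univ else s i) ×ˢ
        (Set.univ.pi fun i => if i ∈ A then s i else Set.univ) := by
    ext p
    simp only [Set.mem_preimage, Set.mem_pi, Set.mem_univ, true_implies, Set.mem_prod]
    rw [← forall_and]
    refine forall_congr' fun i => ?_
    by_cases h : i ∈ A <;> simp [h]
  rw [this, Measure.prod_prod]
  unfold gauss
  rw [Measure.pi_pi, Measure.pi_pi, ← Finset.prod_mul_distrib]
  refine Finset.prod_congr rfl fun i _ => ?_
  by_cases h : i ∈ A <;> simp [h]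

/-- The convolution of a Gamma and an exponential law. After Tonelli the factor exp(-z) comes out
and the inner integral of x^a / a! over (0, z) is z^(a+1)/(a+1)!. -/
theorem lintegral_gammaMeasure_add_exp (a : ℕ) (f : ℝ → ℝ≥0∞) (hf : Measurable f) :
    ∫⁻ x, ∫⁻ y, f (x + y) ∂(gammaMeasure (0 + 1 : ℕ) 1) ∂(gammaMeasure (a + 1 : ℕ) 1) =
      ∫⁻ z, f z ∂(gammaMeasure (a + 1 + 1 : ℕ) 1) := by
  have e1 : ∀ x : ℝ, ∫⁻ y, f (x + y) ∂(gammaMeasure (0 + 1 : ℕ) 1) =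
      ∫⁻ z, (Set.Ioi x).indicator (fun z => ENNReal.ofReal (Real.exp (-(z - x))) * f z) z := by
    intro x
    rw [lintegral_gammaMeasure_natCast 0 _ (by fun_prop), ← lintegral_indicator measurableSet_Ioi]
    conv_rhs => rw [← lintegral_add_left_eq_self (μ := volume) _ x]
    refine lintegral_congr fun y => ?_
    by_cases h : 0 < y
    · simp [h]
    · simp [h]
  have hm1 : Measurable fun p : ℝ × ℝ => ENNReal.ofReal (Real.exp (-(p.2 - p.1))) * f p.2 := by
    fun_prop
  have hms : MeasurableSet {p : ℝ × ℝ | p.1 < p.2} := measurableSet_lt measurable_fst measurable_snd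
  have hm2 : Measurable fun p : ℝ × ℝ =>
      (Set.Ioi p.1).indicator (fun z => ENNReal.ofReal (Real.exp (-(z - p.1))) * f z) p.2 := by
    have : (fun p : ℝ × ℝ => (Set.Ioi p.1).indicator
        (fun z => ENNReal.ofReal (Real.exp (-(z - p.1))) * f z) p.2) =
        {p : ℝ × ℝ | p.1 < p.2}.indicator
          fun p => ENNReal.ofReal (Real.exp (-(p.2 - p.1))) * f p.2 := by
      ext p
      by_cases h : p.1 < p.2 <;> simp [h]
    rw [this]
    exact hm1.indicator hms
  simp only [e1]
  rw [lintegral_gammaMeasure_natCast a _ hm2.lintegral_prod_right',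
    lintegral_gammaMeasure_natCast (a + 1) _ hf]
  have e2 : ∀ x ∈ Set.Ioi (0 : ℝ), ENNReal.ofReal (x ^ a / a.factorial * Real.exp (-x)) *
      ∫⁻ z, (Set.Ioi x).indicator (fun z => ENNReal.ofReal (Real.exp (-(z - x))) * f z) z =
      ∫⁻ z, (Set.Ioi x).indicator
        (fun z => ENNReal.ofReal (x ^ a / a.factorial) * (ENNReal.ofReal (Real.exp (-z)) * f z)) z := by
    intro x hx
    have hx' : (0 : ℝ) < x := hx
    rw [← lintegral_const_mul _ (by
      exact (Measurable.indicator (by fun_prop) measurableSet_Ioi))]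
    refine lintegral_congr fun z => ?_
    by_cases h : z ∈ Set.Ioi x
    · rw [Set.indicator_of_mem h, Set.indicator_of_mem h, ← mul_assoc, ← mul_assoc,
        ← ENNReal.ofReal_mul (by positivity), ← ENNReal.ofReal_mul (by positivity), mul_assoc,
        ← Real.exp_add]
      ring_nf
    · rw [Set.indicator_of_notMem h, Set.indicator_of_notMem h, mul_zero]
  rw [setLIntegral_congr_fun measurableSet_Ioi e2, lintegral_lintegral_swap]
  · rw [← lintegral_indicator measurableSet_Ioi]
    refine lintegral_congr fun z => ?_
    have e3 : ∀ x, (Set.Ioi x).indicator (fun z => ENNReal.ofReal (x ^ a / a.factorial) *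
        (ENNReal.ofReal (Real.exp (-z)) * f z)) z =
        (Set.Iio z).indicator (fun x => ENNReal.ofReal (x ^ a / a.factorial)) x *
        (ENNReal.ofReal (Real.exp (-z)) * f z) := by
      intro x
      by_cases h : x < z <;> simp [h]
    simp only [e3]
    rw [lintegral_mul_const _ (Measurable.indicator (by fun_prop) measurableSet_Iio),
      lintegral_indicator measurableSet_Iio, Measure.restrict_restrict measurableSet_Iio]
    by_cases hz : 0 < z
    · have hset : Set.Iio z ∩ Set.Ioi 0 = Set.Ioo 0 z := by ext; simp [and_comm]
      rw [Set.indicator_of_mem (Set.mem_Ioi.2 hz), hset, ← ofReal_integral_eq_lintegral_ofReal,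
        ← integral_Ioc_eq_integral_Ioo, ← intervalIntegral.integral_of_le hz.le,
        intervalIntegral.integral_div, integral_pow, ← mul_assoc, ← ENNReal.ofReal_mul]
      · congr 2
        rw [Nat.factorial_succ]
        push_cast
        field_simp
        simp
      · have := hz.le
        simp
        positivity
      · refine IntegrableOn.mono_set ?_ Set.Ioo_subset_Icc_self
        exact Continuous.integrableOn_Icc (by fun_prop)
      · filter_upwards [ae_restrict_mem measurableSet_Ioo] with x hx
        have := hx.1.le
        simp only [Pi.zero_apply]
        positivity
    · have hset : Set.Iio z ∩ Set.Ioi 0 = ∅ := by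
        ext x
        simp only [Set.mem_inter_iff, Set.mem_Iio, Set.mem_Ioi, Set.mem_empty_iff_false, iff_false,
          not_and, not_lt]
        intro h; linarith
      rw [hset, Set.indicator_of_notMem (by simpa using hz)]
      simp
  · refine Measurable.aemeasurable ?_
    have : Function.uncurry (fun (x z : ℝ) => (Set.Ioi x).indicator
        (fun z => ENNReal.ofReal (x ^ a / a.factorial) * (ENNReal.ofReal (Real.exp (-z)) * f z)) z) =
        {p : ℝ × ℝ | p.1 < p.2}.indicator fun p => ENNReal.ofReal (p.1 ^ a / a.factorial) *
          (ENNReal.ofReal (Real.exp (-p.2)) * f p.2) := by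
      ext p
      by_cases h : p.1 < p.2 <;> simp [Function.uncurry, h]
    rw [this]
    exact Measurable.indicator (by fun_prop) hms

/-- The squared norms of `d + 1` independent standard complex Gaussians add up to a gamma law. -/
theorem hasLaw_sum_normSq {I : Finset κ} (d : ℕ) (hI : I.card = d + 1) :
    HasLaw (fun z : κ → ℂ => ∑ i ∈ I, ‖z i‖ ^ 2) (gammaMeasure (d + 1 : ℕ) 1) (gauss κ) := by
  classical
  have h1 : ∀ i, HasLaw (fun z : κ → ℂ => ‖z i‖ ^ 2) (gammaMeasure (0 + 1 : ℕ) 1) (gauss κ) := by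
    intro i
    refine ⟨Measurable.aemeasurable (by fun_prop), ?_⟩
    have := (measurePreserving_eval (fun _ : κ => stdComplexGaussian) i).map_eq
    rw [← map_normSq_stdComplexGaussian, ← this, Measure.map_map (by fun_prop) (by fun_prop)]
    rfl
  induction d generalizing I with
  | zero =>
    obtain ⟨i, rfl⟩ := Finset.card_eq_one.1 hI
    simpa using h1 i
  | succ d ih =>
    obtain ⟨j, J, hj, rfl, hJ⟩ := Finset.card_eq_succ.1 hI
    have hind : iIndepFun (fun (i : κ) (z : κ → ℂ) => ‖z i‖ ^ 2) (gauss κ) :=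
      iIndepFun_pi (X := fun (_ : κ) (z : ℂ) => ‖z‖ ^ 2) fun i => Measurable.aemeasurable (by fun_prop)
    have hind2 := hind.indepFun_finsetSum_of_notMem (fun i => by fun_prop) hj
    refine ⟨Measurable.aemeasurable (by fun_prop), ?_⟩
    have hprod := (indepFun_iff_map_prod_eq_prod_map_map
      (Measurable.aemeasurable (by fun_prop)) (Measurable.aemeasurable (by fun_prop))).1 hind2
    have hJ' := (ih hJ).map_eq
    have e : (∑ i ∈ J, fun z : κ → ℂ => ‖z i‖ ^ 2) = fun z => ∑ i ∈ J, ‖z i‖ ^ 2 := by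
      ext z; simp
    rw [e, hJ', (h1 j).map_eq] at hprod
    refine Measure.ext_of_lintegral _ fun f hf => ?_
    rw [lintegral_map hf (by fun_prop), ← lintegral_gammaMeasure_add_exp d f hf,
      ← lintegral_prod (fun p : ℝ × ℝ => f (p.1 + p.2)) (Measurable.aemeasurable (by fun_prop)),
      ← hprod, lintegral_map (by fun_prop) (by fun_prop)]
    refine lintegral_congr fun z => ?_
    rw [Finset.sum_insert hj, add_comm]

open scoped Matrix

theorem ofReal_sum_normSq (z : κ → ℂ) : ((∑ i, ‖z i‖ ^ 2 : ℝ) : ℂ) = star z ⬝ᵥ z := by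
  simp only [dotProduct, Pi.star_apply, RCLike.star_def, Complex.conj_mul']
  push_cast; rfl

theorem sum_normSq_mulVec_of_unitary [DecidableEq κ] {U : Matrix κ κ ℂ} (hU : Uᴴ * U = 1)
    (z : κ → ℂ) : ∑ i, ‖(U *ᵥ z) i‖ ^ 2 = ∑ i, ‖z i‖ ^ 2 := by
  have : ((∑ i, ‖(U *ᵥ z) i‖ ^ 2 : ℝ) : ℂ) = ((∑ i, ‖z i‖ ^ 2 : ℝ) : ℂ) := by
    rw [ofReal_sum_normSq, ofReal_sum_normSq, Matrix.star_mulVec, ← Matrix.dotProduct_mulVec,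
      Matrix.mulVec_mulVec, hU, Matrix.one_mulVec]
  exact_mod_cast this

theorem measurePreserving_mulVec_gauss [DecidableEq κ] {U : Matrix κ κ ℂ} (hU : Uᴴ * U = 1) :
    MeasurePreserving (fun z : κ → ℂ => U *ᵥ z) (gauss κ) (gauss κ) :=
  measurePreserving_gauss ((Matrix.toLin' U).restrictScalars ℝ)
    fun z => sum_normSq_mulVec_of_unitary hU z

/-- Unitary diagonalisation of a Hermitian form. -/
theorem exists_unitary_quadForm_eq [DecidableEq κ] {C : Matrix κ κ ℂ} (hC : C.IsHermitian) :
    ∃ U : Matrix κ κ ℂ, Uᴴ * U = 1 ∧ ∀ z : κ → ℂ, star z ⬝ᵥ C *ᵥ z =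
      ((∑ i, hC.eigenvalues i * ‖(U *ᵥ z) i‖ ^ 2 : ℝ) : ℂ) := by
  set U : Matrix κ κ ℂ := (hC.eigenvectorUnitary : Matrix κ κ ℂ) with hU
  have hUU' : U * Uᴴ = 1 := by
    have := Unitary.coe_mul_star_self hC.eigenvectorUnitary
    simpa [hU, Matrix.star_eq_conjTranspose] using this
  have hspec : U * Matrix.diagonal (fun i => (hC.eigenvalues i : ℂ)) * Uᴴ = C := by
    have := hC.spectral_theorem
    simpa [Unitary.conjStarAlgAut_apply, hU, Matrix.star_eq_conjTranspose, Function.comp_def]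
      using this.symm
  refine ⟨Uᴴ, by rwa [Matrix.conjTranspose_conjTranspose], fun z => ?_⟩
  have : star z ⬝ᵥ C *ᵥ z = star (Uᴴ *ᵥ z) ⬝ᵥ
      Matrix.diagonal (fun i => (hC.eigenvalues i : ℂ)) *ᵥ (Uᴴ *ᵥ z) := by
    conv_lhs => rw [← hspec]
    rw [Matrix.star_mulVec, Matrix.conjTranspose_conjTranspose, ← Matrix.dotProduct_mulVec,
      Matrix.mulVec_mulVec, Matrix.mulVec_mulVec, Matrix.mul_assoc]
  rw [this, dotProduct, Complex.ofReal_sum]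
  refine Finset.sum_congr rfl fun i _ => ?_
  rw [Matrix.mulVec_diagonal, Pi.star_apply, RCLike.star_def, mul_left_comm, Complex.conj_mul']
  push_cast
  rfl

theorem eigenvalues_of_mul_self [DecidableEq κ] {C : Matrix κ κ ℂ} (hC : C.IsHermitian)
    (hC2 : C * C = C) (i : κ) : hC.eigenvalues i = 0 ∨ hC.eigenvalues i = 1 := by
  have h1 := hC.mulVec_eigenvectorBasis i
  set v : κ → ℂ := (hC.eigenvectorBasis i).ofLp with hv
  have h2 : C *ᵥ (C *ᵥ v) = C *ᵥ v := by rw [Matrix.mulVec_mulVec, hC2]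
  have hv0 : v ≠ 0 := by
    intro h
    have := hC.eigenvectorBasis.orthonormal.ne_zero i
    exact this (by ext j; exact congrFun h j)
  rw [h1, Matrix.mulVec_smul, h1, smul_smul] at h2
  have h3 := smul_left_injective ℝ hv0 h2
  rcases eq_or_ne (hC.eigenvalues i) 0 with h | h
  · exact Or.inl h
  · exact Or.inr (mul_left_cancel₀ h (by simpa using h3))

/-- The quadratic form of an orthogonal projection of rank `d + 1`, at a Gaussian vector. -/
theorem hasLaw_quadForm_proj [DecidableEq κ] {C : Matrix κ κ ℂ} (hC : C.IsHermitian)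
    (hC2 : C * C = C) (d : ℕ) (htr : C.trace = (d + 1 : ℕ)) :
    HasLaw (fun z : κ → ℂ => (star z ⬝ᵥ C *ᵥ z).re) (gammaMeasure (d + 1 : ℕ) 1) (gauss κ) := by
  obtain ⟨U, hU, hquad⟩ := exists_unitary_quadForm_eq hC
  have h01 := eigenvalues_of_mul_self hC hC2
  set I : Finset κ := Finset.univ.filter fun i => hC.eigenvalues i = 1 with hI
  -- The eigenvalues of a projection are 0 or 1, so the trace counts the ones.
  have hcard : I.card = d + 1 := by
    have e : C.trace = ∑ i, (hC.eigenvalues i : ℂ) := hC.trace_eq_sum_eigenvalues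
    rw [htr] at e
    have e2 : ∑ i, (hC.eigenvalues i : ℂ) = ∑ i, if hC.eigenvalues i = 1 then (1 : ℂ) else 0 := by
      refine Finset.sum_congr rfl fun i _ => ?_
      rcases h01 i with h | h <;> simp [h]
    rw [e2, Finset.sum_boole] at e
    exact_mod_cast e.symm
  have hmp := measurePreserving_mulVec_gauss hU
  have hlaw := hasLaw_sum_normSq d hcard
  have hfun : (fun z : κ → ℂ => (star z ⬝ᵥ C *ᵥ z).re) =
      (fun z : κ → ℂ => ∑ i ∈ I, ‖z i‖ ^ 2) ∘ fun z => U *ᵥ z := by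
    ext z
    rw [hquad, Complex.ofReal_re, Function.comp, hI, Finset.sum_filter]
    refine Finset.sum_congr rfl fun i _ => ?_
    rcases h01 i with h | h <;> simp [h]
  rw [hfun]
  refine ⟨(Measurable.aemeasurable (by fun_prop)).comp_measurable hmp.measurable, ?_⟩
  rw [← Measure.map_map (by fun_prop) hmp.measurable, hmp.map_eq, hlaw.map_eq]

end Gauss

/-! ### Averaging over a pair of streams -/

section PairAverage

open scoped ENNReal Matrix ComplexOrder

instance matrixMeasurableSpace {m n : Type*} : MeasurableSpace (Matrix m n ℂ) :=
  inferInstanceAs (MeasurableSpace (m → n → ℂ))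

instance matrixBorelSpace {m n : Type*} [Finite m] [Finite n] : BorelSpace (Matrix m n ℂ) :=
  haveI := Fintype.ofFinite m
  haveI := Fintype.ofFinite n
  inferInstanceAs (BorelSpace (m → n → ℂ))

instance matrixSecondCountable {m n : Type*} [Finite m] [Finite n] :
    SecondCountableTopology (Matrix m n ℂ) :=
  haveI := Fintype.ofFinite m
  haveI := Fintype.ofFinite n
  inferInstanceAs (SecondCountableTopology (m → n → ℂ))

/-- Distribution function of the uniform law on `[l, u]`. -/
def uniformCdf (l u a : ℝ) : ℝ := if a < l then 0 else if u ≤ a then 1 else (a - l) / (u - l)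

/-- The thresholds belonging to a stream that is nulled out, present, or absent. -/
theorem uniformCdf_mix {l u x : ℝ} (hl : 0 < l) (hlu : l ≤ u) (hx : 0 < x) :
    uniformCdf l u ((x * (l + u + 1) - l * u) / (1 + x)) =
      x / (1 + x) * uniformCdf l u (l + u - l * u / x) + 1 / (1 + x) * uniformCdf l u x := by
  have hx1 : 0 < 1 + x := by linarith
  -- The threshold on the left is the convex combination of the two on the right, with the same
  -- weights. By `e1`–`e4` all three thresholds lie on the same side of l, and of u, as x does;
  -- between l and u the distribution function is affine, so the combination passes through it.
  have key : (x * (l + u + 1) - l * u) / (1 + x) =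
      x / (1 + x) * (l + u - l * u / x) + 1 / (1 + x) * x := by
    field_simp
    ring
  have e1 : l + u - l * u / x - l = u * (x - l) / x := by field_simp; ring
  have e2 : l + u - l * u / x - u = l * (x - u) / x := by field_simp; ring
  have e3 : (x * (l + u + 1) - l * u) / (1 + x) - l = (x - l) * (1 + u) / (1 + x) := by
    field_simp; ring
  have e4 : (x * (l + u + 1) - l * u) / (1 + x) - u = (x - u) * (1 + l) / (1 + x) := by
    field_simp; ring
  have hu : 0 < u := hl.trans_le hlu
  unfold uniformCdf
  rcases lt_or_ge x l with h | h
  · have h1 : l + u - l * u / x < l := by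
      have : u * (x - l) / x < 0 := div_neg_of_neg_of_pos (by nlinarith) hx
      linarith
    have h2 : (x * (l + u + 1) - l * u) / (1 + x) < l := by
      have : (x - l) * (1 + u) / (1 + x) < 0 := div_neg_of_neg_of_pos (by nlinarith) hx1
      linarith
    rw [if_pos h, if_pos h1, if_pos h2]; ring
  · have h1 : l ≤ l + u - l * u / x := by
      have : 0 ≤ u * (x - l) / x := div_nonneg (by nlinarith) hx.le
      linarith
    have h2 : l ≤ (x * (l + u + 1) - l * u) / (1 + x) := by
      have : 0 ≤ (x - l) * (1 + u) / (1 + x) := div_nonneg (by nlinarith) hx1.le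
      linarith
    rw [if_neg h.not_gt, if_neg h1.not_gt, if_neg h2.not_gt]
    rcases le_or_gt u x with h' | h'
    · have h3 : u ≤ l + u - l * u / x := by
        have : 0 ≤ l * (x - u) / x := div_nonneg (by nlinarith) hx.le
        linarith
      have h4 : u ≤ (x * (l + u + 1) - l * u) / (1 + x) := by
        have : 0 ≤ (x - u) * (1 + l) / (1 + x) := div_nonneg (by nlinarith) hx1.le
        linarith
      rw [if_pos h', if_pos h3, if_pos h4]
      field_simp
      ring
    · have h3 : l + u - l * u / x < u := by
        have : l * (x - u) / x < 0 := div_neg_of_neg_of_pos (by nlinarith) hx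
        linarith
      have h4 : (x * (l + u + 1) - l * u) / (1 + x) < u := by
        have : (x - u) * (1 + l) / (1 + x) < 0 := div_neg_of_neg_of_pos (by nlinarith) hx1
        linarith
      rw [if_neg h'.not_ge, if_neg h3.not_ge, if_neg h4.not_ge, key]
      have hd : u - l ≠ 0 := by linarith
      field_simp
      ring

theorem gammaMeasure_one_Iic {t : ℝ} (ht : 0 ≤ t) :
    gammaMeasure (0 + 1 : ℕ) 1 (Set.Iic t) = ENNReal.ofReal (1 - Real.exp (-t)) := by
  have h := cdf_expMeasure_eq one_pos t
  have := isProbabilityMeasure_expMeasure one_pos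
  rw [cdf_eq_real, if_pos ht, one_mul] at h
  rw [← h, ofReal_measureReal, expMeasure, zero_add, Nat.cast_one]

theorem gammaMeasure_Iio_zero (a : ℕ) : gammaMeasure (a + 1 : ℕ) 1 (Set.Iic 0) = 0 := by
  rw [← lintegral_indicator_one measurableSet_Iic, lintegral_gammaMeasure_natCast _ _
    (measurable_one.indicator measurableSet_Iic)]
  rw [setLIntegral_congr_fun (g := fun _ => 0) measurableSet_Ioi, lintegral_zero]
  intro x hx
  have : (0 : ℝ) < x := hx
  simp [this]

/-- Two independent standard exponentials: `P(β Y ≤ α X) = α / (α + β)`. -/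
theorem exp_prod_le {α β : ℝ} (hα : 0 ≤ α) (hβ : 0 < β) :
    ((gammaMeasure (0 + 1 : ℕ) 1).prod (gammaMeasure (0 + 1 : ℕ) 1))
      {p : ℝ × ℝ | β * p.2 ≤ α * p.1} = ENNReal.ofReal (α / (α + β)) := by
  have hms : MeasurableSet {p : ℝ × ℝ | β * p.2 ≤ α * p.1} :=
    measurableSet_le (by fun_prop) (by fun_prop)
  rw [Measure.prod_apply hms, lintegral_gammaMeasure_natCast _ _ (measurable_measure_prodMk_left hms)]
  have e : ∀ x ∈ Set.Ioi (0 : ℝ), ENNReal.ofReal (x ^ 0 / (Nat.factorial 0 : ℕ) * Real.exp (-x)) *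
      gammaMeasure (0 + 1 : ℕ) 1 (Prod.mk x ⁻¹' {p : ℝ × ℝ | β * p.2 ≤ α * p.1}) =
      ENNReal.ofReal (Real.exp (-1 * x) - Real.exp (-(1 + α / β) * x)) := by
    intro x hx
    have hx' : (0 : ℝ) < x := hx
    have hset : Prod.mk x ⁻¹' {p : ℝ × ℝ | β * p.2 ≤ α * p.1} = Set.Iic (α / β * x) := by
      ext y
      simp only [Set.mem_preimage, Set.mem_ofPred_eq, Set.mem_Iic]
      rw [div_mul_eq_mul_div, le_div_iff₀ hβ, mul_comm]
    rw [hset, gammaMeasure_one_Iic (by positivity), ← ENNReal.ofReal_mul (by positivity)]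
    congr 1
    rw [mul_sub, pow_zero, Nat.factorial_zero, Nat.cast_one, div_one, one_mul, mul_one,
      ← Real.exp_add]
    ring_nf
  rw [setLIntegral_congr_fun measurableSet_Ioi e]
  have hc : 0 < 1 + α / β := by positivity
  have i1 : IntegrableOn (fun x : ℝ => Real.exp (-1 * x)) (Set.Ioi 0) :=
    integrableOn_exp_mul_Ioi (by norm_num) 0
  have i2 : IntegrableOn (fun x : ℝ => Real.exp (-(1 + α / β) * x)) (Set.Ioi 0) :=
    integrableOn_exp_mul_Ioi (by linarith) 0
  rw [← ofReal_integral_eq_lintegral_ofReal (f := fun x => Real.exp (-1 * x) -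
    Real.exp (-(1 + α / β) * x)) (i1.sub i2), integral_sub i1 i2,
    integral_exp_mul_Ioi (by norm_num), integral_exp_mul_Ioi (by linarith)]
  · have h3 : -1 / -(1 + α / β) = β / (α + β) := by
      rw [neg_div_neg_eq, div_eq_div_iff hc.ne' (by positivity)]
      field_simp
      ring
    rw [mul_zero, mul_zero, Real.exp_zero, h3]
    congr 1
    field_simp
    ring
  · filter_upwards [ae_restrict_mem measurableSet_Ioi] with x hx
    have hx' : (0 : ℝ) < x := hx
    simp only [Pi.zero_apply, sub_nonneg]
    refine Real.exp_le_exp.2 ?_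
    have : 0 ≤ α / β := by positivity
    nlinarith

variable {κ : Type*} [Fintype κ]

theorem hasLaw_pair_normSq {i j : κ} (hij : i ≠ j) :
    HasLaw (fun z : κ → ℂ => (‖z i‖ ^ 2, ‖z j‖ ^ 2))
      ((gammaMeasure (0 + 1 : ℕ) 1).prod (gammaMeasure (0 + 1 : ℕ) 1)) (gauss κ) := by
  have h1 : ∀ i, HasLaw (fun z : κ → ℂ => ‖z i‖ ^ 2) (gammaMeasure (0 + 1 : ℕ) 1) (gauss κ) := by
    intro i
    simpa using hasLaw_sum_normSq (I := {i}) 0 (by simp)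
  have hind : iIndepFun (fun (i : κ) (z : κ → ℂ) => ‖z i‖ ^ 2) (gauss κ) :=
    iIndepFun_pi (X := fun (_ : κ) (z : ℂ) => ‖z‖ ^ 2) fun i => Measurable.aemeasurable (by fun_prop)
  refine ⟨Measurable.aemeasurable (by fun_prop), ?_⟩
  rw [(indepFun_iff_map_prod_eq_prod_map_map (Measurable.aemeasurable (by fun_prop))
    (Measurable.aemeasurable (by fun_prop))).1 (hind.indepFun hij), (h1 i).map_eq, (h1 j).map_eq]

/-- For l ≤ a < u the event reads (u - a) Y ≤ (a - l) X with independent exponentials X and Y, whose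
probability is (a - l)/(u - l). For l = u this branch is empty, so the zero denominator never
occurs. -/
theorem gauss_pair_le {i j : κ} (hij : i ≠ j) {l u : ℝ} (hlu : l ≤ u) (a : ℝ) :
    (gauss κ).real {z | l * ‖z i‖ ^ 2 + u * ‖z j‖ ^ 2 ≤ a * (‖z i‖ ^ 2 + ‖z j‖ ^ 2)} =
      uniformCdf l u a := by
  have hlaw := hasLaw_pair_normSq hij
  have hms : MeasurableSet {p : ℝ × ℝ | l * p.1 + u * p.2 ≤ a * (p.1 + p.2)} :=
    measurableSet_le (by fun_prop) (by fun_prop)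
  have hm := hlaw.measure_eq hms
  rw [measureReal_def, hm]
  set γ := gammaMeasure (0 + 1 : ℕ) 1
  have hpos : ∀ᵐ p : ℝ × ℝ ∂(γ.prod γ), 0 < p.1 ∧ 0 < p.2 := by
    have h0 : ∀ᵐ x : ℝ ∂γ, 0 < x := by
      rw [ae_iff]
      simp only [not_lt]
      exact gammaMeasure_Iio_zero 0
    exact (Measure.quasiMeasurePreserving_fst.ae h0).and (Measure.quasiMeasurePreserving_snd.ae h0)
  unfold uniformCdf
  split_ifs with h1 h2
  · rw [ENNReal.toReal_eq_zero_iff]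
    left
    refine measure_mono_null ?_ (ae_iff.1 hpos)
    intro p hp hpp
    have hp' : l * p.1 + u * p.2 ≤ a * (p.1 + p.2) := hp
    nlinarith [hpp.1, hpp.2]
  · have : (γ.prod γ) {p : ℝ × ℝ | l * p.1 + u * p.2 ≤ a * (p.1 + p.2)} = 1 := by
      rw [← prob_compl_eq_zero_iff hms]
      refine measure_mono_null ?_ (ae_iff.1 hpos)
      intro p hp hpp
      refine hp ?_
      show l * p.1 + u * p.2 ≤ a * (p.1 + p.2)
      nlinarith [hpp.1, hpp.2]
    rw [this]; rfl
  · have hset : {p : ℝ × ℝ | l * p.1 + u * p.2 ≤ a * (p.1 + p.2)} =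
        {p : ℝ × ℝ | (u - a) * p.2 ≤ (a - l) * p.1} := by
      ext p
      simp only [Set.mem_ofPred_eq]
      constructor <;> intro h <;> linarith
    have ha : 0 ≤ a - l := by linarith
    have hb : 0 < u - a := by linarith
    rw [hset, exp_prod_le ha hb, ENNReal.toReal_ofReal (by positivity)]
    congr 1
    ring

/-- The ratio `z† V z / |z|²` of a Hermitian `2 × 2` form at a Gaussian vector is uniformly
distributed between the two eigenvalues of `V`. -/
theorem exists_gauss_rayleigh_le {V : Matrix (Fin 2) (Fin 2) ℂ} (hV : V.IsHermitian)
    (hdet : 0 < V.det.re) (htr : 0 < V.trace.re) :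
    ∃ l u : ℝ, 0 < l ∧ l ≤ u ∧ V.trace.re = l + u ∧ V.det.re = l * u ∧
      ∀ a : ℝ, (gauss (Fin 2)).real {z | (star z ⬝ᵥ V *ᵥ z).re ≤ a * ∑ i, ‖z i‖ ^ 2} =
        uniformCdf l u a := by
  obtain ⟨U, hU, hquad⟩ := exists_unitary_quadForm_eq hV
  have ht : V.trace.re = hV.eigenvalues 0 + hV.eigenvalues 1 := by
    rw [hV.trace_eq_sum_eigenvalues]; simp
  have hd : V.det.re = hV.eigenvalues 0 * hV.eigenvalues 1 := by
    rw [hV.det_eq_prod_eigenvalues]; simp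
  have hmp := measurePreserving_mulVec_gauss hU
  have hm : ∀ a : ℝ, (gauss (Fin 2)).real {z | (star z ⬝ᵥ V *ᵥ z).re ≤ a * ∑ i, ‖z i‖ ^ 2} =
      (gauss (Fin 2)).real {z | hV.eigenvalues 0 * ‖z 0‖ ^ 2 + hV.eigenvalues 1 * ‖z 1‖ ^ 2 ≤
        a * (‖z 0‖ ^ 2 + ‖z 1‖ ^ 2)} := by
    intro a
    conv_rhs => rw [← hmp.measureReal_preimage
      (measurableSet_le (by fun_prop) (by fun_prop)).nullMeasurableSet]
    congr 1
    ext z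
    have := sum_normSq_mulVec_of_unitary hU z
    simp only [Fin.sum_univ_two] at this
    simp only [Set.mem_ofPred_eq, Set.mem_preimage, hquad, Complex.ofReal_re, Fin.sum_univ_two, this]
  have hp0 : 0 < hV.eigenvalues 0 := by nlinarith
  have hp1 : 0 < hV.eigenvalues 1 := by nlinarith
  rcases le_total (hV.eigenvalues 0) (hV.eigenvalues 1) with h | h
  · refine ⟨_, _, hp0, h, ht, hd, fun a => ?_⟩
    rw [hm, gauss_pair_le (by simp) h]
  · refine ⟨_, _, hp1, h, by rw [ht, add_comm], by rw [hd, mul_comm], fun a => ?_⟩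
    rw [hm, ← gauss_pair_le (κ := Fin 2) (i := 1) (j := 0) (by simp) h]
    congr 1
    ext z
    simp only [Set.mem_ofPred_eq]
    rw [add_comm (hV.eigenvalues 0 * _), add_comm (‖z 0‖ ^ 2)]

variable {n m : Type*} [Fintype n] [DecidableEq n] [Fintype m] [DecidableEq m]

theorem conjTranspose_submatrix_mul_mul {α : Type*} (H : Matrix m n ℂ) (C : Matrix m m ℂ)
    (f : α → n) : (H.submatrix id f)ᴴ * C * H.submatrix id f = (Hᴴ * C * H).submatrix f f := by
  ext a b
  simp [Matrix.mul_apply]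

theorem posDef_det_eq_ofReal {W : Matrix n n ℂ} (hW : W.PosDef) (F S : Finset n) :
    (mixedMatrix W F S).det = ((mixedMatrix W F S).det.re : ℂ) ∧
      0 < (mixedMatrix W F S).det.re := by
  have h := det_mixedMatrix_pos hW F S
  rw [Complex.lt_def] at h
  exact ⟨Complex.ext (by simp) (by simpa using h.2.symm), by simpa using h.1⟩

theorem det_mixedMatrix_insert_right (H : Matrix m n ℂ) {F S : Finset n} {k : n}
    (hk : k ∉ S ∪ F) (hM : (mixedMatrix (Hᴴ * H) F S).det ≠ 0) :
    (mixedMatrix (Hᴴ * H) F (insert k S)).det =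
      (mixedMatrix (Hᴴ * H) F S).det * (Hᴴ * residualForm H F S * H) k k := by
  have h := det_mixedMatrix_union H (f := fun _ : Unit => k) (fun _ _ _ => rfl) (fun _ => hk) hM
  rw [conjTranspose_submatrix_mul_mul, Matrix.det_unique (n := Unit)] at h
  rw [Matrix.submatrix_apply] at h
  rw [← h]
  congr 3
  ext
  simp

/-- With s = D(F, S), adding k, i, or both to S multiplies s by V₀₀, V₁₁ and det V, the Gram
determinants of the residual form. Letting i interfere adds the determinants with i in S and with i
absent, so all three ratios are rational in these entries and s cancels. -/
theorem sir_pair {H : Matrix m n ℂ} (hW : (Hᴴ * H).PosDef) {F S : Finset n} {k i : n}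
    (hki : k ≠ i) (hk : k ∉ S ∪ F) (hi : i ∉ S ∪ F)
    {V : Matrix (Fin 2) (Fin 2) ℂ}
    (hV : V = (Hᴴ * residualForm H F S * H).submatrix ![k, i] ![k, i]) :
    0 < (V 0 0).re ∧ 0 < (V 1 1).re ∧ 0 < V.det.re ∧
      sir (Hᴴ * H) k (insert i F) S = (V.det.re + (V 0 0).re) / ((V 1 1).re + 1) ∧
      sir (Hᴴ * H) k F (insert i S) = V.det.re / (V 1 1).re ∧
      sir (Hᴴ * H) k F S = (V 0 0).re := by
  obtain ⟨hs, hs0⟩ := posDef_det_eq_ofReal hW F S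
  set s := (mixedMatrix (Hᴴ * H) F S).det.re
  have hM : (mixedMatrix (Hᴴ * H) F S).det ≠ 0 := by
    rw [hs]; exact_mod_cast hs0.ne'
  have h1 := det_mixedMatrix_insert_right H hk hM
  have h2 := det_mixedMatrix_insert_right H hi hM
  have h3 := det_mixedMatrix_union H (F := F) (S := S) (f := ![k, i])
    (by intro a b; fin_cases a <;> fin_cases b <;> simp [hki, hki.symm])
    (by intro a; fin_cases a; exacts [hk, hi]) hM
  rw [conjTranspose_submatrix_mul_mul, ← hV] at h3
  have e3 : S ∪ Finset.univ.image ![k, i] = insert k (insert i S) := by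
    ext j
    simp only [Finset.mem_union, Finset.mem_image, Finset.mem_univ, true_and, Finset.mem_insert,
      Fin.exists_fin_two, Matrix.cons_val_zero, Matrix.cons_val_one]
    tauto
  rw [e3] at h3
  have e1 : (Hᴴ * residualForm H F S * H) k k = V 0 0 := by rw [hV]; simp
  have e2 : (Hᴴ * residualForm H F S * H) i i = V 1 1 := by rw [hV]; simp
  rw [e1, hs] at h1
  rw [e2, hs] at h2
  rw [hs] at h3
  have r1 := congrArg Complex.re h1
  have r2 := congrArg Complex.re h2
  have r3 := congrArg Complex.re h3
  rw [Complex.re_ofReal_mul] at r1 r2 r3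
  have p1 := (posDef_det_eq_ofReal hW F (insert k S)).2
  have p2 := (posDef_det_eq_ofReal hW F (insert i S)).2
  have p3 := (posDef_det_eq_ofReal hW F (insert k (insert i S))).2
  rw [r1] at p1
  rw [r2] at p2
  rw [r3] at p3
  have q1 := pos_of_mul_pos_right p1 hs0.le
  have q2 := pos_of_mul_pos_right p2 hs0.le
  have q3 := pos_of_mul_pos_right p3 hs0.le
  simp only [Finset.mem_union, not_or] at hk hi
  have a1 := congrArg Complex.re (det_mixedMatrix_insert (Hᴴ * H) hi.1 hi.2)
  have a2 := congrArg Complex.re (det_mixedMatrix_insert (Hᴴ * H) (F := F) (S := insert k S) (i := i)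
    (by simp [hki.symm, hi.1]) hi.2)
  rw [Complex.add_re] at a1 a2
  rw [Finset.insert_comm] at a2
  refine ⟨q1, q2, q3, ?_, ?_, ?_⟩
  · unfold sir
    rw [a1, a2, r1, r2, r3, show (mixedMatrix (Hᴴ * H) F S).det.re = s from rfl]
    field_simp
  · unfold sir
    rw [r2, r3]
    field_simp
  · unfold sir
    rw [r1, show (mixedMatrix (Hᴴ * H) F S).det.re = s from rfl]
    field_simp

/-- The element of `SU(2)` with first column `(a, b)`. -/
def pairUnitary (a b : ℂ) : Matrix (Fin 2) (Fin 2) ℂ :=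
  !![a, -(starRingEnd ℂ) b; b, (starRingEnd ℂ) a]

theorem pairUnitary_conjTranspose_mul_self {a b : ℂ} (h : ‖a‖ ^ 2 + ‖b‖ ^ 2 = 1) :
    (pairUnitary a b)ᴴ * pairUnitary a b = 1 := by
  have h' : (starRingEnd ℂ) a * a + (starRingEnd ℂ) b * b = 1 := by
    rw [Complex.conj_mul', Complex.conj_mul']; exact_mod_cast h
  ext i j
  fin_cases i <;> fin_cases j <;>
    simp [pairUnitary, Matrix.mul_apply, Fin.sum_univ_two]
  · exact h'
  · ring
  · ring
  · linear_combination h'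

/-- `pairUnitary a b` acting on the two coordinates selected by `f`. -/
def embedPair (f : Fin 2 → n) (a b : ℂ) : Matrix n n ℂ :=
  1 + selection f * (pairUnitary a b - 1) * (selection f)ᴴ

theorem embedPair_conjTranspose_mul_self {f : Fin 2 → n} (hf : f.Injective) {a b : ℂ}
    (h : ‖a‖ ^ 2 + ‖b‖ ^ 2 = 1) : (embedPair f a b)ᴴ * embedPair f a b = 1 := by
  have hP := selection_conjTranspose_mul_self hf
  have hu := pairUnitary_conjTranspose_mul_self h
  unfold embedPair
  generalize selection f = P at *
  generalize pairUnitary a b = u at *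
  have e : (1 + P * (u - 1) * Pᴴ)ᴴ * (1 + P * (u - 1) * Pᴴ) =
      1 + P * ((uᴴ - 1) + (u - 1) + (uᴴ - 1) * (Pᴴ * P) * (u - 1)) * Pᴴ := by
    simp only [Matrix.conjTranspose_add, Matrix.conjTranspose_mul, Matrix.conjTranspose_one,
      Matrix.conjTranspose_sub, Matrix.conjTranspose_conjTranspose, Matrix.mul_add,
      Matrix.add_mul, Matrix.mul_assoc, Matrix.one_mul, Matrix.mul_one]
    abel
  have e2 : (uᴴ - 1) + (u - 1) + (uᴴ - 1) * (1 : Matrix (Fin 2) (Fin 2) ℂ) * (u - 1) =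
      uᴴ * u - 1 := by noncomm_ring
  rw [e, hP, e2, hu, sub_self, Matrix.mul_zero, Matrix.zero_mul, add_zero]

theorem embedPair_mul_coordProj {f : Fin 2 → n} {s : Finset n} (h : ∀ a, f a ∉ s) (a b : ℂ) :
    embedPair f a b * coordProj s = coordProj s := by
  have := congrArg Matrix.conjTranspose (coordProj_mul_selection h)
  rw [Matrix.conjTranspose_mul, coordProj_isHermitian, Matrix.conjTranspose_zero] at this
  rw [embedPair, Matrix.add_mul, Matrix.mul_assoc, this, Matrix.mul_zero, add_zero, Matrix.one_mul]

theorem embedPair_mul_selection {f : Fin 2 → n} (hf : f.Injective) (a b : ℂ) :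
    embedPair f a b * selection f = selection f * pairUnitary a b := by
  rw [embedPair, Matrix.add_mul, Matrix.mul_assoc, selection_conjTranspose_mul_self hf,
    Matrix.mul_one, Matrix.one_mul, Matrix.mul_sub, Matrix.mul_one, add_sub_cancel]

/-- The rotation fixes every column in S ∪ F, hence the residual form. Its only effect is a unitary
conjugation of the 2 × 2 matrix V. -/
theorem residualForm_mul_embedPair (H : Matrix m n ℂ) {F S : Finset n} {f : Fin 2 → n}
    (hf : f.Injective) (hfs : ∀ a, f a ∉ S ∪ F) (a b : ℂ) :
    ((H * embedPair f a b)ᴴ * residualForm (H * embedPair f a b) F S *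
      (H * embedPair f a b)).submatrix f f = (pairUnitary a b)ᴴ *
        (Hᴴ * residualForm H F S * H).submatrix f f * pairUnitary a b := by
  have h1 : residualForm (H * embedPair f a b) F S = residualForm H F S :=
    residualForm_congr (by rw [Matrix.mul_assoc, embedPair_mul_coordProj hfs])
  rw [← conjTranspose_submatrix_mul_mul, ← conjTranspose_submatrix_mul_mul, h1,
    ← mul_selection, ← mul_selection, Matrix.mul_assoc H, embedPair_mul_selection hf]
  simp only [Matrix.conjTranspose_mul, Matrix.mul_assoc]

theorem pairUnitary_conj_entries {V : Matrix (Fin 2) (Fin 2) ℂ} {a b : ℂ}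
    (h : ‖a‖ ^ 2 + ‖b‖ ^ 2 = 1) :
    ((pairUnitary a b)ᴴ * V * pairUnitary a b) 0 0 = star ![a, b] ⬝ᵥ V *ᵥ ![a, b] ∧
    ((pairUnitary a b)ᴴ * V * pairUnitary a b) 1 1 = V.trace - star ![a, b] ⬝ᵥ V *ᵥ ![a, b] ∧
    ((pairUnitary a b)ᴴ * V * pairUnitary a b).det = V.det := by
  have hu := pairUnitary_conjTranspose_mul_self h
  have h0 : ((pairUnitary a b)ᴴ * V * pairUnitary a b) 0 0 = star ![a, b] ⬝ᵥ V *ᵥ ![a, b] := by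
    simp [pairUnitary, Matrix.mul_apply, Fin.sum_univ_two, dotProduct, Matrix.mulVec]
    ring
  refine ⟨h0, ?_, ?_⟩
  · have ht : ((pairUnitary a b)ᴴ * V * pairUnitary a b).trace = V.trace := by
      rw [Matrix.mul_assoc, Matrix.trace_mul_comm, Matrix.mul_assoc,
        mul_eq_one_comm.1 hu, Matrix.mul_one]
    rw [Matrix.trace_fin_two] at ht
    rw [← ht, ← h0]; ring
  · rw [Matrix.det_mul, Matrix.det_mul, mul_right_comm, ← Matrix.det_mul, hu, Matrix.det_one,
      one_mul]

end PairAverage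

/-! ### Trading an interfering stream for a nulled or an absent one -/

section PairStep

open scoped ENNReal Matrix ComplexOrder

variable {n m : Type*} [Fintype n] [DecidableEq n] [Fintype m] [DecidableEq m]

theorem measurable_mixedMatrix_det (F S : Finset n) :
    Measurable fun W : Matrix n n ℂ => (mixedMatrix W F S).det := by
  refine Continuous.measurable ?_
  unfold mixedMatrix
  fun_prop

theorem measurable_sir (k : n) (F S : Finset n) :
    Measurable fun W : Matrix n n ℂ => sir W k F S := by
  unfold sir
  have h1 := measurable_mixedMatrix_det F (insert k S)
  have h2 := measurable_mixedMatrix_det F S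
  exact (Complex.measurable_re.comp h1).div (Complex.measurable_re.comp h2)

theorem measurable_gramMatrix : Measurable fun H : Matrix m n ℂ => Hᴴ * H :=
  Continuous.measurable (by fun_prop)

/-- The `SU(2)` rotation, in the coordinates `f`, whose first column is proportional to `z`. -/
def rotationTo (f : Fin 2 → n) (z : Fin 2 → ℂ) : Matrix n n ℂ :=
  embedPair f (((√(∑ i, ‖z i‖ ^ 2))⁻¹ : ℝ) * z 0) (((√(∑ i, ‖z i‖ ^ 2))⁻¹ : ℝ) * z 1)

theorem sum_normSq_pos {κ : Type*} [Fintype κ] {z : κ → ℂ} (hz : z ≠ 0) :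
    0 < ∑ i, ‖z i‖ ^ 2 := by
  obtain ⟨i, hi⟩ := Function.ne_iff.1 hz
  exact Finset.sum_pos' (fun _ _ => by positivity)
    ⟨i, Finset.mem_univ i, by have := norm_pos_iff.2 hi; positivity⟩

theorem rotationTo_normSq {z : Fin 2 → ℂ} (hz : z ≠ 0) :
    ‖(((√(∑ i, ‖z i‖ ^ 2))⁻¹ : ℝ) : ℂ) * z 0‖ ^ 2 + ‖(((√(∑ i, ‖z i‖ ^ 2))⁻¹ : ℝ) : ℂ) * z 1‖ ^ 2 =
      1 := by
  have h := sum_normSq_pos hz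
  rw [norm_mul, norm_mul, mul_pow, mul_pow, ← mul_add, Complex.norm_real, Real.norm_eq_abs, sq_abs,
    inv_pow, Real.sq_sqrt h.le, Fin.sum_univ_two]
  rw [Fin.sum_univ_two] at h
  exact inv_mul_cancel₀ h.ne'

theorem measurable_rotationTo (f : Fin 2 → n) : Measurable (rotationTo f) := by
  have h : Measurable fun p : ℂ × ℂ => embedPair f p.1 p.2 := by
    refine Continuous.measurable ?_
    unfold embedPair
    have : Continuous fun p : ℂ × ℂ => pairUnitary p.1 p.2 := by
      unfold pairUnitary
      refine continuous_matrix fun i j => ?_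
      fin_cases i <;> fin_cases j <;> simp <;> fun_prop
    fun_prop
  exact h.comp (f := fun z : Fin 2 → ℂ => ((((√(∑ i, ‖z i‖ ^ 2))⁻¹ : ℝ) : ℂ) * z 0,
    (((√(∑ i, ‖z i‖ ^ 2))⁻¹ : ℝ) : ℂ) * z 1)) (by fun_prop)

theorem gauss_ae_ne_zero {κ : Type*} [Fintype κ] [Nonempty κ] : ∀ᵐ z ∂gauss κ, z ≠ 0 := by
  obtain ⟨i⟩ := ‹Nonempty κ›
  have h := hasLaw_sum_normSq (κ := κ) (I := {i}) 0 (by simp)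
  have h2 := h.measure_eq (p := fun x => x ≤ 0) measurableSet_Iic
  rw [ae_iff]
  refine measure_mono_null (fun z hz => ?_) (h2.trans (gammaMeasure_Iio_zero 0))
  simp only [ne_eq, not_not, Set.mem_ofPred_eq] at hz
  subst hz
  simp

/-- A unitarily invariant law may be averaged over the rotations in two coordinates. -/
theorem measure_eq_lintegral_rotation {μ : Measure (Matrix m n ℂ)} [IsProbabilityMeasure μ]
    (hinv : ∀ U : Matrix n n ℂ, Uᴴ * U = 1 → MeasurePreserving (fun H => H * U) μ μ)
    {f : Fin 2 → n} (hf : f.Injective) {A : Set (Matrix m n ℂ)} (hA : MeasurableSet A) :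
    MeasurableSet {p : Matrix m n ℂ × (Fin 2 → ℂ) | p.1 * rotationTo f p.2 ∈ A} ∧
    μ A = ∫⁻ H, gauss (Fin 2) {z | H * rotationTo f z ∈ A} ∂μ := by
  have hmeas : Measurable fun p : Matrix m n ℂ × (Fin 2 → ℂ) => p.1 * rotationTo f p.2 := by
    have : Measurable fun p : Matrix m n ℂ × Matrix n n ℂ => p.1 * p.2 :=
      Continuous.measurable (by fun_prop)
    exact this.comp (measurable_fst.prodMk ((measurable_rotationTo f).comp measurable_snd))
  have hms := hmeas hA
  refine ⟨hms, ?_⟩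
  have e1 : (μ.prod (gauss (Fin 2))) {p | p.1 * rotationTo f p.2 ∈ A} =
      ∫⁻ H, gauss (Fin 2) {z | H * rotationTo f z ∈ A} ∂μ := Measure.prod_apply hms
  have e2 : (μ.prod (gauss (Fin 2))) {p | p.1 * rotationTo f p.2 ∈ A} =
      ∫⁻ z, μ {H | H * rotationTo f z ∈ A} ∂gauss (Fin 2) := Measure.prod_apply_symm hms
  rw [← e1, e2]
  -- The vector z = 0 gives no unitary matrix, since its normalisation is the default inverse of 0,
  -- but it has measure zero.
  have e3 : ∀ᵐ z ∂gauss (Fin 2), μ {H | H * rotationTo f z ∈ A} = μ A := by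
    filter_upwards [gauss_ae_ne_zero] with z hz
    exact (hinv _ (embedPair_conjTranspose_mul_self hf (rotationTo_normSq hz))).measure_preimage
      hA.nullMeasurableSet
  rw [lintegral_congr_ae e3, lintegral_const, measure_univ, mul_one]

theorem posDef_mul_unitary {H : Matrix m n ℂ} (hW : (Hᴴ * H).PosDef) {U : Matrix n n ℂ}
    (hU : Uᴴ * U = 1) : ((H * U)ᴴ * (H * U)).PosDef := by
  have : (H * U)ᴴ * (H * U) = Uᴴ * (Hᴴ * H) * U := by
    simp only [Matrix.conjTranspose_mul, Matrix.mul_assoc]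
  rw [this]
  refine hW.conjTranspose_mul_mul_same fun x y hxy => ?_
  have := congrArg (Uᴴ *ᵥ ·) hxy
  simpa [Matrix.mulVec_mulVec, hU] using this

/-- With H fixed and z random, let q be the Rayleigh quotient of V at z. Trace and determinant of V
are invariant, so the three ratios are (lu + q)/(l + u - q + 1), lu/(l + u - q) and q. Each
increases with q, so each event is q ≤ threshold. As q is uniform on [l, u], `uniformCdf_mix`
concludes. -/
theorem gauss_sir_step {H : Matrix m n ℂ} (hW : (Hᴴ * H).PosDef) {F S : Finset n} {k i : n}
    (hki : k ≠ i) (hk : k ∉ S ∪ F) (hi : i ∉ S ∪ F) {x : ℝ} (hx : 0 < x) :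
    gauss (Fin 2) {z | H * rotationTo ![k, i] z ∈
        {H : Matrix m n ℂ | sir (Hᴴ * H) k (insert i F) S ≤ x}} =
      ENNReal.ofReal (x / (1 + x)) * gauss (Fin 2) {z | H * rotationTo ![k, i] z ∈
        {H : Matrix m n ℂ | sir (Hᴴ * H) k F (insert i S) ≤ x}} +
      ENNReal.ofReal (1 / (1 + x)) * gauss (Fin 2) {z | H * rotationTo ![k, i] z ∈
        {H : Matrix m n ℂ | sir (Hᴴ * H) k F S ≤ x}} := by
  have hf : Function.Injective ![k, i] := by
    intro a b; fin_cases a <;> fin_cases b <;> simp [hki, hki.symm]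
  have hfs : ∀ a, ![k, i] a ∉ S ∪ F := by intro a; fin_cases a; exacts [hk, hi]
  obtain ⟨V, hV⟩ : ∃ V, V = (Hᴴ * residualForm H F S * H).submatrix ![k, i] ![k, i] := ⟨_, rfl⟩
  have hVh : V.IsHermitian := by
    rw [hV]
    refine Matrix.IsHermitian.submatrix ?_ _
    unfold Matrix.IsHermitian
    simp only [Matrix.conjTranspose_mul, Matrix.conjTranspose_conjTranspose, residualForm_isHermitian,
      Matrix.mul_assoc]
  obtain ⟨v0, v1, vd, -, -, -⟩ := sir_pair hW hki hk hi hV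
  have htr : V.trace.re = (V 0 0).re + (V 1 1).re := by rw [Matrix.trace_fin_two, Complex.add_re]
  obtain ⟨l, u, hl, hlu, ht, hd, hcdf⟩ := exists_gauss_rayleigh_le hVh vd (by rw [htr]; positivity)
  have key : ∀ z : Fin 2 → ℂ, z ≠ 0 →
      0 < (l + u) * (∑ i, ‖z i‖ ^ 2) - (star z ⬝ᵥ V *ᵥ z).re ∧
      sir ((H * rotationTo ![k, i] z)ᴴ * (H * rotationTo ![k, i] z)) k (insert i F) S =
        (l * u + (star z ⬝ᵥ V *ᵥ z).re / ∑ i, ‖z i‖ ^ 2) /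
          (l + u - (star z ⬝ᵥ V *ᵥ z).re / (∑ i, ‖z i‖ ^ 2) + 1) ∧
      sir ((H * rotationTo ![k, i] z)ᴴ * (H * rotationTo ![k, i] z)) k F (insert i S) =
        (l * u) / (l + u - (star z ⬝ᵥ V *ᵥ z).re / (∑ i, ‖z i‖ ^ 2)) ∧
      sir ((H * rotationTo ![k, i] z)ᴴ * (H * rotationTo ![k, i] z)) k F S =
        (star z ⬝ᵥ V *ᵥ z).re / ∑ i, ‖z i‖ ^ 2 := by
    intro z hz
    have hr := sum_normSq_pos hz
    have hn := rotationTo_normSq hz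
    have hpd := posDef_mul_unitary hW (embedPair_conjTranspose_mul_self hf hn)
    obtain ⟨p0, p1, p2⟩ := pairUnitary_conj_entries (V := V) hn
    have hV' := residualForm_mul_embedPair H hf hfs
      ((((√(∑ i, ‖z i‖ ^ 2))⁻¹ : ℝ) : ℂ) * z 0) ((((√(∑ i, ‖z i‖ ^ 2))⁻¹ : ℝ) : ℂ) * z 1)
    rw [← hV] at hV'
    obtain ⟨-, s1, -, s2, s3, s4⟩ := sir_pair hpd hki hk hi hV'.symm
    have hvec : ![(((√(∑ i, ‖z i‖ ^ 2))⁻¹ : ℝ) : ℂ) * z 0, (((√(∑ i, ‖z i‖ ^ 2))⁻¹ : ℝ) : ℂ) * z 1]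
        = (((√(∑ i, ‖z i‖ ^ 2))⁻¹ : ℝ) : ℂ) • z := by
      ext j; fin_cases j <;> simp
    have hQ : (star ![(((√(∑ i, ‖z i‖ ^ 2))⁻¹ : ℝ) : ℂ) * z 0,
        (((√(∑ i, ‖z i‖ ^ 2))⁻¹ : ℝ) : ℂ) * z 1] ⬝ᵥ V *ᵥ ![(((√(∑ i, ‖z i‖ ^ 2))⁻¹ : ℝ) : ℂ) * z 0,
        (((√(∑ i, ‖z i‖ ^ 2))⁻¹ : ℝ) : ℂ) * z 1]).re =
        (star z ⬝ᵥ V *ᵥ z).re / ∑ i, ‖z i‖ ^ 2 := by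
      rw [hvec, Matrix.mulVec_smul, star_smul, smul_dotProduct, dotProduct_smul, smul_smul,
        RCLike.star_def, Complex.conj_ofReal, smul_eq_mul, ← Complex.ofReal_mul,
        Complex.re_ofReal_mul, ← mul_inv, Real.mul_self_sqrt hr.le, inv_mul_eq_div]
    rw [p1] at s1
    rw [p0, p1, p2] at s2
    rw [p1, p2] at s3
    rw [p0, hQ] at s4
    rw [Complex.sub_re, hQ, ht] at s1 s2 s3
    rw [hd] at s2 s3
    refine ⟨?_, s2, s3, s4⟩
    rw [sub_pos, div_lt_iff₀ hr] at s1
    linarith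
  have hset : ∀ (A : Set (Matrix m n ℂ)) (a : ℝ), (∀ z : Fin 2 → ℂ, z ≠ 0 →
      (H * rotationTo ![k, i] z ∈ A ↔ (star z ⬝ᵥ V *ᵥ z).re ≤ a * ∑ i, ‖z i‖ ^ 2)) →
      gauss (Fin 2) {z | H * rotationTo ![k, i] z ∈ A} = ENNReal.ofReal (uniformCdf l u a) := by
    intro A a hA
    rw [← hcdf a, ofReal_measureReal]
    refine measure_congr ?_
    filter_upwards [gauss_ae_ne_zero] with z hz
    exact propext (hA z hz)
  have hx1 : 0 < 1 + x := by linarith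
  have hnn : ∀ a, 0 ≤ uniformCdf l u a := fun a => by rw [← hcdf]; exact measureReal_nonneg
  -- The thresholds come from solving each of the three ratios = x for q.
  rw [hset _ ((x * (l + u + 1) - l * u) / (1 + x)), hset _ (l + u - l * u / x), hset _ x,
    uniformCdf_mix hl hlu hx, ENNReal.ofReal_add (mul_nonneg (by positivity) (hnn _))
    (mul_nonneg (by positivity) (hnn _)), ENNReal.ofReal_mul (by positivity),
    ENNReal.ofReal_mul (by positivity)]
  · intro z hz
    obtain ⟨k1, -, -, k4⟩ := key z hz
    have hr := sum_normSq_pos hz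
    rw [Set.mem_ofPred_eq, k4, div_le_iff₀ hr]
  · intro z hz
    obtain ⟨k1, -, k3, -⟩ := key z hz
    have hr := sum_normSq_pos hz
    have k1' : 0 < l + u - (star z ⬝ᵥ V *ᵥ z).re / (∑ i, ‖z i‖ ^ 2) := by
      rw [sub_pos, div_lt_iff₀ hr]; linarith
    rw [Set.mem_ofPred_eq, k3, div_le_iff₀ k1', ← div_le_iff₀ hr, ← div_le_iff₀' hx]
    constructor <;> intro h <;> linarith
  · intro z hz
    obtain ⟨k1, k2, -, -⟩ := key z hz
    have hr := sum_normSq_pos hz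
    have k1' : 0 < l + u - (star z ⬝ᵥ V *ᵥ z).re / (∑ i, ‖z i‖ ^ 2) + 1 := by
      have : 0 < l + u - (star z ⬝ᵥ V *ᵥ z).re / (∑ i, ‖z i‖ ^ 2) := by
        rw [sub_pos, div_lt_iff₀ hr]; linarith
      linarith
    rw [Set.mem_ofPred_eq, k2, div_le_iff₀ k1', ← div_le_iff₀ hr, le_div_iff₀ hx1]
    constructor <;> intro h <;> linarith

/-- One interfering stream of unit power may be replaced, in the distribution function at `x`, by a
stream nulled out with probability `x / (1 + x)` and absent otherwise. -/
theorem measure_sir_step {μ : Measure (Matrix m n ℂ)} [IsProbabilityMeasure μ]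
    (hinv : ∀ U : Matrix n n ℂ, Uᴴ * U = 1 → MeasurePreserving (fun H => H * U) μ μ)
    (hpd : ∀ᵐ H ∂μ, (Hᴴ * H).PosDef) {F S : Finset n} {k i : n}
    (hki : k ≠ i) (hk : k ∉ S ∪ F) (hi : i ∉ S ∪ F) {x : ℝ} (hx : 0 < x) :
    μ {H | sir (Hᴴ * H) k (insert i F) S ≤ x} =
      ENNReal.ofReal (x / (1 + x)) * μ {H | sir (Hᴴ * H) k F (insert i S) ≤ x} +
      ENNReal.ofReal (1 / (1 + x)) * μ {H | sir (Hᴴ * H) k F S ≤ x} := by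
  have hf : Function.Injective ![k, i] := by
    intro a b; fin_cases a <;> fin_cases b <;> simp [hki, hki.symm]
  have hms : ∀ F S : Finset n, MeasurableSet {H : Matrix m n ℂ | sir (Hᴴ * H) k F S ≤ x} :=
    fun F S => measurableSet_le ((measurable_sir k F S).comp measurable_gramMatrix) measurable_const
  obtain ⟨-, e1⟩ := measure_eq_lintegral_rotation hinv hf (hms (insert i F) S)
  obtain ⟨m2, e2⟩ := measure_eq_lintegral_rotation hinv hf (hms F (insert i S))
  obtain ⟨m3, e3⟩ := measure_eq_lintegral_rotation hinv hf (hms F S)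
  have m2' : Measurable fun H : Matrix m n ℂ => gauss (Fin 2) {z | H * rotationTo ![k, i] z ∈
      {H : Matrix m n ℂ | sir (Hᴴ * H) k F (insert i S) ≤ x}} := measurable_measure_prodMk_left m2
  have m3' : Measurable fun H : Matrix m n ℂ => gauss (Fin 2) {z | H * rotationTo ![k, i] z ∈
      {H : Matrix m n ℂ | sir (Hᴴ * H) k F S ≤ x}} := measurable_measure_prodMk_left m3
  rw [e1, e2, e3, ← lintegral_const_mul _ m2', ← lintegral_const_mul _ m3',
    ← lintegral_add_left (m2'.const_mul _)]
  refine lintegral_congr_ae ?_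
  filter_upwards [hpd] with H hH
  exact gauss_sir_step hH hki hk hi hx

/-- All interfering streams of unit power replaced by streams that are nulled out or absent. -/
theorem measure_sir_eq_sum {μ : Measure (Matrix m n ℂ)} [IsProbabilityMeasure μ]
    (hinv : ∀ U : Matrix n n ℂ, Uᴴ * U = 1 → MeasurePreserving (fun H => H * U) μ μ)
    (hpd : ∀ᵐ H ∂μ, (Hᴴ * H).PosDef) {k : n} {x : ℝ} (hx : 0 < x) (F S : Finset n)
    (hk : k ∉ S ∪ F) (hFS : Disjoint S F) :
    μ {H | sir (Hᴴ * H) k F S ≤ x} = ∑ T ∈ F.powerset,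
      ENNReal.ofReal ((x / (1 + x)) ^ T.card * (1 / (1 + x)) ^ (F.card - T.card)) *
        μ {H | sir (Hᴴ * H) k ∅ (S ∪ T) ≤ x} := by
  have hx1 : 0 < 1 + x := by linarith
  induction F using Finset.induction_on generalizing S with
  | empty => simp
  | insert i F hiF ih =>
    rw [Finset.disjoint_insert_right] at hFS
    have hk' : k ∉ S ∪ F ∧ k ≠ i := by
      simp only [Finset.mem_union, Finset.mem_insert, not_or] at hk ⊢; tauto
    rw [measure_sir_step hinv hpd hk'.2 hk'.1 (by simp [hFS.1, hiF]) hx,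
      ih (insert i S) (by
        simp only [Finset.mem_union, Finset.mem_insert, not_or] at hk ⊢; tauto)
        (by rw [Finset.disjoint_insert_left]; exact ⟨hiF, hFS.2⟩), ih S hk'.1 hFS.2,
      Finset.sum_powerset_insert hiF, add_comm, Finset.mul_sum, Finset.mul_sum]
    congr 1
    · refine Finset.sum_congr rfl fun T hT => ?_
      have hc := Finset.card_le_card (Finset.mem_powerset.1 hT)
      rw [← mul_assoc, ← ENNReal.ofReal_mul (by positivity), Finset.card_insert_of_notMem hiF,
        Nat.succ_sub hc, pow_succ]
      ring_nf
    · refine Finset.sum_congr rfl fun T hT => ?_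
      have hiT : i ∉ T := fun h => hiF (Finset.mem_powerset.1 hT h)
      rw [← mul_assoc, ← ENNReal.ofReal_mul (by positivity), Finset.card_insert_of_notMem hiF,
        Finset.card_insert_of_notMem hiT, Nat.succ_sub_succ, pow_succ, Finset.union_insert,
        Finset.insert_union]
      ring_nf

end PairStep

/-! ### Products of Gaussian matrices -/

section Ginibre

open scoped ENNReal Matrix ComplexOrder

theorem hasLaw_gauss_comp {κ κ' : Type*} [Fintype κ] [Fintype κ'] {e : κ' → κ}
    (he : e.Injective) : HasLaw (fun (z : κ → ℂ) i => z (e i)) (gauss κ') (gauss κ) := by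
  have hind : iIndepFun (fun (i : κ) (z : κ → ℂ) => z i) (gauss κ) :=
    iIndepFun_pi (X := fun (_ : κ) (z : ℂ) => z) fun i => Measurable.aemeasurable (by fun_prop)
  have h2 := hind.precomp he
  refine ⟨Measurable.aemeasurable (by fun_prop), ?_⟩
  rw [iIndepFun_iff_map_fun_eq_pi_map (fun i => Measurable.aemeasurable (by fun_prop))] at h2
  refine h2.trans ?_
  unfold gauss
  congr 1
  ext1 i
  exact (measurePreserving_eval (fun _ : κ => stdComplexGaussian) (e i)).map_eq

theorem map_gauss_pair {κ κ₁ κ₂ : Type*} [Fintype κ] [Fintype κ₁] [Fintype κ₂] {e₁ : κ₁ → κ}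
    {e₂ : κ₂ → κ} (h : (Sum.elim e₁ e₂).Injective) :
    (gauss κ).map (fun z => ((fun i => z (e₁ i)), (fun i => z (e₂ i)))) =
      (gauss κ₁).prod (gauss κ₂) := by
  have h1 := (hasLaw_gauss_comp h).map_eq
  have h2 := (measurePreserving_sumPiEquivProdPi
    (fun _ : κ₁ ⊕ κ₂ => stdComplexGaussian)).map_eq
  rw [show Measure.pi (fun _ : κ₁ ⊕ κ₂ => stdComplexGaussian) = gauss (κ₁ ⊕ κ₂) from rfl, ← h1,
    Measure.map_map (by fun_prop) (by fun_prop)] at h2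
  exact h2

variable {m p n : Type*} [Fintype m] [DecidableEq m] [Fintype p] [DecidableEq p] [Fintype n]
  [DecidableEq n]

/-- The matrix with entries `z (i, j)`. -/
def entryMatrix (z : m × p → ℂ) : Matrix m p ℂ := Matrix.of fun i j => z (i, j)

theorem measurable_entryMatrix : Measurable (entryMatrix : (m × p → ℂ) → Matrix m p ℂ) :=
  measurable_pi_lambda _ fun i => measurable_pi_lambda _ fun j => measurable_pi_apply (i, j)

/-- The law of a matrix with independent standard complex Gaussian entries. -/
def ginibre (m p : Type*) [Fintype m] [Fintype p] : Measure (Matrix m p ℂ) :=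
  (gauss (m × p)).map entryMatrix

instance : IsProbabilityMeasure (ginibre m p) :=
  Measure.isProbabilityMeasure_map measurable_entryMatrix.aemeasurable

theorem lintegral_ginibre {f : Matrix m p ℂ → ℝ≥0∞} (hf : Measurable f) :
    ∫⁻ G, f G ∂ginibre m p = ∫⁻ z, f (entryMatrix z) ∂gauss (m × p) :=
  lintegral_map hf measurable_entryMatrix

/-- Right multiplication acts on each row by the unitary matrix Uᵀ, so it preserves the sum of all
squared moduli. -/
theorem measurePreserving_ginibre_mul {U : Matrix p p ℂ} (hU : Uᴴ * U = 1) :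
    MeasurePreserving (fun G => G * U) (ginibre m p) (ginibre m p) := by
  have hUt : (Uᵀ)ᴴ * Uᵀ = 1 := by
    change (Uᴴ)ᵀ * Uᵀ = 1
    rw [← Matrix.transpose_mul, mul_eq_one_comm.1 hU, Matrix.transpose_one]
  let L : (m × p → ℂ) →ₗ[ℝ] (m × p → ℂ) :=
    { toFun := fun z q => ∑ l, z (q.1, l) * U l q.2
      map_add' := fun z w => by ext q; simp [add_mul, Finset.sum_add_distrib]
      map_smul' := fun c z => by ext q; simp [mul_assoc, Finset.mul_sum] }
  have hL : ∀ z, ∑ i, ‖L z i‖ ^ 2 = ∑ i, ‖z i‖ ^ 2 := by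
    intro z
    rw [Fintype.sum_prod_type, Fintype.sum_prod_type]
    refine Finset.sum_congr rfl fun i _ => ?_
    rw [← sum_normSq_mulVec_of_unitary hUt fun l => z (i, l)]
    refine Finset.sum_congr rfl fun j _ => ?_
    simp [L, Matrix.mulVec, dotProduct, mul_comm]
  have hmp := measurePreserving_gauss L hL
  have hm : Measurable fun G : Matrix m p ℂ => G * U := Continuous.measurable (by fun_prop)
  refine ⟨hm, ?_⟩
  rw [ginibre, Measure.map_map hm measurable_entryMatrix]
  conv_rhs => rw [← hmp.map_eq, Measure.map_map measurable_entryMatrix hmp.measurable]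
  rfl

theorem measurable_updateCol (c : p) :
    Measurable fun q : Matrix m p ℂ × (m → ℂ) => q.1.updateCol c q.2 := by
  refine Continuous.measurable ?_
  exact continuous_fst.matrix_updateCol c continuous_snd

/-- One column of a Gaussian matrix may be replaced by an independent Gaussian vector. -/
theorem lintegral_ginibre_updateCol (c : p) {f : Matrix m p ℂ → ℝ≥0∞} (hf : Measurable f) :
    ∫⁻ G, f G ∂ginibre m p = ∫⁻ G, ∫⁻ g, f (G.updateCol c g) ∂gauss m ∂ginibre m p := by
  classical
  have hmp := measurePreserving_resample (κ := m × p) {q | q.2 = c}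
  have hfe : Measurable fun z : m × p → ℂ => f (entryMatrix z) := hf.comp measurable_entryMatrix
  have hcol := hasLaw_gauss_comp (e := fun i : m => (i, c)) fun i j h => (Prod.ext_iff.1 h).1
  have hfu := hf.comp (measurable_updateCol (m := m) c)
  rw [lintegral_ginibre hf, ← hmp.lintegral_comp hfe]
  refine (lintegral_prod _ (hfe.comp hmp.measurable).aemeasurable).trans ?_
  refine Eq.trans ?_ (lintegral_ginibre hfu.lintegral_prod_right').symm
  refine lintegral_congr fun z => ?_
  rw [← hcol.map_eq]
  refine Eq.trans ?_ (lintegral_map (hfu.comp measurable_prodMk_left) (by fun_prop)).symm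
  refine lintegral_congr fun w => ?_
  simp only [Function.comp]
  congr 1
  ext i j
  by_cases h : j = c
  · subst h; simp [entryMatrix]
  · simp [entryMatrix, h]

theorem exists_unitary_mulVec_single [Nonempty p] {v : p → ℂ} (hv : v ≠ 0) (c : p) :
    ∃ U : Matrix p p ℂ, Uᴴ * U = 1 ∧
      Uᴴ *ᵥ v = Pi.single c ((√(∑ i, ‖v i‖ ^ 2) : ℝ) : ℂ) := by
  have hpos := sum_normSq_pos hv
  set r : ℝ := √(∑ i, ‖v i‖ ^ 2) with hr
  have hr0 : 0 < r := Real.sqrt_pos.2 hpos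
  set w : EuclideanSpace ℂ p := WithLp.toLp 2 (((r⁻¹ : ℝ) : ℂ) • v) with hw
  have hwn : ‖w‖ = 1 := by
    rw [EuclideanSpace.norm_eq]
    simp only [hw, Pi.smul_apply, smul_eq_mul, norm_mul, mul_pow, ← Finset.mul_sum]
    rw [Complex.norm_real, Real.norm_eq_abs, sq_abs, inv_pow, hr, Real.sq_sqrt hpos.le,
      inv_mul_cancel₀ hpos.ne', Real.sqrt_one]
  have hon : Orthonormal ℂ (({c} : Set p).domRestrict fun _ : p => w) := by
    refine ⟨fun i => hwn, fun i j hij => ?_⟩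
    exact absurd (Subsingleton.elim i j) hij
  obtain ⟨b, hb⟩ := hon.exists_orthonormalBasis_extension_of_card_eq (by simp)
  set U : Matrix p p ℂ := Matrix.of fun i j => (b j).ofLp i with hU
  have hUU : Uᴴ * U = 1 := by
    ext i j
    have h1 := orthonormal_iff_ite.1 b.orthonormal i j
    rw [EuclideanSpace.inner_eq_star_dotProduct] at h1
    rw [Matrix.one_apply, ← h1]
    simp [hU, Matrix.mul_apply, dotProduct, mul_comm]
  refine ⟨U, hUU, ?_⟩
  have hv' : v = (r : ℂ) • (U *ᵥ Pi.single c 1) := by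
    rw [Matrix.mulVec_single_one]
    have hbc := hb c rfl
    ext i
    have : (U.col c) i = ((r⁻¹ : ℝ) : ℂ) * v i := by
      simp [hU, Matrix.col, hbc, hw]
    have hrc : (r : ℂ) ≠ 0 := by exact_mod_cast hr0.ne'
    rw [Pi.smul_apply, this, smul_eq_mul, Complex.ofReal_inv, mul_inv_cancel_left₀ hrc]
  conv_lhs => rw [hv']
  rw [Matrix.mulVec_smul, Matrix.mulVec_mulVec, hUU, Matrix.one_mulVec]
  ext i
  by_cases h : i = c
  · subst h; simp
  · simp [h]

/-- Without interferers the residual form is the orthogonal projection onto the complement of the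
span of the columns in S. This is the half saying that it kills those columns; idempotence follows.
-/
theorem residualForm_mul (H : Matrix m n ℂ) {S : Finset n}
    (h : (mixedMatrix (Hᴴ * H) ∅ S).det ≠ 0) :
    residualForm H ∅ S * (H * coordProj S) = 0 := by
  have hu : IsUnit (symmMixedMatrix (Hᴴ * H) ∅ S).det := by
    rw [← det_mixedMatrix]; exact isUnit_iff_ne_zero.2 h
  have hc := symmMixedMatrix_inv_comm hu
  have e : coordProj S * Hᴴ * H * coordProj S = symmMixedMatrix (Hᴴ * H) ∅ S - coordProj Sᶜ := by
    unfold symmMixedMatrix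
    rw [Finset.union_empty]
    simp only [Matrix.mul_assoc]
    abel
  have hJ : coordProj S * coordProj Sᶜ = 0 := coordProj_disjoint disjoint_compl_right
  unfold residualForm
  rw [Finset.union_empty] at *
  calc _ = H * coordProj S - H * coordProj S * (symmMixedMatrix (Hᴴ * H) ∅ S)⁻¹ *
        (coordProj S * Hᴴ * H * coordProj S) := by
        simp only [Matrix.sub_mul, Matrix.one_mul, Matrix.mul_assoc]
    _ = H * ((symmMixedMatrix (Hᴴ * H) ∅ S)⁻¹ * coordProj S * coordProj Sᶜ) := by
        rw [e, Matrix.mul_sub, Matrix.mul_assoc _ _ (symmMixedMatrix (Hᴴ * H) ∅ S),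
          Matrix.nonsing_inv_mul _ hu, Matrix.mul_one, sub_sub_cancel, hc]
        simp only [Matrix.mul_assoc]
    _ = 0 := by rw [Matrix.mul_assoc _ (coordProj S), hJ, Matrix.mul_zero, Matrix.mul_zero]

theorem residualForm_idem (H : Matrix m n ℂ) {S : Finset n}
    (h : (mixedMatrix (Hᴴ * H) ∅ S).det ≠ 0) :
    residualForm H ∅ S * residualForm H ∅ S = residualForm H ∅ S := by
  have h1 := residualForm_mul H h
  conv_lhs => rw [show residualForm H ∅ S * residualForm H ∅ S = residualForm H ∅ S *
    (1 - H * coordProj (S ∪ ∅) * (symmMixedMatrix (Hᴴ * H) ∅ S)⁻¹ * coordProj (S ∪ ∅) * Hᴴ) from rfl]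
  rw [Finset.union_empty, Matrix.mul_sub, Matrix.mul_one]
  simp only [← Matrix.mul_assoc] at h1 ⊢
  rw [h1]
  simp

theorem trace_coordProj (S : Finset n) : (coordProj S).trace = S.card := by
  simp [coordProj, Matrix.trace_diagonal]

/-- The subtracted term is a projection onto |S| independent columns, and cyclicity of the trace
reduces it to the trace of `coordProj S`. This supplies the shape parameter of the Gamma law. -/
theorem residualForm_trace (H : Matrix m n ℂ) {S : Finset n}
    (h : (mixedMatrix (Hᴴ * H) ∅ S).det ≠ 0) :
    (residualForm H ∅ S).trace = Fintype.card m - S.card := by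
  have hu : IsUnit (symmMixedMatrix (Hᴴ * H) ∅ S).det := by
    rw [← det_mixedMatrix]; exact isUnit_iff_ne_zero.2 h
  have hc := symmMixedMatrix_inv_comm hu
  have e : coordProj S * Hᴴ * H * coordProj S = symmMixedMatrix (Hᴴ * H) ∅ S - coordProj Sᶜ := by
    unfold symmMixedMatrix
    rw [Finset.union_empty]
    simp only [Matrix.mul_assoc]
    abel
  have hJ : coordProj S * coordProj Sᶜ = 0 := coordProj_disjoint disjoint_compl_right
  unfold residualForm
  rw [Finset.union_empty] at *
  rw [Matrix.trace_sub, Matrix.trace_one]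
  congr 1
  have e1 : (H * coordProj S * (symmMixedMatrix (Hᴴ * H) ∅ S)⁻¹ * coordProj S * Hᴴ).trace =
      ((symmMixedMatrix (Hᴴ * H) ∅ S)⁻¹ * (coordProj S * Hᴴ * H * coordProj S)).trace := by
    rw [Matrix.mul_assoc (H * coordProj S), Matrix.mul_assoc (H * coordProj S),
      Matrix.trace_mul_comm]
    simp only [Matrix.mul_assoc]
  have e2 : (symmMixedMatrix (Hᴴ * H) ∅ S)⁻¹ * (coordProj S * Hᴴ * H * coordProj S) =
      (symmMixedMatrix (Hᴴ * H) ∅ S)⁻¹ * (coordProj S * Hᴴ * H * coordProj S) * coordProj S := by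
    simp only [Matrix.mul_assoc, coordProj_idem]
  rw [e1, e2, e, Matrix.mul_sub, Matrix.nonsing_inv_mul _ hu, Matrix.sub_mul, Matrix.one_mul,
    Matrix.mul_assoc _ (coordProj Sᶜ), coordProj_comm, hJ, Matrix.mul_zero, sub_zero,
    trace_coordProj]

theorem det_mixedMatrix_im (H : Matrix m n ℂ) (F S : Finset n) :
    (mixedMatrix (Hᴴ * H) F S).det = ((mixedMatrix (Hᴴ * H) F S).det.re : ℂ) := by
  have h : (symmMixedMatrix (Hᴴ * H) F S).IsHermitian := symmMixedMatrix_isHermitian H F S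
  rw [det_mixedMatrix, h.det_eq_prod_eigenvalues]
  simp only [RCLike.ofReal_eq_complex_ofReal, ← Complex.ofReal_prod, Complex.ofReal_re] 

theorem sir_empty_eq (H : Matrix m n ℂ) {S : Finset n} {k : n} (hk : k ∉ S)
    (h : (mixedMatrix (Hᴴ * H) ∅ S).det ≠ 0) :
    sir (Hᴴ * H) k ∅ S = (star (H.col k) ⬝ᵥ residualForm H ∅ S *ᵥ H.col k).re := by
  have h1 := det_mixedMatrix_insert_right H (F := ∅) (S := S) (k := k) (by simpa using hk) h
  have h2 := det_mixedMatrix_im H ∅ S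
  have h3 : (mixedMatrix (Hᴴ * H) ∅ S).det.re ≠ 0 := by
    intro h0; rw [h0] at h2; exact h (by simpa using h2)
  have h4 : (Hᴴ * residualForm H ∅ S * H) k k =
      star (H.col k) ⬝ᵥ residualForm H ∅ S *ᵥ H.col k := by
    rw [Matrix.mul_assoc, Matrix.mul_apply]
    simp [dotProduct, Matrix.mul_apply, Matrix.mulVec]
  unfold sir
  rw [h1, h4, h2, Complex.re_ofReal_mul, Complex.ofReal_re, mul_div_cancel_left₀ _ h3]

/-- The law of the signal-to-interference ratio after multiplication by a Gaussian matrix, with the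
interfering streams nulled out. -/
theorem lintegral_sir_ginibre {K : Matrix p n ℂ} (hK : (Kᴴ * K).PosDef) {S : Finset n} {k : n}
    (hk : k ∉ S) (d : ℕ) (hd : Fintype.card m = S.card + (d + 1))
    (hdet : ∀ᵐ G ∂ginibre m p, (mixedMatrix ((G * K)ᴴ * (G * K)) ∅ S).det ≠ 0)
    {f : ℝ → ℝ≥0∞} (hf : Measurable f) :
    ∫⁻ G, f (sir ((G * K)ᴴ * (G * K)) k ∅ S) ∂ginibre m p =
      ∫⁻ x, f (sir (Kᴴ * K) k ∅ S * x) ∂gammaMeasure (d + 1 : ℕ) 1 := by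
  obtain ⟨hs, hs0⟩ := posDef_det_eq_ofReal hK ∅ S
  have hM : (mixedMatrix (Kᴴ * K) ∅ S).det ≠ 0 := by rw [hs]; exact_mod_cast hs0.ne'
  have hpos : 0 < sir (Kᴴ * K) k ∅ S := by
    unfold sir
    exact div_pos (posDef_det_eq_ofReal hK ∅ (insert k S)).2 hs0
  -- The component of column k orthogonal to the columns in S; its squared length is the ratio `sir`
  -- of K.
  set u : p → ℂ := residualForm K ∅ S *ᵥ K.col k with hu
  have hCh := residualForm_isHermitian K ∅ S
  have hsir : sir (Kᴴ * K) k ∅ S = ∑ i, ‖u i‖ ^ 2 := by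
    have e : ((∑ i, ‖u i‖ ^ 2 : ℝ) : ℂ) = star (K.col k) ⬝ᵥ residualForm K ∅ S *ᵥ K.col k := by
      rw [ofReal_sum_normSq, hu, Matrix.star_mulVec, hCh, ← Matrix.dotProduct_mulVec,
        Matrix.mulVec_mulVec, residualForm_idem K hM]
    rw [sir_empty_eq K hk hM, ← e, Complex.ofReal_re]
  have hu0 : u ≠ 0 := by
    intro h
    rw [hsir, h] at hpos
    simp at hpos
  have huK : star u ᵥ* (K * coordProj S) = 0 := by
    rw [hu, Matrix.star_mulVec, hCh, Matrix.vecMul_vecMul, residualForm_mul K hM,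
      Matrix.vecMul_zero]
  -- The rest of column k is a combination of the columns in S; the least squares coefficients w are
  -- explicit.
  obtain ⟨w, hw⟩ : ∃ w : n → ℂ, K.col k = u + (K * coordProj S) *ᵥ w := by
    refine ⟨((symmMixedMatrix (Kᴴ * K) ∅ S)⁻¹ * coordProj S * Kᴴ) *ᵥ K.col k, ?_⟩
    rw [hu, Matrix.mulVec_mulVec, ← Matrix.add_mulVec]
    have : residualForm K ∅ S + K * coordProj S *
        ((symmMixedMatrix (Kᴴ * K) ∅ S)⁻¹ * coordProj S * Kᴴ) = 1 := by
      unfold residualForm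
      rw [Finset.union_empty]
      simp only [Matrix.mul_assoc]
      abel
    rw [this, Matrix.one_mulVec]
  obtain ⟨c, -⟩ := Function.ne_iff.1 hu0
  have : Nonempty p := ⟨c⟩
  obtain ⟨U, hU, hUu⟩ := exists_unitary_mulVec_single hu0 c
  set r : ℝ := √(∑ i, ‖u i‖ ^ 2) with hr
  have hr2 : r * r = sir (Kᴴ * K) k ∅ S := by
    rw [hsir, hr, Real.mul_self_sqrt (sum_normSq_pos hu0).le]
  have hUh : (Uᴴ)ᴴ * Uᴴ = 1 := by
    rw [Matrix.conjTranspose_conjTranspose]; exact mul_eq_one_comm.1 hU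
  have hmp := measurePreserving_ginibre_mul (m := m) hUh
  have hsm : Measurable fun G : Matrix m p ℂ => f (sir ((G * K)ᴴ * (G * K)) k ∅ S) := by
    have h1 : Measurable fun G : Matrix m p ℂ => (G * K)ᴴ * (G * K) :=
      Continuous.measurable (by fun_prop)
    exact hf.comp ((measurable_sir k ∅ S).comp h1)
  have hsm' : Measurable fun G : Matrix m p ℂ =>
      f (sir ((G * Uᴴ * K)ᴴ * (G * Uᴴ * K)) k ∅ S) := hsm.comp hmp.measurable
  have hdet' := hmp.quasiMeasurePreserving.ae hdet
  -- After rotation u becomes r times the basis vector at c, while the columns in S have no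
  -- c-component (`hrow`). Column c of the Gaussian matrix is thus independent of the images of
  -- these columns and may be resampled.
  rw [← hmp.lintegral_comp hsm, lintegral_ginibre_updateCol c hsm']
  have hrow : ∀ (G : Matrix m p ℂ) (g : m → ℂ),
      G.updateCol c g * Uᴴ * K * coordProj S = G * Uᴴ * K * coordProj S := by
    intro G g
    have hz : ∀ j, (Uᴴ * (K * coordProj S)) c j = 0 := by
      intro j
      have e1 : star u ᵥ* U = star (Pi.single c ((r : ℝ) : ℂ)) := by
        have := Matrix.star_mulVec Uᴴ u
        rw [Matrix.conjTranspose_conjTranspose] at this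
        rw [← this, hUu]
      have e2 : (star u ᵥ* U) ᵥ* (Uᴴ * (K * coordProj S)) = 0 := by
        rw [Matrix.vecMul_vecMul, ← Matrix.mul_assoc, mul_eq_one_comm.1 hU, Matrix.one_mul, huK]
      rw [e1] at e2
      have e3 := congrFun e2 j
      have hrc : (r : ℂ) ≠ 0 := by
        exact_mod_cast (Real.sqrt_pos.2 (sum_normSq_pos hu0)).ne'
      have e4 : star (Pi.single c ((r : ℝ) : ℂ) : p → ℂ) = Pi.single c ((r : ℝ) : ℂ) := by
        ext i
        by_cases h : i = c
        · subst h; simp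
        · simp [h]
      rw [e4, Matrix.single_vecMul] at e3
      simpa [hrc] using e3
    simp only [Matrix.mul_assoc]
    ext i j
    rw [Matrix.mul_apply, Matrix.mul_apply]
    refine Finset.sum_congr rfl fun l _ => ?_
    by_cases h : l = c
    · subst h
      have := hz j
      rw [this, mul_zero, mul_zero]
    · rw [Matrix.updateCol_ne h]
  have hcol : ∀ (G : Matrix m p ℂ) (g : m → ℂ), (G.updateCol c g * Uᴴ * K).col k =
      (r : ℂ) • g + (G.updateCol c g * Uᴴ * K * coordProj S) *ᵥ w := by
    intro G g
    have e0 : (G.updateCol c g * Uᴴ * K).col k = (G.updateCol c g * Uᴴ) *ᵥ K.col k := by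
      ext i; simp [Matrix.mul_apply, Matrix.mulVec, dotProduct, Matrix.col]
    have e1 : (G.updateCol c g) *ᵥ Pi.single c (r : ℂ) = (r : ℂ) • g := by
      ext i
      simp [Matrix.mulVec_single, mul_comm]
    rw [e0, hw, Matrix.mulVec_add, ← Matrix.mulVec_mulVec, hUu, e1, Matrix.mulVec_mulVec]
    simp only [Matrix.mul_assoc]
  have hmix : ∀ (G : Matrix m p ℂ) (g : m → ℂ),
      (mixedMatrix ((G.updateCol c g * Uᴴ * K)ᴴ * (G.updateCol c g * Uᴴ * K)) ∅ S).det =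
        (mixedMatrix ((G * Uᴴ * K)ᴴ * (G * Uᴴ * K)) ∅ S).det := by
    intro G g
    have key : ∀ B : Matrix m n ℂ, symmMixedMatrix (Bᴴ * B) ∅ S =
        coordProj Sᶜ + (B * coordProj S)ᴴ * (B * coordProj S) := by
      intro B
      simp [symmMixedMatrix, coordProj_isHermitian, Matrix.mul_assoc]
    rw [det_mixedMatrix, det_mixedMatrix, key, key, hrow]
  refine (lintegral_congr_ae ?_).trans (?_ : ∫⁻ _ : Matrix m p ℂ,
    ∫⁻ x, f (sir (Kᴴ * K) k ∅ S * x) ∂gammaMeasure (d + 1 : ℕ) 1 ∂ginibre m p = _)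
  swap
  · rw [lintegral_const, measure_univ, mul_one]
  filter_upwards [hdet'] with G hG
  -- Conditionally on the other columns, C is a fixed projection of rank d + 1. Column k of the
  -- product is r g plus a vector killed by C, so the ratio is r² times the quadratic form of C at
  -- g.
  set C := residualForm (G * Uᴴ * K) ∅ S with hC
  have hlaw := hasLaw_quadForm_proj (C := C) (residualForm_isHermitian _ ∅ S)
    (residualForm_idem _ hG) d (by
      rw [hC, residualForm_trace _ hG, hd]; push_cast; ring)
  rw [← hlaw.map_eq]
  refine Eq.trans ?_ (lintegral_map (f := fun x => f (sir (Kᴴ * K) k ∅ S * x))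
    (hf.comp (measurable_const_mul _))
    (Complex.measurable_re.comp (Continuous.measurable (by fun_prop)))).symm
  refine lintegral_congr fun g => ?_
  have hG' := hG
  rw [← hmix G g] at hG'
  have hCC : residualForm (G.updateCol c g * Uᴴ * K) ∅ S = C :=
    residualForm_congr (by rw [Finset.union_empty]; exact hrow G g)
  have hz := residualForm_mul _ hG'
  rw [hCC] at hz
  have hz1 : C *ᵥ ((G.updateCol c g * Uᴴ * K * coordProj S) *ᵥ w) = 0 := by
    rw [Matrix.mulVec_mulVec, hz, Matrix.zero_mulVec]
  have hz2 : star ((G.updateCol c g * Uᴴ * K * coordProj S) *ᵥ w) ᵥ* C = 0 := by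
    have := congrArg star hz1
    rwa [Matrix.star_mulVec, star_zero, residualForm_isHermitian] at this
  rw [sir_empty_eq _ hk hG', hCC, hcol, Matrix.mulVec_add, hz1, add_zero, star_add,
    add_dotProduct, Matrix.dotProduct_mulVec (star (_ *ᵥ w) : m → ℂ) C, hz2, zero_dotProduct,
    add_zero, Matrix.mulVec_smul, star_smul, smul_dotProduct, dotProduct_smul, smul_smul, RCLike.star_def,
    Complex.conj_ofReal, smul_eq_mul, ← Complex.ofReal_mul, Complex.re_ofReal_mul, hr2]
  rfl

/-- Induction on S: once the determinant for S is almost surely nonzero, the ratio obtained by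
adding k is a positive constant times a Gamma variable. It is almost surely positive, so its
numerator cannot vanish. -/
theorem ae_det_mixedMatrix_ne_zero {K : Matrix p n ℂ} (hK : (Kᴴ * K).PosDef) (S : Finset n)
    (hS : S.card ≤ Fintype.card m) :
    ∀ᵐ G ∂ginibre m p, (mixedMatrix ((G * K)ᴴ * (G * K)) ∅ S).det ≠ 0 := by
  induction S using Finset.induction_on with
  | empty => 
    refine ae_of_all _ fun G => ?_
    simp [mixedMatrix, coordProj, Matrix.diagonal_one]
  | insert k S hk ih =>
    rw [Finset.card_insert_of_notMem hk] at hS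
    have hdet := ih (by omega)
    obtain ⟨d, hd⟩ : ∃ d, Fintype.card m = S.card + (d + 1) :=
      ⟨Fintype.card m - S.card - 1, by omega⟩
    obtain ⟨-, hs0⟩ := posDef_det_eq_ofReal hK ∅ S
    have hpos : 0 < sir (Kᴴ * K) k ∅ S := by
      unfold sir
      exact div_pos (posDef_det_eq_ofReal hK ∅ (insert k S)).2 hs0
    have h0 := lintegral_sir_ginibre hK hk d hd hdet (f := (Set.Iic (0 : ℝ)).indicator 1)
      (measurable_one.indicator measurableSet_Iic)
    have h1 : ∫⁻ x, (Set.Iic (0 : ℝ)).indicator (1 : ℝ → ℝ≥0∞) (sir (Kᴴ * K) k ∅ S * x)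
        ∂gammaMeasure (d + 1 : ℕ) 1 = 0 := by
      rw [← gammaMeasure_Iio_zero d, ← lintegral_indicator_one measurableSet_Iic]
      refine lintegral_congr fun x => ?_
      by_cases h : x ≤ 0
      · rw [Set.indicator_of_mem (Set.mem_Iic.2 h), Set.indicator_of_mem]
        · rfl
        · exact mul_nonpos_of_nonneg_of_nonpos hpos.le h
      · have h2 : sir (Kᴴ * K) k ∅ S * x ∉ Set.Iic (0 : ℝ) :=
          not_le.2 (mul_pos hpos (not_le.1 h))
        have h3 : x ∉ Set.Iic (0 : ℝ) := h
        rw [Set.indicator_of_notMem h2, Set.indicator_of_notMem h3]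
    rw [h1, lintegral_eq_zero_iff] at h0
    · filter_upwards [h0] with G hG hc
      have : sir ((G * K)ᴴ * (G * K)) k ∅ S ∈ Set.Iic (0 : ℝ) := by
        unfold sir
        rw [hc]; simp
      rw [Set.indicator_of_mem this] at hG
      simp at hG
    · have h1 : Measurable fun G : Matrix m p ℂ => (G * K)ᴴ * (G * K) :=
        Continuous.measurable (by fun_prop)
      exact (measurable_one.indicator measurableSet_Iic).comp ((measurable_sir k ∅ S).comp h1)

theorem ae_posDef_ginibre {K : Matrix p n ℂ} (hK : (Kᴴ * K).PosDef)
    (hS : Fintype.card n ≤ Fintype.card m) :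
    ∀ᵐ G ∂ginibre m p, ((G * K)ᴴ * (G * K)).PosDef := by
  filter_upwards [ae_det_mixedMatrix_ne_zero (m := m) hK Finset.univ (by simpa using hS)] with G hG
  have e : mixedMatrix ((G * K)ᴴ * (G * K)) ∅ Finset.univ = (G * K)ᴴ * (G * K) := by
    simp [mixedMatrix, coordProj, Matrix.diagonal_one]
  rw [e] at hG
  have h1 := Matrix.posSemidef_conjTranspose_mul_self (G * K)
  exact h1.posDef_iff_isUnit.2 ((Matrix.isUnit_iff_isUnit_det _).2 (isUnit_iff_ne_zero.2 hG))

end Ginibre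

/-! ### The chain of Gaussian factors and the product of Gamma variables -/

section Chain
open scoped Matrix ENNReal

/-- The chain of matrices with entries `z ⟨j, (a, b)⟩`. -/
def chainEntries {M : ℕ} {d : Fin (M + 1) → ℕ}
    (z : ((j : Fin M) × (Fin (d j.succ) × Fin (d j.castSucc))) → ℂ) (j : Fin M) :
    Matrix (Fin (d j.succ)) (Fin (d j.castSucc)) ℂ :=
  entryMatrix fun q => z ⟨j, q⟩

section MulGinibre
variable {l m n : Type*} [Fintype l] [DecidableEq l] [Fintype m] [DecidableEq m] [Fintype n]
  [DecidableEq n]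

theorem measurable_matrix_mul :
    Measurable fun q : Matrix m n ℂ × Matrix l m ℂ => q.2 * q.1 :=
  Continuous.measurable (by fun_prop)

/-- The law of `G * H` for a Gaussian matrix `G` and an independent `H` of law `μ`. -/
def mulGinibre (l : Type*) [Fintype l] (μ : Measure (Matrix m n ℂ)) : Measure (Matrix l n ℂ) :=
  (μ.prod (ginibre l m)).map fun q => q.2 * q.1

instance (μ : Measure (Matrix m n ℂ)) [IsProbabilityMeasure μ] :
    IsProbabilityMeasure (mulGinibre l μ) :=
  Measure.isProbabilityMeasure_map measurable_matrix_mul.aemeasurable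

theorem lintegral_mulGinibre (μ : Measure (Matrix m n ℂ)) [IsProbabilityMeasure μ]
    {f : Matrix l n ℂ → ℝ≥0∞} (hf : Measurable f) :
    ∫⁻ H, f H ∂mulGinibre l μ = ∫⁻ H, ∫⁻ G, f (G * H) ∂ginibre l m ∂μ := by
  rw [mulGinibre, lintegral_map hf measurable_matrix_mul]
  exact lintegral_prod _ (hf.comp measurable_matrix_mul).aemeasurable

theorem mulGinibre_dirac_one : mulGinibre l (Measure.dirac (1 : Matrix m m ℂ)) = ginibre l m := by
  rw [mulGinibre, Measure.dirac_prod, Measure.map_map measurable_matrix_mul measurable_prodMk_left]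
  have : ((fun q : Matrix m m ℂ × Matrix l m ℂ => q.2 * q.1) ∘ Prod.mk 1) = id := by
    ext q : 1
    exact Matrix.mul_one _
  rw [this, Measure.map_id]

theorem measurePreserving_mulGinibre_mul {μ : Measure (Matrix m n ℂ)} [IsProbabilityMeasure μ]
    {U : Matrix n n ℂ} (h : MeasurePreserving (fun H => H * U) μ μ) :
    MeasurePreserving (fun H => H * U) (mulGinibre l μ) (mulGinibre l μ) := by
  have hU : Measurable fun H : Matrix l n ℂ => H * U := Continuous.measurable (by fun_prop)
  have h2 := h.prod (MeasurePreserving.id (ginibre l m))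
  refine ⟨hU, ?_⟩
  rw [mulGinibre, Measure.map_map hU measurable_matrix_mul]
  conv_rhs => rw [← h2.map_eq, Measure.map_map measurable_matrix_mul h2.measurable]
  congr 1
  ext q : 1
  exact Matrix.mul_assoc _ _ _

open scoped ComplexOrder

theorem measurableSet_posDef_gram : MeasurableSet {H : Matrix m n ℂ | (Hᴴ * H).PosDef} := by
  have : {H : Matrix m n ℂ | (Hᴴ * H).PosDef} = {H | (Hᴴ * H).det ≠ 0} := by
    ext H
    exact (Matrix.posSemidef_conjTranspose_mul_self H).posDef_iff_isUnit.trans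
      ((Matrix.isUnit_iff_isUnit_det _).trans isUnit_iff_ne_zero)
  rw [this]
  exact (isOpen_ne_fun (by fun_prop) continuous_const).measurableSet

theorem ae_posDef_mulGinibre {μ : Measure (Matrix m n ℂ)} [IsProbabilityMeasure μ]
    (h : ∀ᵐ H ∂μ, (Hᴴ * H).PosDef) (hc : Fintype.card n ≤ Fintype.card l) :
    ∀ᵐ H ∂mulGinibre l μ, (Hᴴ * H).PosDef := by
  rw [mulGinibre, ae_map_iff measurable_matrix_mul.aemeasurable measurableSet_posDef_gram]
  refine (Measure.ae_prod_iff_ae_ae (measurable_matrix_mul measurableSet_posDef_gram)).2 ?_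
  filter_upwards [h] with K hK
  exact ae_posDef_ginibre hK hc

/-- Disjoint blocks of entries are independent, which is what injectivity of the combined index map
expresses. This is the induction step that identifies the law of the chain. -/
theorem mulGinibre_map_gauss {κ κ₁ : Type*} [Fintype κ] [Fintype κ₁] {e₁ : κ₁ → κ} {e₂ : l × m → κ}
    (he : (Sum.elim e₁ e₂).Injective) {F : (κ₁ → ℂ) → Matrix m n ℂ} (hF : Measurable F) :
    (gauss κ).map (fun z => entryMatrix (fun q => z (e₂ q)) * F fun i => z (e₁ i)) =
      mulGinibre l ((gauss κ₁).map F) := by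
  rw [mulGinibre, ginibre, Measure.map_prod_map _ _ hF measurable_entryMatrix, ← map_gauss_pair he,
    Measure.map_map (hF.prodMap measurable_entryMatrix) (by fun_prop),
    Measure.map_map measurable_matrix_mul ((hF.prodMap measurable_entryMatrix).comp (by fun_prop))]
  rfl

end MulGinibre

open scoped ComplexOrder

/-- The law of a product of independent Gaussian matrices of sizes `d (j+1) × d j`. -/
def chainLaw : {M : ℕ} → (d : Fin (M + 1) → ℕ) →
    Measure (Matrix (Fin (d (Fin.last M))) (Fin (d 0)) ℂ)
  | 0, d => Measure.dirac (1 : Matrix (Fin (d 0)) (Fin (d 0)) ℂ)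
  | M + 1, d =>
      mulGinibre (Fin (d (Fin.last M).succ)) (chainLaw fun i : Fin (M + 1) => d i.castSucc)

instance isProbabilityMeasure_chainLaw : ∀ {M : ℕ} (d : Fin (M + 1) → ℕ),
    IsProbabilityMeasure (chainLaw d)
  | 0, d => by unfold chainLaw; infer_instance
  | M + 1, d => by
      have := isProbabilityMeasure_chainLaw fun i : Fin (M + 1) => d i.castSucc
      exact inferInstanceAs (IsProbabilityMeasure (mulGinibre (Fin (d (Fin.last M).succ))
        (chainLaw fun i : Fin (M + 1) => d i.castSucc)))

theorem measurable_chainProd : ∀ {M : ℕ} (d : Fin (M + 1) → ℕ),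
    Measurable fun z : ((j : Fin M) × (Fin (d j.succ) × Fin (d j.castSucc))) → ℂ =>
      chainProd d (chainEntries z)
  | 0, d => measurable_const
  | M + 1, d => by
      have h1 := measurable_chainProd fun i : Fin (M + 1) => d i.castSucc
      have h2 : Measurable fun z : ((j : Fin (M + 1)) × (Fin (d j.succ) × Fin (d j.castSucc))) → ℂ
          => (fun q : ((j : Fin M) × (Fin (d j.succ.castSucc) × Fin (d j.castSucc.castSucc))) =>
            z ⟨q.1.castSucc, q.2⟩) := by fun_prop
      have h3 : Measurable fun z : ((j : Fin (M + 1)) × (Fin (d j.succ) × Fin (d j.castSucc))) → ℂ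
          => chainEntries z (Fin.last M) :=
        measurable_entryMatrix.comp (by fun_prop)
      exact measurable_matrix_mul.comp ((h1.comp h2).prodMk h3)

theorem map_chainProd_gauss : ∀ {M : ℕ} (d : Fin (M + 1) → ℕ),
    (gauss ((j : Fin M) × (Fin (d j.succ) × Fin (d j.castSucc)))).map
      (fun z => chainProd d (chainEntries z)) = chainLaw d
  | 0, d => by
      change Measure.map (fun _ => (1 : Matrix (Fin (d 0)) (Fin (d 0)) ℂ)) _ = _
      rw [Measure.map_const, measure_univ, one_smul]
      rfl
  | M + 1, d => by
      have ih := map_chainProd_gauss fun i : Fin (M + 1) => d i.castSucc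
      have hm := measurable_chainProd fun i : Fin (M + 1) => d i.castSucc
      let e₁ : ((j : Fin M) × (Fin (d j.succ.castSucc) × Fin (d j.castSucc.castSucc))) →
          ((j : Fin (M + 1)) × (Fin (d j.succ) × Fin (d j.castSucc))) :=
        fun q => ⟨q.1.castSucc, q.2⟩
      let e₂ : (Fin (d (Fin.last M).succ) × Fin (d (Fin.last M).castSucc)) →
          ((j : Fin (M + 1)) × (Fin (d j.succ) × Fin (d j.castSucc))) :=
        fun q => ⟨Fin.last M, q⟩
      have he : (Sum.elim e₁ e₂).Injective := by
        refine Function.Injective.sumElim ?_ ?_ ?_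
        · rintro ⟨i, x⟩ ⟨j, y⟩ h
          have h1 : i = j := Fin.castSucc_injective _ (congrArg Sigma.fst h)
          subst h1
          have h2 := eq_of_heq (Sigma.mk.inj h).2
          exact congrArg _ h2
        · intro x y h
          exact eq_of_heq (Sigma.mk.inj h).2
        · intro x y h
          exact (Fin.castSucc_lt_last x.1).ne (congrArg Sigma.fst h)
      have hp := mulGinibre_map_gauss he hm
      rw [ih] at hp
      exact hp

/-- The rightmost Gaussian factor absorbs the unitary matrix. At least one factor is required, since
the empty product is the deterministic identity matrix. -/
theorem measurePreserving_chainLaw_mul : ∀ {M : ℕ} (d : Fin (M + 2) → ℕ)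
    {U : Matrix (Fin (d 0)) (Fin (d 0)) ℂ}, Uᴴ * U = 1 →
    MeasurePreserving (fun H => H * U) (chainLaw d) (chainLaw d)
  | 0, d, U, hU => by
      have e : chainLaw d = ginibre (Fin (d 1)) (Fin (d 0)) := mulGinibre_dirac_one
      rw [e]
      exact measurePreserving_ginibre_mul hU
  | M + 1, d, U, hU => by
      have h := measurePreserving_mulGinibre_mul (l := Fin (d (Fin.last (M + 1)).succ))
        (measurePreserving_chainLaw_mul (fun i : Fin (M + 2) => d i.castSucc) hU)
      exact h

theorem ae_posDef_chainLaw : ∀ {M : ℕ} (d : Fin (M + 1) → ℕ), (∀ j : Fin M, d 0 ≤ d j.succ) →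
    ∀ᵐ H ∂chainLaw d, (Hᴴ * H).PosDef
  | 0, d, _ => by
      rw [chainLaw]
      refine (ae_dirac_iff measurableSet_posDef_gram).2 ?_
      simpa using Matrix.PosDef.one
  | M + 1, d, h => by
      have h1 := ae_posDef_mulGinibre (l := Fin (d (Fin.last M).succ))
        (ae_posDef_chainLaw (fun i : Fin (M + 1) => d i.castSucc) fun j => h j.castSucc)
        (by rw [Fintype.card_fin, Fintype.card_fin]; exact h (Fin.last M))
      exact h1

/-- The law of `δ` times a product of independent Gamma variables with shapes `a l + 1`. -/
def gammaProd : {M : ℕ} → (Fin M → ℕ) → ℝ → Measure ℝ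
  | 0, _, δ => Measure.dirac δ
  | M + 1, a, δ =>
      ((gammaProd (fun i : Fin M => a i.castSucc) δ).prod
        (gammaMeasure (a (Fin.last M) + 1 : ℕ) 1)).map fun q => q.1 * q.2

instance isProbabilityMeasure_gammaProd : ∀ {M : ℕ} (a : Fin M → ℕ) (δ : ℝ),
    IsProbabilityMeasure (gammaProd a δ)
  | 0, _, δ => by unfold gammaProd; infer_instance
  | M + 1, a, δ => by
      have := isProbabilityMeasure_gammaProd (fun i : Fin M => a i.castSucc) δ
      unfold gammaProd
      exact Measure.isProbabilityMeasure_map (by fun_prop)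

theorem lintegral_gammaProd_succ {M : ℕ} (a : Fin (M + 1) → ℕ) (δ : ℝ) {f : ℝ → ℝ≥0∞}
    (hf : Measurable f) :
    ∫⁻ x, f x ∂gammaProd a δ = ∫⁻ y, ∫⁻ x, f (y * x) ∂gammaMeasure (a (Fin.last M) + 1 : ℕ) 1
      ∂gammaProd (fun i : Fin M => a i.castSucc) δ := by
  rw [gammaProd, lintegral_map hf (by fun_prop), lintegral_prod _ (by fun_prop)]

/-- Absorbing √δ into the channel makes δ HᴴH a Gram matrix again, so that statements about Gram
matrices apply to it. -/
theorem gram_sqrt_smul {m n : Type*} [Fintype m] [Fintype n] {δ : ℝ} (hδ : 0 ≤ δ)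
    (H : Matrix m n ℂ) :
    (((√δ : ℝ) : ℂ) • H)ᴴ * (((√δ : ℝ) : ℂ) • H) = (δ : ℂ) • (Hᴴ * H) := by
  rw [Matrix.conjTranspose_smul, Matrix.smul_mul, Matrix.mul_smul, smul_smul]
  congr 1
  rw [RCLike.star_def, Complex.conj_ofReal, ← Complex.ofReal_mul, Real.mul_self_sqrt hδ]

theorem sir_smul_one {n : Type*} [Fintype n] [DecidableEq n] {δ : ℝ} (hδ : 0 < δ) {k : n}
    {S : Finset n} (hk : k ∉ S) : sir ((δ : ℂ) • (1 : Matrix n n ℂ)) k ∅ S = δ := by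
  have h : ∀ T : Finset n,
      (mixedMatrix ((δ : ℂ) • (1 : Matrix n n ℂ)) ∅ T).det = ((δ ^ T.card : ℝ) : ℂ) := by
    intro T
    have e : mixedMatrix ((δ : ℂ) • (1 : Matrix n n ℂ)) ∅ T =
        Matrix.diagonal fun i => if i ∈ T then (δ : ℂ) else 1 := by
      ext i j
      by_cases hij : i = j
      · subst hij
        by_cases hi : i ∈ T <;> simp [mixedMatrix, coordProj, hi]
      · simp [mixedMatrix, coordProj, hij]
    rw [e, Matrix.det_diagonal, Finset.prod_ite_mem, Finset.univ_inter, Finset.prod_const]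
    push_cast; rfl
  rw [sir, h, h, Complex.ofReal_re, Complex.ofReal_re, Finset.card_insert_of_notMem hk, pow_succ,
    mul_div_cancel_left₀ _ (pow_pos hδ _).ne']

/-- Induction peels off the leftmost factor: conditionally on the others it multiplies the ratio by
a Gamma variable of shape (number of rows) - |S| = a + 1. The empty chain has W = δ I, which gives
the Dirac mass at δ. -/
theorem lintegral_sir_chainLaw {δ : ℝ} (hδ : 0 < δ) : ∀ {M : ℕ} (d : Fin (M + 1) → ℕ)
    (a : Fin M → ℕ), (∀ j : Fin M, d 0 ≤ d j.succ) →
    ∀ {S : Finset (Fin (d 0))} {k : Fin (d 0)}, k ∉ S →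
    (∀ j : Fin M, d j.succ = S.card + (a j + 1)) → ∀ {f : ℝ → ℝ≥0∞}, Measurable f →
    ∫⁻ H, f (sir ((δ : ℂ) • (Hᴴ * H)) k ∅ S) ∂chainLaw d = ∫⁻ x, f x ∂gammaProd a δ
  | 0, d, a, _, S, k, hk, _, f, hf => by
      have hm : Measurable fun H : Matrix (Fin (d 0)) (Fin (d 0)) ℂ =>
          f (sir ((δ : ℂ) • (Hᴴ * H)) k ∅ S) := by
        have h1 : Measurable fun H : Matrix (Fin (d 0)) (Fin (d 0)) ℂ => (δ : ℂ) • (Hᴴ * H) :=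
          Continuous.measurable (by fun_prop)
        exact hf.comp ((measurable_sir k ∅ S).comp h1)
      rw [gammaProd, lintegral_dirac' _ hf]
      refine (lintegral_dirac' _ hm).trans ?_
      rw [Matrix.conjTranspose_one, Matrix.one_mul, sir_smul_one hδ hk]
  | M + 1, d, a, h, S, k, hk, hd, f, hf => by
      have hm : Measurable fun H : Matrix (Fin (d (Fin.last M).succ)) (Fin (d 0)) ℂ =>
          f (sir ((δ : ℂ) • (Hᴴ * H)) k ∅ S) := by
        have h1 : Measurable fun H : Matrix (Fin (d (Fin.last M).succ)) (Fin (d 0)) ℂ =>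
          (δ : ℂ) • (Hᴴ * H) := Continuous.measurable (by fun_prop)
        exact hf.comp ((measurable_sir k ∅ S).comp h1)
      have hg : Measurable fun y : ℝ =>
          ∫⁻ x, f (y * x) ∂gammaMeasure (a (Fin.last M) + 1 : ℕ) 1 :=
        Measurable.lintegral_prod_right' (f := fun q : ℝ × ℝ => f (q.1 * q.2)) (by fun_prop)
      have ih := lintegral_sir_chainLaw hδ (fun i : Fin (M + 1) => d i.castSucc)
        (fun i => a i.castSucc) (fun j => h j.castSucc) hk (fun j => hd j.castSucc) hg
      rw [lintegral_gammaProd_succ a δ hf, ← ih]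
      refine (lintegral_mulGinibre (chainLaw fun i : Fin (M + 1) => d i.castSucc) hm).trans ?_
      refine lintegral_congr_ae ?_
      filter_upwards [ae_posDef_chainLaw (fun i : Fin (M + 1) => d i.castSucc)
        fun j => h j.castSucc] with H hH
      have hK : ((((√δ : ℝ) : ℂ) • H)ᴴ * (((√δ : ℝ) : ℂ) • H)).PosDef := by
        rw [gram_sqrt_smul hδ.le]
        exact hH.smul (by exact_mod_cast hδ)
      have hcard : Fintype.card (Fin (d (Fin.last M).succ)) = S.card + (a (Fin.last M) + 1) := by
        rw [Fintype.card_fin]; exact hd _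
      have := lintegral_sir_ginibre hK hk _ hcard
        (ae_det_mixedMatrix_ne_zero hK S ((Nat.le_add_right _ _).trans_eq hcard.symm)) hf
      rw [gram_sqrt_smul hδ.le] at this
      refine Eq.trans ?_ this
      refine lintegral_congr fun G => ?_
      rw [Matrix.mul_smul, gram_sqrt_smul hδ.le]
      rfl

end Chain

/-! ### The distribution function of the SINR as a binomial mixture -/

section SinrLaw
open scoped Matrix ENNReal ComplexOrder

/-- The diagonal entry of the inverse is D₀/(D₀ + D₁), so its reciprocal minus one is D₁/D₀.
Positive definiteness makes both determinants real and positive. -/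
theorem mmseSINR_eq_sir {n m : ℕ} {δ : ℝ} (hδ : 0 < δ) {H : Matrix (Fin m) (Fin n) ℂ}
    (hH : (Hᴴ * H).PosDef) (k : Fin n) :
    mmseSINR δ H k = sir ((δ : ℂ) • (Hᴴ * H)) k (Finset.univ.erase k) ∅ := by
  have hW : ((δ : ℂ) • (Hᴴ * H)).PosDef := hH.smul (by exact_mod_cast hδ)
  obtain ⟨h1, h2⟩ := posDef_det_eq_ofReal hW (Finset.univ.erase k) ∅
  obtain ⟨h3, h4⟩ := posDef_det_eq_ofReal hW (Finset.univ.erase k) {k}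
  rw [mmseSINR, inv_one_add_diag, h1, h3, ← Complex.ofReal_add, ← Complex.ofReal_div,
    Complex.ofReal_re, sir, insert_empty_eq]
  field_simp
  ring

theorem mmseSINR_pos {n m : ℕ} {δ : ℝ} (hδ : 0 < δ) {H : Matrix (Fin m) (Fin n) ℂ}
    (hH : (Hᴴ * H).PosDef) (k : Fin n) : 0 < mmseSINR δ H k := by
  have hW : ((δ : ℂ) • (Hᴴ * H)).PosDef := hH.smul (by exact_mod_cast hδ)
  rw [mmseSINR_eq_sir hδ hH, sir]
  exact div_pos (posDef_det_eq_ofReal hW _ _).2 (posDef_det_eq_ofReal hW _ _).2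

theorem hasLaw_chainProd {Ω : Type*} [MeasurableSpace Ω] {P : Measure Ω} {M : ℕ}
    (d : Fin (M + 1) → ℕ)
    {A : (j : Fin M) → Ω → Matrix (Fin (d j.succ)) (Fin (d j.castSucc)) ℂ}
    (hlaw : ∀ j a b, HasLaw (fun ω => A j ω a b) stdComplexGaussian P)
    (hindep : iIndepFun (fun (i : (j : Fin M) × (Fin (d j.succ) × Fin (d j.castSucc))) (ω : Ω) =>
      A i.1 ω i.2.1 i.2.2) P) :
    HasLaw (fun ω => chainProd d fun j => A j ω) (chainLaw d) P := by
  have hP := hindep.isProbabilityMeasure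
  have hX : HasLaw (fun ω (i : (j : Fin M) × (Fin (d j.succ) × Fin (d j.castSucc))) =>
      A i.1 ω i.2.1 i.2.2) (gauss _) P := by
    refine ⟨aemeasurable_pi_lambda _ fun i => (hlaw _ _ _).aemeasurable, ?_⟩
    rw [(iIndepFun_iff_map_fun_eq_pi_map fun i => (hlaw _ _ _).aemeasurable).1 hindep]
    unfold gauss
    congr 1
    ext i : 1
    exact (hlaw _ _ _).map_eq
  exact HasLaw.comp (μ := gauss _) ⟨(measurable_chainProd d).aemeasurable, map_chainProd_gauss d⟩ hX

/-- All n - 1 interferers are traded. A set T of nulled streams leaves j = n - 1 - |T| absent ones,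
its law depends only on |T|, and there are C(n-1, j) such sets. -/
theorem measure_mmseSINR_le {n M : ℕ} (ν : Fin (M + 1) → ℕ) {δ : ℝ} (hδ : 0 < δ) (k : Fin n)
    {x : ℝ} (hx : 0 < x) :
    (chainLaw (chainDim n ν) :
        Measure (Matrix (Fin (chainDim n ν (Fin.last (M + 1)))) (Fin n) ℂ)) {H | mmseSINR δ H k ≤ x} = ∑ j ∈ Finset.range n,
      ENNReal.ofReal ((n - 1).choose j * ((x / (1 + x)) ^ (n - 1 - j) * (1 / (1 + x)) ^ j)) *
        gammaProd (fun l => ν l + j) δ (Set.Iic x) := by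
  set μ : Measure (Matrix (Fin (chainDim n ν (Fin.last (M + 1)))) (Fin n) ℂ) :=
    chainLaw (chainDim n ν) with hμ
  have hμp : IsProbabilityMeasure μ := isProbabilityMeasure_chainLaw (chainDim n ν)
  have hpd : ∀ᵐ H ∂μ, (Hᴴ * H).PosDef :=
    ae_posDef_chainLaw (chainDim n ν) fun j => Nat.le_add_right n (ν j)
  have hinv : ∀ U : Matrix (Fin n) (Fin n) ℂ, Uᴴ * U = 1 →
    MeasurePreserving (fun H => H * U) μ μ := fun U hU =>
      measurePreserving_chainLaw_mul (chainDim n ν) hU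
  have hs : Measurable fun H : Matrix (Fin (chainDim n ν (Fin.last (M + 1)))) (Fin n) ℂ =>
      ((√δ : ℝ) : ℂ) • H := Continuous.measurable (by fun_prop)
  have hprob : IsProbabilityMeasure (μ.map fun H => ((√δ : ℝ) : ℂ) • H) :=
    Measure.isProbabilityMeasure_map hs.aemeasurable
  have hmeas : ∀ F S : Finset (Fin n), MeasurableSet
      {H : Matrix (Fin (chainDim n ν (Fin.last (M + 1)))) (Fin n) ℂ | sir (Hᴴ * H) k F S ≤ x} := by
    intro F S
    exact measurableSet_le ((measurable_sir k F S).comp measurable_gramMatrix) measurable_const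
  have hsum := measure_sir_eq_sum (μ := μ.map fun H => ((√δ : ℝ) : ℂ) • H) (k := k) (x := x)
    (F := Finset.univ.erase k) (S := ∅) (by
      intro U hU
      have hU' : Measurable fun H : Matrix (Fin (chainDim n ν (Fin.last (M + 1)))) (Fin n) ℂ =>
        H * U := Continuous.measurable (by fun_prop)
      refine ⟨hU', ?_⟩
      conv_rhs => rw [← (hinv U hU).map_eq]
      rw [Measure.map_map hU' hs, Measure.map_map hs hU']
      congr 1
      ext H : 1
      exact Matrix.smul_mul _ _ _) (by
      rw [ae_map_iff hs.aemeasurable measurableSet_posDef_gram]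
      filter_upwards [hpd] with H hH
      rw [gram_sqrt_smul hδ.le]
      exact hH.smul (by exact_mod_cast hδ)) hx (by simp) (by simp)
  have hcard : (Finset.univ.erase k).card = n - 1 := by
    rw [Finset.card_erase_of_mem (Finset.mem_univ k), Finset.card_univ, Fintype.card_fin]
  have hmap : ∀ F S : Finset (Fin n), (μ.map fun H => ((√δ : ℝ) : ℂ) • H)
      {H | sir (Hᴴ * H) k F S ≤ x} = μ {H | sir ((δ : ℂ) • (Hᴴ * H)) k F S ≤ x} := by
    intro F S
    rw [Measure.map_apply hs (hmeas F S)]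
    congr 1
    ext H
    simp only [Set.mem_preimage, Set.mem_ofPred_eq, gram_sqrt_smul hδ.le]
  have hterm : ∀ S : Finset (Fin n), k ∉ S → μ {H | sir ((δ : ℂ) • (Hᴴ * H)) k ∅ S ≤ x} =
      gammaProd (fun l => ν l + (n - 1 - S.card)) δ (Set.Iic x) := by
    intro S hk
    have hSn : S.card + 1 ≤ n := by
      have := Finset.card_le_univ (insert k S)
      rwa [Finset.card_insert_of_notMem hk, Fintype.card_fin] at this
    have h1 := lintegral_sir_chainLaw hδ (chainDim n ν) (fun l => ν l + (n - 1 - S.card))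
      (fun j => Nat.le_add_right n (ν j)) hk (fun j => by
        have h : n + ν j = S.card + (ν j + (n - 1 - S.card) + 1) := by omega
        exact h) (f := (Set.Iic x).indicator 1) (measurable_one.indicator measurableSet_Iic)
    rw [lintegral_indicator_one measurableSet_Iic] at h1
    rw [← h1]
    have hm2 : MeasurableSet {H : Matrix (Fin (chainDim n ν (Fin.last (M + 1)))) (Fin n) ℂ |
        sir ((δ : ℂ) • (Hᴴ * H)) k ∅ S ≤ x} := by
      have h1 : Measurable fun H : Matrix (Fin (chainDim n ν (Fin.last (M + 1)))) (Fin n) ℂ =>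
        (δ : ℂ) • (Hᴴ * H) := Continuous.measurable (by fun_prop)
      exact measurableSet_le ((measurable_sir k ∅ S).comp h1) measurable_const
    rw [← lintegral_indicator_one hm2]
    rfl
  have hcongr : μ {H | mmseSINR δ H k ≤ x} =
      μ {H | sir ((δ : ℂ) • (Hᴴ * H)) k (Finset.univ.erase k) ∅ ≤ x} := by
    refine measure_congr ?_
    filter_upwards [hpd] with H hH
    exact congrArg (· ≤ x) (mmseSINR_eq_sir hδ hH k)
  rw [hmap] at hsum
  refine hcongr.trans ?_
  rw [hsum, hcard]
  have hsum2 := Finset.sum_powerset_apply_card (x := Finset.univ.erase k) (fun i : ℕ =>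
    ENNReal.ofReal ((x / (1 + x)) ^ i * (1 / (1 + x)) ^ (n - 1 - i)) *
      gammaProd (fun l => ν l + (n - 1 - i)) δ (Set.Iic x))
  rw [hcard] at hsum2
  have hn : n - 1 + 1 = n := by have := k.pos; omega
  -- Reflection changes the index from the number of nulled streams to the number j of absent ones.
  rw [hn, ← Finset.sum_range_reflect] at hsum2
  refine Eq.trans ?_ (hsum2.trans ?_)
  · refine Finset.sum_congr rfl fun T hT => ?_
    rw [hmap, Finset.empty_union, hterm T fun h => Finset.notMem_erase k _
      (Finset.mem_powerset.1 hT h)]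
  · refine Finset.sum_congr rfl fun j hj => ?_
    have hj' := Finset.mem_range.1 hj
    have e1 : n - 1 - (n - 1 - j) = j := by omega
    rw [e1, nsmul_eq_mul, Nat.choose_symm (by omega), ENNReal.ofReal_mul (Nat.cast_nonneg _),
      ENNReal.ofReal_natCast, mul_assoc]

end SinrLaw

/-! ### Decay of Gamma in strips and shifting of vertical lines -/

section VerticalLines
open Complex Filter Topology

theorem Complex.norm_Gamma_le {z : ℂ} (hz : 0 < z.re) : ‖Gamma z‖ ≤ Real.Gamma z.re := by
  rw [Complex.Gamma_eq_integral hz, Complex.GammaIntegral, Real.Gamma_eq_integral hz]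
  refine (norm_integral_le_integral_norm _).trans_eq ?_
  refine setIntegral_congr_fun measurableSet_Ioi fun x (hx : 0 < x) => ?_
  simp only [norm_mul, Complex.norm_real, Complex.norm_cpow_eq_rpow_re_of_pos hx,
    Complex.sub_re, Complex.one_re, Real.norm_eq_abs, Real.abs_exp]

/-- The Gamma function decays quadratically along vertical strips of the right half plane. -/
theorem exists_norm_Gamma_le {α : ℝ} (hα : 0 < α) (β : ℝ) :
    ∃ C, 0 ≤ C ∧ ∀ z : ℂ, α ≤ z.re → z.re ≤ β → ‖Gamma z‖ ≤ C / (1 + z.im ^ 2) := by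
  have hcont : ContinuousOn Real.Gamma (Set.Icc (α + 2) (β + 2)) := by
    intro x hx
    refine (Real.differentiableAt_Gamma fun m => ?_).continuousAt.continuousWithinAt
    have := hx.1
    have hm : (0 : ℝ) ≤ m := m.cast_nonneg
    intro h; linarith
  obtain ⟨C, hC⟩ := isCompact_Icc.exists_bound_of_continuousOn hcont
  have hm0 : 0 < min (α ^ 2) 1 := lt_min (by positivity) one_pos
  refine ⟨|C| / min (α ^ 2) 1, by positivity, fun z h1 h2 => ?_⟩
  have hz : 0 < z.re := hα.trans_le h1
  have hz0 : z ≠ 0 := fun h => by rw [h] at hz; simp at hz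
  have hz1 : z + 1 ≠ 0 := fun h => by
    have := congrArg Complex.re h
    simp at this; linarith
  -- Two applications of the functional equation give quadratic decay, because |Γ(z + 2)| ≤ Γ(Re z +
  -- 2) stays bounded on the strip.
  have e : Gamma z = Gamma (z + 2) / (z * (z + 1)) := by
    rw [show z + 2 = (z + 1) + 1 by ring, Complex.Gamma_add_one _ hz1, Complex.Gamma_add_one _ hz0]
    field_simp
  have hn : ‖Gamma (z + 2)‖ ≤ |C| := by
    have h3 : (z + 2).re = z.re + 2 := by simp
    refine (Complex.norm_Gamma_le (by rw [h3]; linarith)).trans ?_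
    rw [h3]
    exact (le_abs_self _).trans ((hC _ ⟨by linarith, by linarith⟩).trans (le_abs_self C))
  have hle : ‖z‖ ≤ ‖z + 1‖ := by
    rw [← sq_le_sq₀ (norm_nonneg _) (norm_nonneg _), Complex.sq_norm, Complex.sq_norm,
      Complex.normSq_apply, Complex.normSq_apply]
    simp; nlinarith
  have hlow : min (α ^ 2) 1 * (1 + z.im ^ 2) ≤ ‖z‖ * ‖z + 1‖ := by
    have h4 : ‖z‖ * ‖z‖ ≤ ‖z‖ * ‖z + 1‖ := mul_le_mul_of_nonneg_left hle (norm_nonneg _)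
    have h5 : ‖z‖ * ‖z‖ = z.re ^ 2 + z.im ^ 2 := by
      rw [← sq, Complex.sq_norm, Complex.normSq_apply]; ring
    have h6 : α ^ 2 ≤ z.re ^ 2 := by nlinarith
    have h7 := min_le_left (α ^ 2) 1
    have h8 : min (α ^ 2) 1 * z.im ^ 2 ≤ z.im ^ 2 :=
      mul_le_of_le_one_left (sq_nonneg _) (min_le_right _ _)
    nlinarith
  rw [e, norm_div, norm_mul, div_div]
  exact div_le_div₀ (abs_nonneg _) hn (by positivity) hlow

/-- Quadratic decay along the vertical strips with real parts in `I`. -/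
def QuadraticDecayOn (f : ℂ → ℂ) (I : Set ℝ) : Prop :=
  ∀ σ₁ ∈ I, ∀ σ₂ ∈ I, ∃ C, ∀ s : ℂ, σ₁ ≤ s.re → s.re ≤ σ₂ → ‖f s‖ ≤ C / (1 + s.im ^ 2)

theorem QuadraticDecayOn.bounded_mul {f g : ℂ → ℂ} {I : Set ℝ} (hf : QuadraticDecayOn f I)
    (hg : ∀ σ₁ ∈ I, ∀ σ₂ ∈ I, ∃ C, ∀ s : ℂ, σ₁ ≤ s.re → s.re ≤ σ₂ → ‖g s‖ ≤ C) :
    QuadraticDecayOn (fun s => g s * f s) I := by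
  intro σ₁ h1 σ₂ h2
  obtain ⟨C, hC⟩ := hf σ₁ h1 σ₂ h2
  obtain ⟨B, hB⟩ := hg σ₁ h1 σ₂ h2
  refine ⟨B * C, fun s hs1 hs2 => ?_⟩
  rw [norm_mul, mul_div_assoc]
  exact mul_le_mul (hB s hs1 hs2) (hC s hs1 hs2) (norm_nonneg _)
    ((norm_nonneg _).trans (hB s hs1 hs2))

theorem differentiableOn_continuous_vertical {f : ℂ → ℂ} {I : Set ℝ}
    (hd : DifferentiableOn ℂ f {s | s.re ∈ I}) {σ : ℝ} (hσ : σ ∈ I) :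
    Continuous fun t : ℝ => f (σ + t * Complex.I) := by
  refine hd.continuousOn.comp_continuous (by fun_prop) fun t => ?_
  simpa using hσ

theorem QuadraticDecayOn.integrable {f : ℂ → ℂ} {I : Set ℝ} (hf : QuadraticDecayOn f I)
    (hd : DifferentiableOn ℂ f {s | s.re ∈ I}) {σ : ℝ} (hσ : σ ∈ I) :
    Integrable fun t : ℝ => f (σ + t * Complex.I) := by
  obtain ⟨C, hC⟩ := hf σ hσ σ hσ
  refine (integrable_inv_one_add_sq.const_mul C).mono'
    (differentiableOn_continuous_vertical hd hσ).aestronglyMeasurable (ae_of_all _ fun t => ?_)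
  have := hC (σ + t * Complex.I) (by simp) (by simp)
  simpa [div_eq_mul_inv] using this

/-- The integral along a vertical line does not depend on the line. -/
theorem QuadraticDecayOn.integral_eq {f : ℂ → ℂ} {I : Set ℝ} (hf : QuadraticDecayOn f I)
    (hI : I.OrdConnected) (hd : DifferentiableOn ℂ f {s | s.re ∈ I}) {σ₁ σ₂ : ℝ} (h₁ : σ₁ ∈ I)
    (h₂ : σ₂ ∈ I) : ∫ t : ℝ, f (σ₁ + t * Complex.I) = ∫ t : ℝ, f (σ₂ + t * Complex.I) := by
  wlog h : σ₁ ≤ σ₂ generalizing σ₁ σ₂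
  · exact (this h₂ h₁ (le_of_not_ge h)).symm
  obtain ⟨C, hC⟩ := hf σ₁ h₁ σ₂ h₂
  have hrect : ∀ T : ℝ, (∫ x : ℝ in σ₁..σ₂, f (x + (-T : ℝ) * Complex.I)) -
      (∫ x : ℝ in σ₁..σ₂, f (x + (T : ℝ) * Complex.I)) +
      Complex.I • (∫ y : ℝ in -T..T, f (σ₂ + y * Complex.I)) -
      Complex.I • (∫ y : ℝ in -T..T, f (σ₁ + y * Complex.I)) = 0 := by
    intro T
    have := Complex.integral_boundary_rect_eq_zero_of_differentiableOn f
      ((σ₁ : ℂ) + (-T : ℝ) * Complex.I) ((σ₂ : ℂ) + (T : ℝ) * Complex.I) (hd.mono fun s hs => by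
        have h3 := hs.1
        simp only [Set.mem_preimage] at h3
        simp only [add_re, ofReal_re, mul_re, I_re, mul_zero, ofReal_im, I_im, mul_one, sub_zero,
          add_zero, Set.uIcc_of_le h] at h3
        exact hI.out h₁ h₂ h3)
    simpa using this
  -- By Cauchy's theorem only the horizontal sides of the rectangle separate the two vertical
  -- integrals. The sign ε treats both sides at once; the quadratic decay makes them vanish in the
  -- limit.
  have hside : ∀ ε : ℝ, ε = 1 ∨ ε = -1 →
      Tendsto (fun T : ℝ => ∫ x : ℝ in σ₁..σ₂, f (x + ((ε * T : ℝ) : ℂ) * Complex.I)) atTop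
        (𝓝 0) := by
    intro ε hε
    have hlim : Tendsto (fun T : ℝ => C / (1 + T ^ 2) * |σ₂ - σ₁|) atTop (𝓝 0) := by
      have h5 : Tendsto (fun T : ℝ => 1 + T ^ 2) atTop atTop :=
        tendsto_atTop_add_const_left _ _ (tendsto_pow_atTop two_ne_zero)
      simpa using (h5.const_div_atTop C).mul_const |σ₂ - σ₁|
    refine squeeze_zero_norm (fun T => ?_) hlim
    refine intervalIntegral.norm_integral_le_of_norm_le_const fun x hx => ?_
    rw [Set.uIoc_of_le h] at hx
    have := hC (x + ((ε * T : ℝ) : ℂ) * Complex.I) (by simpa using hx.1.le) (by simpa using hx.2)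
    refine this.trans_eq ?_
    rcases hε with rfl | rfl <;> simp
  have l1 := intervalIntegral_tendsto_integral (hf.integrable hd h₁) tendsto_neg_atTop_atBot
    tendsto_id
  have l2 := intervalIntegral_tendsto_integral (hf.integrable hd h₂) tendsto_neg_atTop_atBot
    tendsto_id
  have hs1 := hside (-1) (Or.inr rfl)
  have hs2 := hside 1 (Or.inl rfl)
  have hlim := ((hs1.sub hs2).add (l2.const_smul Complex.I)).sub (l1.const_smul Complex.I)
  have h0 : Complex.I • (∫ t : ℝ, f (σ₂ + t * Complex.I)) -
      Complex.I • (∫ t : ℝ, f (σ₁ + t * Complex.I)) = 0 := by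
    have h6 : Tendsto (fun _ : ℝ => (0 : ℂ)) atTop (𝓝 _) :=
      hlim.congr fun T => by simpa using hrect T
    simpa using tendsto_nhds_unique h6 tendsto_const_nhds
  rw [← smul_sub, smul_eq_zero] at h0
  exact (sub_eq_zero.1 (h0.resolve_left Complex.I_ne_zero)).symm

end VerticalLines

/-! ### Evaluation of Meijer G-functions -/

section Meijer
namespace MeijerParams
open Complex

theorem Gamma_ne_zero_of_im_ne_zero {z : ℂ} (hz : z.im ≠ 0) : Gamma z ≠ 0 := by
  refine Complex.Gamma_ne_zero fun m h => hz ?_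
  rw [h]; simp

/-- Off the real axis the reduced integrand agrees with the original one. -/
theorem reduce_integrand {p : MeijerParams} (hb : ∀ z ∈ p.b, z.im = 0)
    (hd : ∀ z ∈ p.d, z.im = 0) (x : ℝ) {s : ℂ} (hs : s.im ≠ 0) :
    p.reduce.integrand x s = p.integrand x s := by
  classical
  -- Both sides are the product of g over the multiset union of u and v.
  have key : ∀ (g : ℂ → ℂ) (u v : Multiset ℂ),
      ((u - v).map g).prod * (v.map g).prod = (u.map g).prod * ((v - u).map g).prod := by
    intro g u v
    have e1 : u - v + (u ∩ v) = u := Multiset.sub_add_inter u v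
    have e2 : v - u + (u ∩ v) = v := by rw [Multiset.inter_comm]; exact Multiset.sub_add_inter v u
    have h1 : (u.map g).prod = ((u - v).map g).prod * ((u ∩ v).map g).prod := by
      rw [← Multiset.prod_add, ← Multiset.map_add, e1]
    have h2 : (v.map g).prod = ((v - u).map g).prod * ((u ∩ v).map g).prod := by
      rw [← Multiset.prod_add, ← Multiset.map_add, e2]
    rw [h1, h2]
    ring
  have hg1 : ∀ z ∈ p.b, Gamma (z - s) ≠ 0 := fun z hz =>
    Gamma_ne_zero_of_im_ne_zero (by simpa [hb z hz] using hs)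
  have hg2 : ∀ z ∈ p.d, Gamma (1 - z + s) ≠ 0 := fun z hz =>
    Gamma_ne_zero_of_im_ne_zero (by simpa [hd z hz] using hs)
  have k1 := key (fun z => Gamma (z - s)) p.c p.b
  have k2 := key (fun z => Gamma (1 - z + s)) p.a p.d
  have hpos : ∀ (g : ℂ → ℂ) (v u : Multiset ℂ), v ≤ u → (∀ z ∈ u, g z ≠ 0) →
      (v.map g).prod ≠ 0 := by
    intro g v u hvu h h0
    rw [Multiset.prod_eq_zero_iff, Multiset.mem_map] at h0
    obtain ⟨z, hz, hz0⟩ := h0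
    exact h z (Multiset.mem_of_le hvu hz) hz0
  unfold integrand
  congr 1
  rw [div_eq_div_iff]
  · simp only [reduce]
    linear_combination (((p.a - p.d).map fun a => Gamma (1 - a + s)).prod *
      (p.d.map fun d => Gamma (1 - d + s)).prod) * k1 +
      ((p.c.map fun c => Gamma (c - s)).prod * ((p.b - p.c).map fun b => Gamma (b - s)).prod) * k2
  · exact mul_ne_zero (hpos _ _ _ (Multiset.sub_le_self _ _) hg1)
      (hpos _ _ _ (Multiset.sub_le_self _ _) hg2)
  · exact mul_ne_zero (hpos _ _ _ le_rfl hg1) (hpos _ _ _ le_rfl hg2)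

/-- It suffices to find f holomorphic with quadratic decay on a strip containing every separating
line and equal to the integrand off the real axis. Real points, where Gamma factors may have poles
or take default values, meet each line only at t = 0. As the integral of f is the same on all lines,
the choice in `G` is immaterial. -/
theorem isWellDefined_and_G_eq {p : MeijerParams} {x : ℝ} (hb : ∀ z ∈ p.b, z.im = 0)
    (hd : ∀ z ∈ p.d, z.im = 0) {I : Set ℝ} {f : ℂ → ℂ}
    (hI : ∀ σ, p.reduce.Separates σ → σ ∈ I) (hne : ∃ σ, p.reduce.Separates σ)
    (hconn : I.OrdConnected) (hdiff : DifferentiableOn ℂ f {s | s.re ∈ I})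
    (hdec : QuadraticDecayOn f I) (hf : ∀ s : ℂ, s.re ∈ I → s.im ≠ 0 → p.integrand x s = f s) :
    p.IsWellDefined x ∧
      ∀ σ ∈ I, p.G x = (2 * Real.pi : ℂ)⁻¹ * ∫ t : ℝ, f (σ + t * Complex.I) := by
  have hae : ∀ σ ∈ I, (fun t : ℝ => p.reduce.integrand x ((σ : ℂ) + t * Complex.I)) =ᵐ[volume]
      fun t : ℝ => f (σ + t * Complex.I) := by
    intro σ hσ
    have h0 : ∀ᵐ t : ℝ, t ≠ 0 := by simp [ae_iff, measure_singleton]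
    filter_upwards [h0] with t ht
    have him : ((σ : ℂ) + t * Complex.I).im ≠ 0 := by simpa using ht
    rw [reduce_integrand hb hd x him]
    exact hf _ (by simpa using hσ) him
  have hline : ∀ σ ∈ I, p.reduce.lineIntegral x σ =
      (2 * Real.pi : ℂ)⁻¹ * ∫ t : ℝ, f (σ + t * Complex.I) := by
    intro σ hσ
    rw [lineIntegral, integral_congr_ae (hae σ hσ)]
  have hG : ∀ σ ∈ I, p.G x = (2 * Real.pi : ℂ)⁻¹ * ∫ t : ℝ, f (σ + t * Complex.I) := by
    intro σ hσ
    rw [G, dif_pos hne, hline _ (hI _ hne.choose_spec),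
      hdec.integral_eq hconn hdiff (hI _ hne.choose_spec) hσ]
  refine ⟨⟨hne, fun σ hσ => ⟨?_, ?_⟩⟩, hG⟩
  · exact (hdec.integrable hdiff (hI σ hσ)).congr (hae σ (hI σ hσ)).symm
  · rw [hline σ (hI σ hσ), hG σ (hI σ hσ)]

end MeijerParams
end Meijer

/-! ### Mellin transforms of distribution functions and their inversion -/

section MellinCdf
open Complex Filter Topology Set

/-- Fubini for the indicator of R times x^(s-1). The inner integral over x is evaluated by `h2`, and
`h3` evaluates its absolute version, which provides integrability. A general R covers the
distribution function and the tail together. -/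
theorem hasMellin_measureReal {μ : Measure ℝ} [IsProbabilityMeasure μ] {R : Set (ℝ × ℝ)}
    (hR : MeasurableSet R) {s c : ℂ} {c' : ℝ} (hpos : ∀ᵐ y ∂μ, 0 < y)
    (hint : Integrable (fun y : ℝ => (y : ℂ) ^ s) μ)
    (h1 : ∀ y : ℝ, 0 < y → IntegrableOn (fun x : ℝ => (x : ℂ) ^ (s - 1)) (Ioi 0 ∩ {x | (x, y) ∈ R}))
    (h2 : ∀ y : ℝ, 0 < y → ∫ x in Ioi 0 ∩ {x | (x, y) ∈ R}, (x : ℂ) ^ (s - 1) = c * (y : ℂ) ^ s)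
    (h3 : ∀ y : ℝ, 0 < y → ∫ x in Ioi 0 ∩ {x | (x, y) ∈ R}, x ^ (s.re - 1) = c' * y ^ s.re) :
    HasMellin (fun x => (μ.real {y | (x, y) ∈ R} : ℂ)) s (c * ∫ y, (y : ℂ) ^ s ∂μ) := by
  set F : ℝ × ℝ → ℂ := R.indicator fun q => (q.1 : ℂ) ^ (s - 1) with hF
  have hFm : Measurable F := Measurable.indicator (by fun_prop) hR
  have hRy : ∀ y, MeasurableSet {x : ℝ | (x, y) ∈ R} := fun y => measurable_prodMk_right hR
  have hFy : ∀ y, (fun x => F (x, y)) = {x | (x, y) ∈ R}.indicator fun x => (x : ℂ) ^ (s - 1) :=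
    fun y => rfl
  have hFx : ∀ x, ∫ y, F (x, y) ∂μ = (x : ℂ) ^ (s - 1) • (μ.real {y | (x, y) ∈ R} : ℂ) := by
    intro x
    have hRx : MeasurableSet {y : ℝ | (x, y) ∈ R} := measurable_prodMk_left hR
    refine (integral_indicator_const ((x : ℂ) ^ (s - 1)) hRx).trans ?_
    rw [smul_eq_mul, mul_comm, Complex.real_smul]
  have hI : Integrable F ((volume.restrict (Ioi 0)).prod μ) := by
    rw [integrable_prod_iff' hFm.aestronglyMeasurable]
    constructor
    · filter_upwards [hpos] with y hy
      rw [hFy, integrable_indicator_iff (hRy y), IntegrableOn, Measure.restrict_restrict (hRy y),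
        inter_comm]
      exact h1 y hy
    · have : (fun y => ‖(y : ℂ) ^ s‖ * c') =ᵐ[μ] fun y => ∫ x in Ioi 0, ‖F (x, y)‖ := by
        filter_upwards [hpos] with y hy
        rw [Complex.norm_cpow_eq_rpow_re_of_pos hy, mul_comm, ← h3 y hy, inter_comm,
          ← Measure.restrict_restrict (hRy y), ← integral_indicator (hRy y)]
        refine setIntegral_congr_fun measurableSet_Ioi fun x (hx : 0 < x) => ?_
        by_cases hxy : (x, y) ∈ R
        · simp [hF, hxy, Complex.norm_cpow_eq_rpow_re_of_pos hx]
        · simp [hF, hxy]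
      exact (hint.norm.mul_const c').congr this
  refine ⟨?_, ?_⟩
  · have := hI.integral_prod_left
    exact this.congr (ae_of_all _ hFx)
  · have h4 : mellin (fun x => (μ.real {y | (x, y) ∈ R} : ℂ)) s = ∫ x in Ioi 0, ∫ y, F (x, y) ∂μ :=
      integral_congr_ae (ae_of_all _ fun x => (hFx x).symm)
    rw [h4, integral_integral_swap (f := fun x y => F (x, y)) hI, ← integral_const_mul]
    refine integral_congr_ae ?_
    filter_upwards [hpos] with y hy
    rw [← h2 y hy, hFy, integral_indicator (hRy y), Measure.restrict_restrict (hRy y), inter_comm]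

theorem hasMellin_measureReal_Iic {μ : Measure ℝ} [IsProbabilityMeasure μ] {s : ℂ} (hs : s.re < 0)
    (hpos : ∀ᵐ y ∂μ, 0 < y) (hint : Integrable (fun y : ℝ => (y : ℂ) ^ s) μ) :
    HasMellin (fun x => (μ.real (Iic x) : ℂ)) s (-s⁻¹ * ∫ y, (y : ℂ) ^ s ∂μ) := by
  have hR : MeasurableSet {q : ℝ × ℝ | q.2 ≤ q.1} := measurableSet_le measurable_snd measurable_fst
  have hs' : (s - 1).re < -1 := by simp; linarith
  have hset : ∀ y : ℝ, 0 < y → Ioi 0 ∩ {x | (x, y) ∈ {q : ℝ × ℝ | q.2 ≤ q.1}} = Ici y := by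
    intro y hy
    ext x
    simp only [mem_inter_iff, mem_Ioi, mem_ofPred_eq, mem_Ici]
    exact ⟨fun h => h.2, fun h => ⟨hy.trans_le h, h⟩⟩
  refine hasMellin_measureReal hR (c' := -s.re⁻¹) hpos hint (fun y hy => ?_) (fun y hy => ?_)
    fun y hy => ?_
  · rw [hset y hy, integrableOn_Ici_iff_integrableOn_Ioi]
    exact integrableOn_Ioi_cpow_of_lt hs' hy
  · rw [hset y hy, integral_Ici_eq_integral_Ioi, integral_Ioi_cpow_of_lt hs' hy, sub_add_cancel]
    ring
  · rw [hset y hy, integral_Ici_eq_integral_Ioi, integral_Ioi_rpow_of_lt (by linarith) hy,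
      sub_add_cancel]
    ring

theorem hasMellin_measureReal_Ioi {μ : Measure ℝ} [IsProbabilityMeasure μ] {s : ℂ} (hs : 0 < s.re)
    (hpos : ∀ᵐ y ∂μ, 0 < y) (hint : Integrable (fun y : ℝ => (y : ℂ) ^ s) μ) :
    HasMellin (fun x => (μ.real (Ioi x) : ℂ)) s (s⁻¹ * ∫ y, (y : ℂ) ^ s ∂μ) := by
  have hR : MeasurableSet {q : ℝ × ℝ | q.1 < q.2} := measurableSet_lt measurable_fst measurable_snd
  have hs' : -1 < (s - 1).re := by simpa using hs
  have hs0 : s ≠ 0 := fun h => by simp [h] at hs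
  have hset : ∀ y : ℝ, 0 < y → Ioi 0 ∩ {x | (x, y) ∈ {q : ℝ × ℝ | q.1 < q.2}} = Ioo 0 y := by
    intro y hy
    rfl
  refine hasMellin_measureReal hR (c' := s.re⁻¹) hpos hint (fun y hy => ?_) (fun y hy => ?_)
    fun y hy => ?_
  · rw [hset y hy, ← integrableOn_Ioc_iff_integrableOn_Ioo,
      ← intervalIntegrable_iff_integrableOn_Ioc_of_le hy.le]
    exact intervalIntegral.intervalIntegrable_cpow' hs'
  · rw [hset y hy, ← integral_Ioc_eq_integral_Ioo, ← intervalIntegral.integral_of_le hy.le,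
      integral_cpow (Or.inl hs'), sub_add_cancel, ofReal_zero, zero_cpow hs0]
    ring
  · rw [hset y hy, ← integral_Ioc_eq_integral_Ioo, ← intervalIntegral.integral_of_le hy.le,
      integral_rpow (Or.inl (by linarith)), sub_add_cancel, Real.zero_rpow hs.ne']
    ring

/-- Mellin inversion holds at points of continuity; a law without atoms has a continuous
distribution function. -/
theorem continuous_measureReal_Iic (μ : Measure ℝ) [IsProbabilityMeasure μ] [NullSingletonClass μ] :
    Continuous fun x => μ.real (Iic x) := by
  have h : (fun x => μ.real (Iic x)) = cdf μ := by
    ext x; exact (cdf_eq_real μ x).symm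
  rw [h, continuous_iff_continuousAt]
  intro x
  rw [(monotone_cdf μ).continuousAt_iff_leftLim_eq_rightLim, StieltjesFunction.rightLim_eq]
  have h1 := (cdf μ).measure_singleton x
  rw [measure_cdf, measure_singleton] at h1
  have h2 := ENNReal.ofReal_eq_zero.1 h1.symm
  exact le_antisymm ((monotone_cdf μ).leftLim_le le_rfl) (by linarith)

theorem measureReal_Iic_eq_integral {μ : Measure ℝ} [IsProbabilityMeasure μ] [NullSingletonClass μ] {σ : ℝ}
    (hσ : σ < 0) (hpos : ∀ᵐ y ∂μ, 0 < y)
    (hint : ∀ s : ℂ, s.re = σ → Integrable (fun y : ℝ => (y : ℂ) ^ s) μ) {Φ : ℂ → ℂ}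
    (hΦ : ∀ s : ℂ, s.re = σ → -s⁻¹ * ∫ y, (y : ℂ) ^ s ∂μ = Φ s)
    (hv : Integrable fun t : ℝ => Φ (σ + t * I)) {x : ℝ} (hx : 0 < x) :
    (μ.real (Iic x) : ℂ) = mellinInv σ Φ x := by
  have hm : ∀ t : ℝ, HasMellin (fun x => (μ.real (Iic x) : ℂ)) (σ + t * I) (Φ (σ + t * I)) := by
    intro t
    have hre : ((σ : ℂ) + t * I).re = σ := by simp
    rw [← hΦ _ hre]
    exact hasMellin_measureReal_Iic (by rw [hre]; exact hσ) hpos (hint _ hre)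
  have h := mellinInv_mellin_eq σ (fun x => (μ.real (Iic x) : ℂ)) hx
    (by simpa using (hm 0).1) (hv.congr (ae_of_all _ fun t => (hm t).2.symm))
    (Complex.continuous_ofReal.comp (continuous_measureReal_Iic μ)).continuousAt
  rw [← h, mellinInv, mellinInv]
  congr 1
  exact integral_congr_ae (ae_of_all _ fun t => congrArg _ (hm t).2)

theorem measureReal_Ioi_eq_integral {μ : Measure ℝ} [IsProbabilityMeasure μ] [NullSingletonClass μ] {σ : ℝ}
    (hσ : 0 < σ) (hpos : ∀ᵐ y ∂μ, 0 < y)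
    (hint : ∀ s : ℂ, s.re = σ → Integrable (fun y : ℝ => (y : ℂ) ^ s) μ) {Φ : ℂ → ℂ}
    (hΦ : ∀ s : ℂ, s.re = σ → s⁻¹ * ∫ y, (y : ℂ) ^ s ∂μ = Φ s)
    (hv : Integrable fun t : ℝ => Φ (σ + t * I)) {x : ℝ} (hx : 0 < x) :
    (μ.real (Ioi x) : ℂ) = mellinInv σ Φ x := by
  have hm : ∀ t : ℝ, HasMellin (fun x => (μ.real (Ioi x) : ℂ)) (σ + t * I) (Φ (σ + t * I)) := by
    intro t
    have hre : ((σ : ℂ) + t * I).re = σ := by simp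
    rw [← hΦ _ hre]
    exact hasMellin_measureReal_Ioi (by rw [hre]; exact hσ) hpos (hint _ hre)
  have hc : Continuous fun x => (μ.real (Ioi x) : ℂ) := by
    have : ∀ x, μ.real (Ioi x) = 1 - μ.real (Iic x) := fun x => by
      rw [← compl_Iic, probReal_compl_eq_one_sub measurableSet_Iic]
    simp_rw [this]
    exact Complex.continuous_ofReal.comp (continuous_const.sub (continuous_measureReal_Iic μ))
  have h := mellinInv_mellin_eq σ (fun x => (μ.real (Ioi x) : ℂ)) hx
    (by simpa using (hm 0).1) (hv.congr (ae_of_all _ fun t => (hm t).2.symm)) hc.continuousAt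
  rw [← h, mellinInv, mellinInv]
  congr 1
  exact integral_congr_ae (ae_of_all _ fun t => congrArg _ (hm t).2)

end MellinCdf

/-! ### Complex moments of products of Gamma variables -/

section GammaMoments
open Complex Set
open scoped ENNReal

theorem gammaMeasure_natCast_eq_withDensity (a : ℕ) :
    gammaMeasure (a + 1 : ℕ) 1 = (volume.restrict (Ioi (0 : ℝ))).withDensity
      fun x => ENNReal.ofReal (x ^ a / a.factorial * Real.exp (-x)) := by
  refine Measure.ext_of_lintegral _ fun f hf => ?_
  rw [lintegral_gammaMeasure_natCast a f hf, lintegral_withDensity_eq_lintegral_mul _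
    (by fun_prop) hf]
  rfl

theorem gammaMeasure_ae_pos (a : ℕ) : ∀ᵐ x ∂gammaMeasure (a + 1 : ℕ) 1, 0 < x := by
  rw [gammaMeasure_natCast_eq_withDensity]
  exact (withDensity_absolutelyContinuous _ _).ae_le (ae_restrict_mem measurableSet_Ioi)

theorem gammaMeasure_cpow (a : ℕ) {z : ℂ} (hz : 0 < (a + 1 + z).re) :
    Integrable (fun x : ℝ => (x : ℂ) ^ z) (gammaMeasure (a + 1 : ℕ) 1) ∧
      ∫ x : ℝ, (x : ℂ) ^ z ∂gammaMeasure (a + 1 : ℕ) 1 = Gamma (a + 1 + z) / a.factorial := by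
  have hd : Measurable fun x : ℝ => ENNReal.ofReal (x ^ a / a.factorial * Real.exp (-x)) := by
    fun_prop
  have hfin : ∀ᵐ x : ℝ ∂volume.restrict (Ioi (0 : ℝ)),
      ENNReal.ofReal (x ^ a / a.factorial * Real.exp (-x)) < ∞ := ae_of_all _ fun x => by simp
  have key : ∀ x ∈ Ioi (0 : ℝ), (ENNReal.ofReal (x ^ a / a.factorial * Real.exp (-x))).toReal •
      (x : ℂ) ^ z = ((-x).exp : ℂ) * (x : ℂ) ^ (a + 1 + z - 1) / a.factorial := by
    intro x hx
    have hx0 : 0 < x := hx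
    have hxc : (x : ℂ) ≠ 0 := by exact_mod_cast hx0.ne'
    rw [ENNReal.toReal_ofReal (by positivity), Complex.real_smul,
      show (a : ℂ) + 1 + z - 1 = a + z by ring, Complex.cpow_add _ _ hxc, Complex.cpow_natCast]
    push_cast
    ring
  have hI := (Complex.GammaIntegral_convergent hz).div_const (a.factorial : ℂ)
  rw [gammaMeasure_natCast_eq_withDensity]
  constructor
  · rw [integrable_withDensity_iff_integrable_smul' hd hfin]
    exact IntegrableOn.congr_fun hI (fun x hx => (key x hx).symm) measurableSet_Ioi
  · rw [integral_withDensity_eq_integral_toReal_smul hd hfin, setIntegral_congr_fun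
      measurableSet_Ioi key, integral_div, ← Complex.GammaIntegral, Complex.Gamma_eq_integral hz]

instance nullSingletonClass_gammaMeasure (a : ℕ) : NullSingletonClass (gammaMeasure (a + 1 : ℕ) 1) :=
  ⟨fun x => by
    rw [gammaMeasure_natCast_eq_withDensity]
    exact withDensity_absolutelyContinuous _ _ (measure_singleton x)⟩

theorem gammaProd_ae_pos {δ : ℝ} (hδ : 0 < δ) : ∀ {M : ℕ} (a : Fin M → ℕ),
    ∀ᵐ x ∂gammaProd a δ, 0 < x
  | 0, a => by
      rw [gammaProd]
      exact (ae_dirac_iff measurableSet_Ioi).2 hδ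
  | M + 1, a => by
      have ih := gammaProd_ae_pos hδ fun i : Fin M => a i.castSucc
      rw [gammaProd, ae_map_iff (by fun_prop) measurableSet_Ioi]
      have h1 := Measure.quasiMeasurePreserving_fst
        (μ := gammaProd (fun i : Fin M => a i.castSucc) δ)
        (ν := gammaMeasure (a (Fin.last M) + 1 : ℕ) 1) |>.ae ih
      have h2 := Measure.quasiMeasurePreserving_snd
        (μ := gammaProd (fun i : Fin M => a i.castSucc) δ)
        (ν := gammaMeasure (a (Fin.last M) + 1 : ℕ) 1) |>.ae (gammaMeasure_ae_pos _)
      filter_upwards [h1, h2] with q hq1 hq2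
      exact mul_pos hq1 hq2

/-- One factor with a density suffices: given the positive value y of the other factors, the last
one would have to equal c / y. The empty product is a Dirac mass, so at least one factor is
required. -/
theorem nullSingletonClass_gammaProd {M : ℕ} (a : Fin (M + 1) → ℕ) {δ : ℝ} (hδ : 0 < δ) :
    NullSingletonClass (gammaProd a δ) := by
  refine ⟨fun c => ?_⟩
  rw [← lintegral_indicator_one (measurableSet_singleton c), lintegral_gammaProd_succ a δ
    (measurable_one.indicator (measurableSet_singleton c))]
  refine lintegral_eq_zero_of_ae_eq_zero ?_
  filter_upwards [gammaProd_ae_pos hδ fun i : Fin M => a i.castSucc] with y hy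
  refine lintegral_eq_zero_of_ae_eq_zero ?_
  have : ∀ᵐ x ∂gammaMeasure (a (Fin.last M) + 1 : ℕ) 1, x ≠ c / y := by
    have h0 := measure_singleton (μ := gammaMeasure (a (Fin.last M) + 1 : ℕ) 1) (c / y)
    exact (measure_eq_zero_iff_ae_notMem.1 h0)
  filter_upwards [this] with x hx
  refine Set.indicator_of_notMem (fun h => hx ?_) _
  rw [eq_div_iff hy.ne', mul_comm]
  exact h

/-- By independence the moment is multiplicative over the factors; positivity almost everywhere
allows the complex power of the product to be split. -/
theorem gammaProd_cpow {δ : ℝ} (hδ : 0 < δ) {z : ℂ} : ∀ {M : ℕ} (a : Fin M → ℕ),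
    (∀ l, 0 < (a l + 1 + z).re) →
    Integrable (fun x : ℝ => (x : ℂ) ^ z) (gammaProd a δ) ∧
      ∫ x : ℝ, (x : ℂ) ^ z ∂gammaProd a δ =
        (δ : ℂ) ^ z * ∏ l, (Gamma (a l + 1 + z) / (a l).factorial)
  | 0, a, _ => by
      rw [gammaProd]
      refine ⟨?_, by simp⟩
      exact integrable_dirac (by simp)
  | M + 1, a, ha => by
      have ih := gammaProd_cpow hδ (fun i : Fin M => a i.castSucc) fun l => ha l.castSucc
      have hg := gammaMeasure_cpow (a (Fin.last M)) (ha (Fin.last M))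
      have hmeas : Measurable fun x : ℝ => (x : ℂ) ^ z := by fun_prop
      have h1 := Measure.quasiMeasurePreserving_fst
        (μ := gammaProd (fun i : Fin M => a i.castSucc) δ)
        (ν := gammaMeasure (a (Fin.last M) + 1 : ℕ) 1) |>.ae (gammaProd_ae_pos hδ _)
      have h2 := Measure.quasiMeasurePreserving_snd
        (μ := gammaProd (fun i : Fin M => a i.castSucc) δ)
        (ν := gammaMeasure (a (Fin.last M) + 1 : ℕ) 1) |>.ae (gammaMeasure_ae_pos _)
      have hae : (fun q : ℝ × ℝ => ((q.1 : ℂ) ^ z * (q.2 : ℂ) ^ z))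
          =ᵐ[(gammaProd (fun i : Fin M => a i.castSucc) δ).prod
            (gammaMeasure (a (Fin.last M) + 1 : ℕ) 1)]
          fun q => ((q.1 * q.2 : ℝ) : ℂ) ^ z := by
        filter_upwards [h1, h2] with q hq1 hq2
        rw [Complex.ofReal_mul, Complex.mul_cpow_ofReal_nonneg hq1.le hq2.le]
      rw [gammaProd, integrable_map_measure hmeas.aestronglyMeasurable (by fun_prop),
        integral_map (by fun_prop) hmeas.aestronglyMeasurable, ← integral_congr_ae hae]
      refine ⟨(ih.1.mul_prod hg.1).congr hae, ?_⟩
      rw [integral_prod_mul (fun x : ℝ => (x : ℂ) ^ z) fun x : ℝ => (x : ℂ) ^ z, ih.2, hg.2,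
        Fin.prod_univ_castSucc, mul_assoc]

end GammaMoments

/-! ### Barnes integrals for the distribution function and the tail -/

section Barnes
open Complex Set

/-- The product `∏ Γ(ν_l - s)`. -/
def nuGamma {M : ℕ} (ν : Fin M → ℕ) (s : ℂ) : ℂ := ∏ l, Gamma (ν l - s)

/-- The real parts to the left of all poles of `nuGamma ν`. -/
def nuStrip {M : ℕ} (ν : Fin M → ℕ) : Set ℝ := {σ | ∀ l, σ < ν l}

theorem nuStrip_ordConnected {M : ℕ} (ν : Fin M → ℕ) : (nuStrip ν).OrdConnected :=
  ⟨fun _ _ _ hy _ hz l => hz.2.trans_lt (hy l)⟩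

theorem mem_nuStrip_of_neg {M : ℕ} (ν : Fin M → ℕ) {σ : ℝ} (hσ : σ < 0) : σ ∈ nuStrip ν :=
  fun l => hσ.trans_le (ν l).cast_nonneg

theorem differentiableAt_Gamma_of_re_pos {s : ℂ} (hs : 0 < s.re) : DifferentiableAt ℂ Gamma s := by
  refine differentiableAt_Gamma s fun m h => ?_
  rw [h] at hs
  simp only [neg_re, natCast_re] at hs
  linarith [(m.cast_nonneg : (0 : ℝ) ≤ m)]

theorem differentiableOn_nuGamma {M : ℕ} (ν : Fin M → ℕ) :
    DifferentiableOn ℂ (nuGamma ν) {s | s.re ∈ nuStrip ν} := by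
  unfold nuGamma
  refine DifferentiableOn.fun_finsetProd fun l _ s hs => DifferentiableAt.differentiableWithinAt ?_
  exact (differentiableAt_Gamma_of_re_pos (by simpa using hs l)).comp s (by fun_prop)

theorem QuadraticDecayOn.mono {f : ℂ → ℂ} {I J : Set ℝ} (hf : QuadraticDecayOn f J) (h : I ⊆ J) :
    QuadraticDecayOn f I := fun σ₁ h1 σ₂ h2 => hf σ₁ (h h1) σ₂ (h h2)

theorem quadraticDecayOn_nuGamma {M : ℕ} (ν : Fin (M + 1) → ℕ) :
    QuadraticDecayOn (nuGamma ν) (nuStrip ν) := by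
  intro σ₁ _ σ₂ h2
  have h : ∀ l, ∃ C, 0 ≤ C ∧ ∀ z : ℂ, ν l - σ₂ ≤ z.re → z.re ≤ ν l - σ₁ →
      ‖Gamma z‖ ≤ C / (1 + z.im ^ 2) := fun l =>
    exists_norm_Gamma_le (sub_pos.2 (h2 l)) _
  choose C hC0 hC using h
  refine ⟨∏ l, C l, fun s hs1 hs2 => ?_⟩
  have h1 : 1 ≤ 1 + s.im ^ 2 := by nlinarith [sq_nonneg s.im]
  unfold nuGamma
  rw [norm_prod]
  calc ∏ l, ‖Gamma (ν l - s)‖ ≤ ∏ l, C l / (1 + s.im ^ 2) := by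
        refine Finset.prod_le_prod (fun _ _ => norm_nonneg _) fun l _ => ?_
        simpa using hC l (ν l - s) (by simp; linarith) (by simp; linarith)
    _ = (∏ l, C l) / (1 + s.im ^ 2) ^ (M + 1) := by
        rw [Finset.prod_div_distrib, Finset.prod_const, Finset.card_univ, Fintype.card_fin]
    _ ≤ (∏ l, C l) / (1 + s.im ^ 2) :=
        div_le_div_of_nonneg_left (Finset.prod_nonneg fun l _ => hC0 l) (by positivity)
          (le_self_pow₀ h1 M.succ_ne_zero)

theorem bounded_cpow_strip {y : ℝ} (hy : 0 < y) (I : Set ℝ) :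
    ∀ σ₁ ∈ I, ∀ σ₂ ∈ I, ∃ C, ∀ s : ℂ, σ₁ ≤ s.re → s.re ≤ σ₂ → ‖(y : ℂ) ^ s‖ ≤ C := by
  refine fun σ₁ _ σ₂ _ => ⟨y ^ σ₁ + y ^ σ₂, fun s h1 h2 => ?_⟩
  rw [Complex.norm_cpow_eq_rpow_re_of_pos hy]
  rcases le_total 1 y with h | h
  · linarith [Real.rpow_le_rpow_of_exponent_le h h2, Real.rpow_nonneg hy.le σ₁]
  · linarith [Real.rpow_le_rpow_of_exponent_ge hy h h1, Real.rpow_nonneg hy.le σ₂]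

theorem bounded_inv_add_strip (c : ℝ) {I : Set ℝ}
    (hI : (∀ σ ∈ I, 0 < c + σ) ∨ ∀ σ ∈ I, c + σ < 0) :
    ∀ σ₁ ∈ I, ∀ σ₂ ∈ I, ∃ C, ∀ s : ℂ, σ₁ ≤ s.re → s.re ≤ σ₂ → ‖((c : ℂ) + s)⁻¹‖ ≤ C := by
  intro σ₁ h1 σ₂ h2
  have key : ∀ s : ℂ, |c + s.re| ≤ ‖(c : ℂ) + s‖ := fun s => by
    simpa using Complex.abs_re_le_norm ((c : ℂ) + s)
  rcases hI with hI | hI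
  · refine ⟨(c + σ₁)⁻¹, fun s hs1 hs2 => ?_⟩
    rw [norm_inv]
    refine inv_anti₀ (hI _ h1) ?_
    linarith [key s, le_abs_self (c + s.re)]
  · refine ⟨(-(c + σ₂))⁻¹, fun s hs1 hs2 => ?_⟩
    rw [norm_inv]
    refine inv_anti₀ (by linarith [hI _ h2]) ?_
    linarith [key s, neg_abs_le (c + s.re)]

/-- The Mellin-Barnes integrand of the distribution function of a product of Gamma variables. -/
def cdfIntegrand {M : ℕ} (ν : Fin M → ℕ) (j : ℕ) (y : ℝ) (s : ℂ) : ℂ :=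
  ((1 + j : ℝ) + s)⁻¹ * ((y : ℂ) ^ s * nuGamma ν s)

theorem quadraticDecayOn_cpow_nuGamma {M : ℕ} (ν : Fin (M + 1) → ℕ) {y : ℝ} (hy : 0 < y) :
    QuadraticDecayOn (fun s => (y : ℂ) ^ s * nuGamma ν s) (nuStrip ν) :=
  (quadraticDecayOn_nuGamma ν).bounded_mul (bounded_cpow_strip hy _)

theorem differentiableOn_cpow_nuGamma {M : ℕ} (ν : Fin M → ℕ) {y : ℝ} (hy : 0 < y) :
    DifferentiableOn ℂ (fun s => (y : ℂ) ^ s * nuGamma ν s) {s | s.re ∈ nuStrip ν} := by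
  refine DifferentiableOn.mul (fun s _ => ?_) (differentiableOn_nuGamma ν)
  exact (DifferentiableAt.const_cpow differentiableAt_id
    (Or.inl (by exact_mod_cast hy.ne'))).differentiableWithinAt

theorem add_ne_zero_of_re {c : ℝ} {s : ℂ} (h : c + s.re ≠ 0) : (c : ℂ) + s ≠ 0 := by
  intro h0
  have := congrArg Complex.re h0
  simp at this
  exact h this

theorem differentiableOn_cdfIntegrand {M : ℕ} (ν : Fin M → ℕ) (j : ℕ) {y : ℝ} (hy : 0 < y)
    {I : Set ℝ} (hI : (∀ σ ∈ I, 0 < (1 + j : ℝ) + σ) ∨ ∀ σ ∈ I, (1 + j : ℝ) + σ < 0)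
    (hν : I ⊆ nuStrip ν) : DifferentiableOn ℂ (cdfIntegrand ν j y) {s | s.re ∈ I} := by
  refine DifferentiableOn.mul (fun s hs => ?_)
    ((differentiableOn_cpow_nuGamma ν hy).mono fun s hs => hν hs)
  refine (DifferentiableAt.inv (by fun_prop) (add_ne_zero_of_re ?_)).differentiableWithinAt
  rcases hI with hI | hI
  · exact (hI _ hs).ne'
  · exact (hI _ hs).ne

theorem quadraticDecayOn_cdfIntegrand {M : ℕ} (ν : Fin (M + 1) → ℕ) (j : ℕ) {y : ℝ} (hy : 0 < y)
    {I : Set ℝ} (hI : (∀ σ ∈ I, 0 < (1 + j : ℝ) + σ) ∨ ∀ σ ∈ I, (1 + j : ℝ) + σ < 0)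
    (hν : I ⊆ nuStrip ν) : QuadraticDecayOn (cdfIntegrand ν j y) I :=
  ((quadraticDecayOn_cpow_nuGamma ν hy).mono hν).bounded_mul (bounded_inv_add_strip _ hI)

theorem integrable_cdfIntegrand {M : ℕ} (ν : Fin (M + 1) → ℕ) (j : ℕ) {y σ : ℝ} (hy : 0 < y)
    (hσ : (1 + j : ℝ) + σ ≠ 0) (hν : σ ∈ nuStrip ν) :
    Integrable fun t : ℝ => cdfIntegrand ν j y (σ + t * I) := by
  have hI : (∀ τ ∈ ({σ} : Set ℝ), 0 < (1 + j : ℝ) + τ) ∨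
      ∀ τ ∈ ({σ} : Set ℝ), (1 + j : ℝ) + τ < 0 := by
    rcases lt_or_gt_of_ne hσ with h | h
    · right; rintro τ rfl; exact h
    · left; rintro τ rfl; exact h
  have hs : ({σ} : Set ℝ) ⊆ nuStrip ν := by rintro τ rfl; exact hν
  exact (quadraticDecayOn_cdfIntegrand ν j hy hI hs).integrable
    (differentiableOn_cdfIntegrand ν j hy hI hs) rfl

/-- The Mellin transform of the distribution function, at `s' = -(1 + j + s)`. -/
theorem cpow_mul_moment_eq {M : ℕ} (ν : Fin M → ℕ) (j : ℕ) {δ x : ℝ} (hδ : 0 < δ) (hx : 0 < x)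
    (s s' : ℂ) (hs : s' = -((1 + j : ℝ) + s)) :
    (x : ℂ) ^ (-s') * (-s'⁻¹ * ((δ : ℂ) ^ s' *
      ∏ l, (Gamma ((ν l + j : ℕ) + 1 + s') / (ν l + j).factorial))) =
    ((x / δ : ℝ) : ℂ) ^ (j + 1) / (∏ l, ((ν l + j).factorial : ℂ)) *
      cdfIntegrand ν j (x / δ) s := by
  have hδc : (δ : ℂ) ≠ 0 := by exact_mod_cast hδ.ne'
  have h1 : ∀ l, Gamma ((ν l + j : ℕ) + 1 + s') = Gamma (ν l - s) := fun l => by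
    congr 1; rw [hs]; push_cast; ring
  have h2 : (x : ℂ) ^ (-s') * (δ : ℂ) ^ s' = ((x / δ : ℝ) : ℂ) ^ (j + 1) * ((x / δ : ℝ) : ℂ) ^ s := by
    have h3 : ((x / δ : ℝ) : ℂ) ≠ 0 := by exact_mod_cast (div_pos hx hδ).ne'
    rw [← Complex.cpow_natCast, ← Complex.cpow_add _ _ h3,
      show ((j + 1 : ℕ) : ℂ) + s = -s' by rw [hs]; push_cast; ring, Complex.ofReal_div,
      Complex.div_cpow_ofReal_nonneg hx.le hδ.le, Complex.cpow_neg (δ : ℂ) s', div_inv_eq_mul]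
  simp only [h1, Finset.prod_div_distrib]
  rw [cdfIntegrand, nuGamma]
  have h4 : -s'⁻¹ = ((1 + j : ℝ) + s)⁻¹ := by rw [hs, inv_neg, neg_neg]
  rw [h4]
  linear_combination (((1 + j : ℝ) + s)⁻¹ * ((∏ l, Gamma (ν l - s)) /
    ∏ l, ((ν l + j).factorial : ℂ))) * h2

/-- The substitution s' = -(1 + j + s) turns the moments Γ(ν_l + j + 1 + s') into Γ(ν_l - s). It
reverses the direction of the line, which is why t becomes -t. -/
theorem mellinInv_moment_eq {M : ℕ} (ν : Fin (M + 1) → ℕ) (j : ℕ) {δ : ℝ} (hδ : 0 < δ)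
    {σ : ℝ} (hσ : (1 + j : ℝ) + σ ≠ 0) (hν : σ ∈ nuStrip ν) {Φ : ℂ → ℂ}
    (hΦ : ∀ s, Φ s = -s⁻¹ * ((δ : ℂ) ^ s *
      ∏ l, (Gamma ((ν l + j : ℕ) + 1 + s) / (ν l + j).factorial))) :
    (Integrable fun t : ℝ => Φ ((-((1 + j) + σ) : ℝ) + t * I)) ∧
    ∀ x : ℝ, 0 < x → mellinInv (-((1 + j) + σ)) Φ x =
      ((x / δ : ℝ) : ℂ) ^ (j + 1) / (∏ l, ((ν l + j).factorial : ℂ)) *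
        ((2 * Real.pi : ℂ)⁻¹ * ∫ t : ℝ, cdfIntegrand ν j (x / δ) (σ + t * I)) := by
  have key : ∀ x : ℝ, 0 < x → ∀ t : ℝ, (x : ℂ) ^ (-(((-((1 + j) + σ) : ℝ) : ℂ) + t * I)) *
      Φ ((-((1 + j) + σ) : ℝ) + t * I) =
      ((x / δ : ℝ) : ℂ) ^ (j + 1) / (∏ l, ((ν l + j).factorial : ℂ)) *
        cdfIntegrand ν j (x / δ) (σ + (-t : ℝ) * I) := by
    intro x hx t
    rw [hΦ]
    refine cpow_mul_moment_eq ν j hδ hx _ _ ?_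
    push_cast
    ring
  constructor
  · have h1 := ((integrable_cdfIntegrand ν j (one_div_pos.2 hδ) hσ hν).comp_neg).const_mul
      (((1 / δ : ℝ) : ℂ) ^ (j + 1) / (∏ l, ((ν l + j).factorial : ℂ)))
    refine h1.congr (ae_of_all _ fun t => ?_)
    have := key 1 one_pos t
    rw [Complex.ofReal_one, Complex.one_cpow, one_mul] at this
    exact this.symm
  · intro x hx
    rw [mellinInv]
    simp only [smul_eq_mul, key x hx]
    rw [integral_const_mul,
      integral_neg_eq_self (fun t : ℝ => cdfIntegrand ν j (x / δ) (σ + t * I)) volume,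
      Complex.real_smul]
    push_cast
    ring

theorem gammaProd_moment_re_pos {M : ℕ} {ν : Fin M → ℕ} {j : ℕ} {σ : ℝ} (hν : σ ∈ nuStrip ν)
    {s : ℂ} (hs : s.re = -((1 + j) + σ)) (l : Fin M) : 0 < (((ν l + j : ℕ) : ℂ) + 1 + s).re := by
  have := hν l
  simp [hs]
  linarith

/-- A line to the right of the pole s = -1-j corresponds to Re s' < 0, where the Mellin transform of
the distribution function converges. -/
theorem gammaProd_real_Iic {M : ℕ} (ν : Fin (M + 1) → ℕ) (j : ℕ) {δ : ℝ} (hδ : 0 < δ)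
    {σ : ℝ} (hσ : 0 < (1 + j : ℝ) + σ) (hν : σ ∈ nuStrip ν) {x : ℝ} (hx : 0 < x) :
    ((gammaProd (fun l => ν l + j) δ).real (Iic x) : ℂ) =
      ((x / δ : ℝ) : ℂ) ^ (j + 1) / (∏ l, ((ν l + j).factorial : ℂ)) *
        ((2 * Real.pi : ℂ)⁻¹ * ∫ t : ℝ, cdfIntegrand ν j (x / δ) (σ + t * I)) := by
  have hna := nullSingletonClass_gammaProd (fun l => ν l + j) hδ
  obtain ⟨h1, h2⟩ := mellinInv_moment_eq ν j hδ hσ.ne' hν (fun s => rfl)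
  rw [← h2 x hx]
  refine measureReal_Iic_eq_integral (neg_lt_zero.2 hσ) (gammaProd_ae_pos hδ _) (fun s hs => ?_)
    (fun s hs => ?_) h1 hx
  · exact (gammaProd_cpow hδ _ (gammaProd_moment_re_pos hν hs)).1
  · rw [(gammaProd_cpow hδ _ (gammaProd_moment_re_pos hν hs)).2]

/-- To the left of the pole s = -1-j, where Re s' > 0, the Mellin transform that converges is that
of the tail. The kernel is the same up to sign. -/
theorem gammaProd_real_Ioi {M : ℕ} (ν : Fin (M + 1) → ℕ) (j : ℕ) {δ : ℝ} (hδ : 0 < δ)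
    {σ : ℝ} (hσ : (1 + j : ℝ) + σ < 0) {x : ℝ} (hx : 0 < x) :
    ((gammaProd (fun l => ν l + j) δ).real (Ioi x) : ℂ) =
      -(((x / δ : ℝ) : ℂ) ^ (j + 1) / (∏ l, ((ν l + j).factorial : ℂ)) *
        ((2 * Real.pi : ℂ)⁻¹ * ∫ t : ℝ, cdfIntegrand ν j (x / δ) (σ + t * I))) := by
  have hna := nullSingletonClass_gammaProd (fun l => ν l + j) hδ
  have hν : σ ∈ nuStrip ν := mem_nuStrip_of_neg ν (by
    linarith [(j.cast_nonneg : (0 : ℝ) ≤ j)])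
  obtain ⟨h1, h2⟩ := mellinInv_moment_eq ν j hδ hσ.ne hν (fun s => rfl)
  rw [← h2 x hx, measureReal_Ioi_eq_integral (Φ := fun s => -(-s⁻¹ * ((δ : ℂ) ^ s *
      ∏ l, (Gamma ((ν l + j : ℕ) + 1 + s) / (ν l + j).factorial)))) (neg_pos.2 hσ)
    (gammaProd_ae_pos hδ _) (fun s hs => ?_) (fun s hs => ?_) h1.neg hx]
  · simp only [mellinInv, smul_neg, integral_neg]
  · exact (gammaProd_cpow hδ _ (gammaProd_moment_re_pos hν hs)).1
  · rw [(gammaProd_cpow hδ _ (gammaProd_moment_re_pos hν hs)).2]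
    ring

end Barnes

/-! ### The G-function of the density -/

section SinrMeijer
open Complex Set

theorem reduce_a_mem {p : MeijerParams} {z : ℂ} (h : z ∈ p.reduce.a) : z ∈ p.a :=
  Multiset.mem_of_le (Multiset.sub_le_self _ _) h

theorem mem_reduce_a {p : MeijerParams} {z : ℂ} (h : z ∈ p.a) (h' : z ∉ p.d) : z ∈ p.reduce.a := by
  classical
  have h1 : z ∈ p.a - p.d := by
    rw [Multiset.mem_sub, Multiset.count_eq_zero_of_notMem h']
    exact Multiset.count_pos.2 h
  unfold MeijerParams.reduce
  convert h1

theorem mem_reduce_c {p : MeijerParams} {z : ℂ} (h : z ∈ p.c) (h' : z ∉ p.b) : z ∈ p.reduce.c := by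
  classical
  have h1 : z ∈ p.c - p.b := by
    rw [Multiset.mem_sub, Multiset.count_eq_zero_of_notMem h']
    exact Multiset.count_pos.2 h
  unfold MeijerParams.reduce
  convert h1

theorem reduce_c_mem {p : MeijerParams} {z : ℂ} (h : z ∈ p.reduce.c) : z ∈ p.c :=
  Multiset.mem_of_le (Multiset.sub_le_self _ _) h

/-- `(g + n) / (g + 1)`. -/
def sinrShift (n : ℕ) (g : ℝ) : ℝ := (g + n) / (g + 1)

/-- With c = (g + n)/(g + 1), the parameter pairs contribute Γ(1+c+s)/Γ(c+s) = c + s and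
Γ(1+j+s)/Γ(2+j+s) = 1/(1+j+s). -/
theorem sinrParams_integrand (n : ℕ) {M : ℕ} (ν : Fin M → ℕ) (j : ℕ) (g x : ℝ) {s : ℂ}
    (hs : s.im ≠ 0) : (sinrParams n ν j g).integrand x s =
      (sinrShift n g + s) * cdfIntegrand ν j x s := by
  have e : ((g : ℂ) + n) / (g + 1) = (sinrShift n g : ℝ) := by
    rw [sinrShift]; push_cast; rfl
  have him : ∀ r : ℝ, ((r : ℂ) + s).im ≠ 0 := fun r => by simpa using hs
  have hΓ : ∀ r : ℝ, Gamma ((r : ℂ) + s) ≠ 0 := fun r =>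
    MeijerParams.Gamma_ne_zero_of_im_ne_zero (him r)
  have hne : ∀ r : ℝ, (r : ℂ) + s ≠ 0 := fun r h => him r (by rw [h]; rfl)
  have h1 : Gamma (1 - (-1 - (j : ℂ)) + s) = ((1 + j : ℝ) + s) * Gamma ((1 + j : ℝ) + s) := by
    rw [← Gamma_add_one _ (hne _)]; congr 1; push_cast; ring
  have h2 : Gamma (1 - -(j : ℂ) + s) = Gamma ((1 + j : ℝ) + s) := by
    congr 1; push_cast; ring
  have h3 : Gamma (1 - -(sinrShift n g : ℂ) + s) =
      (sinrShift n g + s) * Gamma ((sinrShift n g : ℂ) + s) := by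
    rw [← Gamma_add_one _ (hne _)]; congr 1; ring
  have h4 : Gamma (1 - (1 - (sinrShift n g : ℂ)) + s) = Gamma ((sinrShift n g : ℂ) + s) := by
    congr 1; ring
  have h5 := hne (1 + j)
  have h6 := hΓ (1 + j)
  have h7 := hΓ (sinrShift n g)
  simp only [MeijerParams.integrand, sinrParams, nuParams, Multiset.map_map, Multiset.map_zero,
    Multiset.prod_zero, Multiset.insert_eq_cons, Multiset.map_cons, Multiset.map_singleton,
    Multiset.prod_cons, Multiset.prod_singleton, e, h1, h2, h3, h4, one_mul, cdfIntegrand]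
  have h8 : (Multiset.map ((fun c => Gamma (c - s)) ∘ fun l => (ν l : ℂ)) Finset.univ.val).prod =
    nuGamma ν s := rfl
  rw [h8]
  field_simp

theorem nuStrip_of_separates_sinr {n M : ℕ} {ν : Fin M → ℕ} {j : ℕ} {g σ : ℝ}
    (h : (sinrParams n ν j g).reduce.Separates σ) : σ ∈ nuStrip ν := by
  intro l
  have := h.1 (ν l) (mem_reduce_c (by
    simp only [sinrParams, nuParams, Multiset.mem_map]
    exact ⟨l, Finset.mem_univ l, rfl⟩) (by simp [sinrParams]))
  simpa using this

theorem separates_sinr_neg_half {n : ℕ} {M : ℕ} (ν : Fin M → ℕ) (j : ℕ) {g : ℝ}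
    (hg : 0 < g) : (sinrParams n ν j g).reduce.Separates (-1 / 2) := by
  constructor
  · intro c hc
    have := reduce_c_mem hc
    simp only [sinrParams, nuParams, Multiset.mem_map] at this
    obtain ⟨l, -, rfl⟩ := this
    have h0 : (0 : ℝ) ≤ ν l := (ν l).cast_nonneg
    simp only [natCast_re]
    linarith
  · intro a ha
    have := reduce_a_mem ha
    simp only [sinrParams, Multiset.insert_eq_cons, Multiset.mem_cons, Multiset.mem_singleton] at this
    rcases this with rfl | rfl
    · have h0 : (0 : ℝ) ≤ j := j.cast_nonneg
      simp only [neg_re, natCast_re]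
      linarith
    · have e : ((g : ℂ) + n) / (g + 1) = ((g + n) / (g + 1) : ℝ) := by push_cast; rfl
      rw [e, neg_re, ofReal_re]
      have : 0 ≤ (g + n) / (g + 1) := by positivity
      linarith

theorem sinrParams_isWellDefined_and_G_eq {n M : ℕ} (ν : Fin (M + 1) → ℕ) (j : ℕ) {g x : ℝ}
    (hg : 0 < g) (hx : 0 < x) : (sinrParams n ν j g).IsWellDefined x ∧
      (sinrParams n ν j g).G x = (2 * Real.pi : ℂ)⁻¹ * ∫ t : ℝ,
        (sinrShift n g + (((-1 / 2 : ℝ) : ℂ) + t * I)) *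
          cdfIntegrand ν j x (((-1 / 2 : ℝ) : ℂ) + t * I) := by
  have e : ((g : ℂ) + n) / (g + 1) = (sinrShift n g : ℝ) := by
    rw [sinrShift]; push_cast; rfl
  have hb : ∀ z ∈ (sinrParams n ν j g).b, z.im = 0 := by simp [sinrParams]
  have hd : ∀ z ∈ (sinrParams n ν j g).d, z.im = 0 := by
    simp only [sinrParams, Multiset.insert_eq_cons, Multiset.mem_cons, Multiset.mem_singleton, e]
    rintro z (rfl | rfl)
    · simp
    · simp
  have hne : ∃ σ, (sinrParams n ν j g).reduce.Separates σ := ⟨_, separates_sinr_neg_half ν j hg⟩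
  have hj0 : (0 : ℝ) ≤ j := j.cast_nonneg
  have hmem : (-1 / 2 : ℝ) ∈ nuStrip ν := mem_nuStrip_of_neg ν (by norm_num)
  -- If the shift equals 1 + j, both upper parameters cancel against the lower ones. No left poles
  -- remain and separating lines may lie arbitrarily far to the left, so the strip differs from the
  -- generic one.
  by_cases hc : sinrShift n g = 1 + j
  · have h := MeijerParams.isWellDefined_and_G_eq (x := x) hb hd
      (f := fun s => (x : ℂ) ^ s * nuGamma ν s)
      (fun σ hσ => nuStrip_of_separates_sinr hσ) hne (nuStrip_ordConnected ν)
      (differentiableOn_cpow_nuGamma ν hx) (quadraticDecayOn_cpow_nuGamma ν hx)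
      (fun s _ hs => by
        rw [sinrParams_integrand n ν j g x hs, cdfIntegrand, hc, ← mul_assoc, mul_inv_cancel₀,
          one_mul]
        intro h0
        have := congrArg Complex.im h0
        simp at this
        exact hs this)
    refine ⟨h.1, (h.2 _ hmem).trans ?_⟩
    congr 1
    refine integral_congr_ae (ae_of_all _ fun t => ?_)
    simp only [cdfIntegrand, hc]
    rw [← mul_assoc, mul_inv_cancel₀, one_mul]
    refine add_ne_zero_of_re ?_
    simp
    linarith
  · set J : Set ℝ := {σ | 0 < (1 + j : ℝ) + σ} ∩ nuStrip ν with hJ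
    have hJ1 : (∀ σ ∈ J, 0 < (1 + j : ℝ) + σ) ∨ ∀ σ ∈ J, (1 + j : ℝ) + σ < 0 :=
      Or.inl fun σ hσ => hσ.1
    have hJc : J.OrdConnected := by
      refine OrdConnected.inter ⟨fun a ha b hb c hc => ?_⟩ (nuStrip_ordConnected ν)
      have h1 : 0 < (1 + j : ℝ) + a := ha
      have h2 := hc.1
      change 0 < (1 + j : ℝ) + c
      linarith
    have hsep : ∀ σ, (sinrParams n ν j g).reduce.Separates σ → σ ∈ J := by
      intro σ hσ
      refine ⟨?_, nuStrip_of_separates_sinr hσ⟩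
      have := hσ.2 (-(j : ℂ)) (mem_reduce_a (by simp [sinrParams]) (by
        simp only [sinrParams, Multiset.insert_eq_cons, Multiset.mem_cons, Multiset.mem_singleton,
          e, not_or]
        constructor
        · intro h
          have := congrArg Complex.re h
          simp at this
          linarith
        · intro h
          have := congrArg Complex.re h
          simp at this
          exact hc (by linarith)))
      simp at this
      change 0 < (1 + j : ℝ) + σ
      linarith
    have hfun : (fun s : ℂ => ((sinrShift n g : ℝ) + s) * cdfIntegrand ν j x s) =
        fun s : ℂ => ((sinrShift n g + s) * ((1 + j : ℝ) + s)⁻¹) * ((x : ℂ) ^ s * nuGamma ν s) := by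
      ext s
      rw [cdfIntegrand, mul_assoc]
    have h := MeijerParams.isWellDefined_and_G_eq (x := x) hb hd
      (f := fun s => ((sinrShift n g : ℝ) + s) * cdfIntegrand ν j x s) hsep hne hJc
      (DifferentiableOn.mul (by fun_prop)
        (differentiableOn_cdfIntegrand ν j hx hJ1 inter_subset_right)) (by
        rw [hfun]
        refine ((quadraticDecayOn_cpow_nuGamma ν hx).mono inter_subset_right).bounded_mul
          fun σ₁ h1 σ₂ h2 => ?_
        obtain ⟨C, hC⟩ := bounded_inv_add_strip _ hJ1 σ₁ h1 σ₂ h2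
        -- The quotient (c + s)/(1 + j + s) equals 1 + (c - 1 - j)/(1 + j + s), hence is bounded on
        -- the strip.
        refine ⟨1 + |sinrShift n g - (1 + j)| * C, fun s hs1 hs2 => ?_⟩
        have hs0 : ((1 + j : ℝ) : ℂ) + s ≠ 0 := add_ne_zero_of_re (by
          have : 0 < (1 + j : ℝ) + σ₁ := h1.1
          linarith)
        have e2 : (sinrShift n g + s) * ((1 + j : ℝ) + s)⁻¹ =
            1 + ((sinrShift n g - (1 + j) : ℝ) : ℂ) * ((1 + j : ℝ) + s)⁻¹ := by
          field_simp
          push_cast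
          ring
        rw [e2]
        refine (norm_add_le _ _).trans ?_
        rw [norm_one, norm_mul, Complex.norm_real, Real.norm_eq_abs]
        gcongr
        exact hC s hs1 hs2)
      (fun s _ hs => sinrParams_integrand n ν j g x hs)
    refine ⟨h.1, h.2 _ ⟨?_, hmem⟩⟩
    change 0 < (1 + j : ℝ) + _
    linarith

end SinrMeijer

/-! ### Differentiating the distribution function -/

section SinrDensity
open Complex Set Filter Topology

/-- Under the integral sign y^(j+1+s)/(1+j+s) has derivative y^(j+s), so the rational factor
disappears. -/
theorem hasDerivAt_pow_mul_integral_cdfIntegrand {M : ℕ} (ν : Fin (M + 1) → ℕ) (j : ℕ) {σ : ℝ}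
    (hσ : (1 + j : ℝ) + σ ≠ 0) (hν : σ ∈ nuStrip ν) {y : ℝ} (hy : 0 < y) :
    HasDerivAt (fun y : ℝ => (y : ℂ) ^ (j + 1) * ∫ t : ℝ, cdfIntegrand ν j y (σ + t * I))
      ((y : ℂ) ^ j * ∫ t : ℝ, (y : ℂ) ^ ((σ : ℂ) + t * I) * nuGamma ν (σ + t * I)) y := by
  set K : ℝ → ℝ → ℂ := fun y t => nuGamma ν (σ + t * I) *
    ((y : ℂ) ^ ((j : ℂ) + (σ + t * I) + 1) / ((j : ℂ) + (σ + t * I) + 1)) with hK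
  set K' : ℝ → ℝ → ℂ := fun y t => nuGamma ν (σ + t * I) * (y : ℂ) ^ ((j : ℂ) + (σ + t * I)) with hK'
  have hKeq : ∀ y : ℝ, 0 < y → ∀ t : ℝ,
      (y : ℂ) ^ (j + 1) * cdfIntegrand ν j y (σ + t * I) = K y t := by
    intro y hy t
    have hy0 : (y : ℂ) ≠ 0 := by exact_mod_cast hy.ne'
    simp only [hK, cdfIntegrand]
    rw [show (j : ℂ) + (σ + t * I) + 1 = ((j + 1 : ℕ) : ℂ) + (σ + t * I) by push_cast; ring,
      Complex.cpow_add ((j + 1 : ℕ) : ℂ) _ hy0, Complex.cpow_natCast]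
    push_cast
    rw [div_eq_mul_inv]
    ring
  have hK'eq : ∀ y : ℝ, 0 < y → ∀ t : ℝ,
      (y : ℂ) ^ j * ((y : ℂ) ^ ((σ : ℂ) + t * I) * nuGamma ν (σ + t * I)) = K' y t := by
    intro y hy t
    have hy0 : (y : ℂ) ≠ 0 := by exact_mod_cast hy.ne'
    simp only [hK']
    rw [Complex.cpow_add (j : ℂ) _ hy0, Complex.cpow_natCast]
    ring
  have hpos : ∀ z ∈ Metric.ball y (y / 2), y / 2 < z ∧ z < 3 * y / 2 := by
    intro z hz
    rw [Metric.mem_ball, Real.dist_eq, abs_lt] at hz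
    constructor <;> linarith [hz.1, hz.2]
  have hgint : Integrable fun t : ℝ => nuGamma ν (σ + t * I) :=
    (quadraticDecayOn_nuGamma ν).integrable (differentiableOn_nuGamma ν) hν
  have hKm : ∀ z : ℝ, 0 < z → Integrable (K z) := fun z hz =>
    ((integrable_cdfIntegrand ν j hz hσ hν).const_mul ((z : ℂ) ^ (j + 1))).congr
      (ae_of_all _ fun t => hKeq z hz t)
  have hK'm : Integrable (K' y) := by
    have h1 := (quadraticDecayOn_cpow_nuGamma ν hy).integrable
      (differentiableOn_cpow_nuGamma ν hy) hν
    exact (h1.const_mul ((y : ℂ) ^ j)).congr (ae_of_all _ fun t => hK'eq y hy t)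
  -- On the ball of radius y/2 the power is monotone in its base. Whatever the sign of the exponent,
  -- it is bounded by the sum of its values at y/2 and 3y/2.
  have hmain := (hasDerivAt_integral_of_dominated_loc_of_deriv_le (F := K) (F' := K') (x₀ := y)
    (μ := volume)
    (s := Metric.ball y (y / 2)) (bound := fun t : ℝ => ‖nuGamma ν (σ + t * I)‖ *
      ((y / 2) ^ (j + σ) + (3 * y / 2) ^ (j + σ)))
    (Metric.ball_mem_nhds y (half_pos hy)) ?_ (hKm y hy) hK'm.aestronglyMeasurable ?_
    (hgint.norm.mul_const _) ?_).2
  · have e1 : (y : ℂ) ^ j * ∫ t : ℝ, (y : ℂ) ^ ((σ : ℂ) + t * I) * nuGamma ν (σ + t * I) =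
        ∫ t, K' y t := by
      rw [← integral_const_mul]
      exact integral_congr_ae (ae_of_all _ fun t => hK'eq y hy t)
    rw [e1]
    refine hmain.congr_of_eventuallyEq ?_
    filter_upwards [lt_mem_nhds hy] with z hz
    rw [← integral_const_mul]
    exact integral_congr_ae (ae_of_all _ fun t => hKeq z hz t)
  · filter_upwards [lt_mem_nhds hy] with z hz
    exact (hKm z hz).aestronglyMeasurable
  · refine ae_of_all _ fun t z hz => ?_
    obtain ⟨h1, h2⟩ := hpos z hz
    have hz0 : 0 < z := (half_pos hy).trans h1
    rw [norm_mul]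
    refine mul_le_mul_of_nonneg_left ?_ (norm_nonneg _)
    rw [Complex.norm_cpow_eq_rpow_re_of_pos hz0]
    have hre : ((j : ℂ) + (σ + t * I)).re = j + σ := by simp
    rw [hre]
    rcases le_total 0 ((j : ℝ) + σ) with h | h
    · linarith [Real.rpow_le_rpow hz0.le h2.le h, Real.rpow_nonneg (half_pos hy).le (j + σ)]
    · linarith [Real.rpow_le_rpow_of_nonpos (half_pos hy) h1.le h,
        Real.rpow_nonneg (by linarith : (0 : ℝ) ≤ 3 * y / 2) (j + σ)]
  · refine ae_of_all _ fun t z hz => ?_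
    obtain ⟨h1, h2⟩ := hpos z hz
    have hz0 : 0 < z := (half_pos hy).trans h1
    refine (hasDerivAt_ofReal_cpow_const' hz0.ne' fun h => hσ ?_).const_mul _
    have := congrArg Complex.re h
    simp at this
    linarith

theorem hasDerivAt_binomialWeight (m j : ℕ) {x : ℝ} (hx : 0 < x) :
    HasDerivAt (fun x : ℝ => (x / (1 + x)) ^ m * (1 / (1 + x)) ^ j)
      ((x / (1 + x)) ^ m * (1 / (1 + x)) ^ j * (m / x - (m + j) / (1 + x))) x := by
  have h1 : (1 + x) ≠ 0 := by positivity
  have ha : HasDerivAt (fun x : ℝ => 1 + x) 1 x := (hasDerivAt_id x).const_add 1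
  have hu : HasDerivAt (fun x : ℝ => x / (1 + x)) _ x := (hasDerivAt_id x).div ha h1
  have hv : HasDerivAt (fun x : ℝ => 1 / (1 + x)) _ x := (hasDerivAt_const x 1).div ha h1
  -- Writing the derivative of u^k with u^k / u avoids the truncated exponent k - 1 at k = 0.
  have hp : ∀ (u : ℝ) (k : ℕ), u ≠ 0 → (k : ℝ) * u ^ (k - 1) = k * u ^ k / u := by
    intro u k hu
    cases k with
    | zero => simp
    | succ k => rw [pow_succ]; field_simp; simp
  refine ((hu.pow m).mul (hv.pow j)).congr_deriv ?_
  rw [hp _ _ (by positivity), hp _ _ (by positivity)]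
  simp only [id, Pi.pow_apply]
  field_simp
  ring

theorem add_mul_inv_add {a b s : ℂ} (h : a + s ≠ 0) :
    (b + s) * (a + s)⁻¹ = 1 + (b - a) * (a + s)⁻¹ := by
  field_simp
  ring

/-- The distribution function of the SINR on the positive half line. -/
def sinrCdf (n : ℕ) {M : ℕ} (ν : Fin M → ℕ) (δ x : ℝ) : ℝ :=
  ∑ j ∈ Finset.range n, ((n - 1).choose j : ℝ) *
    ((x / (1 + x)) ^ (n - 1 - j) * (1 / (1 + x)) ^ j) * (gammaProd (fun l => ν l + j) δ).real (Iic x)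

/-- With n = m + j + 1, the logarithmic derivative of x^m (1+x)^(-m-j) x^(j+1+s) is (n+s)/x -
(n-1)/(1+x) = ((x+n)/(x+1) + s)/x. This is where the parameter (x+n)/(x+1) of the G-function comes
from. -/
theorem hasDerivAt_sinrCdf_term {M : ℕ} (ν : Fin (M + 1) → ℕ) (m j : ℕ) {δ x : ℝ} (hδ : 0 < δ)
    (hx : 0 < x) :
    HasDerivAt (fun x : ℝ => (((x / (1 + x)) ^ m * (1 / (1 + x)) ^ j : ℝ) : ℂ) *
        ((gammaProd (fun l => ν l + j) δ).real (Iic x) : ℂ))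
      (((x : ℂ) / (x + 1)) ^ (m + j) * (((δ : ℂ) ^ (j + 1))⁻¹ / (∏ l, ((ν l + j).factorial : ℂ)) *
        (sinrParams (m + j + 1) ν j x).G (x / δ))) x := by
  have hj0 : (0 : ℝ) ≤ j := j.cast_nonneg
  have hσ : 0 < (1 + j : ℝ) + (-1 / 2) := by linarith
  have hν : (-1 / 2 : ℝ) ∈ nuStrip ν := mem_nuStrip_of_neg ν (by norm_num)
  have hy : 0 < x / δ := div_pos hx hδ
  rw [(sinrParams_isWellDefined_and_G_eq ν j hx hy).2]
  set B : ℂ := ∫ t : ℝ, cdfIntegrand ν j (x / δ) (((-1 / 2 : ℝ) : ℂ) + t * I) with hB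
  set G₀ : ℂ := ∫ t : ℝ, ((x / δ : ℝ) : ℂ) ^ (((-1 / 2 : ℝ) : ℂ) + t * I) *
    nuGamma ν (((-1 / 2 : ℝ) : ℂ) + t * I) with hG₀
  have hG : ∫ t : ℝ, (sinrShift (m + j + 1) x + (((-1 / 2 : ℝ) : ℂ) + t * I)) *
      cdfIntegrand ν j (x / δ) (((-1 / 2 : ℝ) : ℂ) + t * I) =
      G₀ + ((sinrShift (m + j + 1) x - (1 + j) : ℝ) : ℂ) * B := by
    rw [hG₀, hB, ← integral_const_mul, ← integral_add
      ((quadraticDecayOn_cpow_nuGamma ν hy).integrable (differentiableOn_cpow_nuGamma ν hy) hν)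
      ((integrable_cdfIntegrand ν j hy hσ.ne' hν).const_mul _)]
    refine integral_congr_ae (ae_of_all _ fun t => ?_)
    have hne : ((1 + j : ℝ) : ℂ) + (((-1 / 2 : ℝ) : ℂ) + t * I) ≠ 0 := add_ne_zero_of_re (by
      simp
      linarith)
    have hsh := add_mul_inv_add (b := (sinrShift (m + j + 1) x : ℂ)) hne
    simp only [cdfIntegrand]
    rw [Complex.ofReal_sub, ← mul_assoc, hsh]
    ring
  rw [hG]
  have hT := (hasDerivAt_pow_mul_integral_cdfIntegrand ν j hσ.ne' hν hy).scomp x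
    ((hasDerivAt_id x).div_const δ)
  have hF : HasDerivAt (fun x : ℝ => ((gammaProd (fun l => ν l + j) δ).real (Iic x) : ℂ))
      ((∏ l, ((ν l + j).factorial : ℂ))⁻¹ * (2 * Real.pi : ℂ)⁻¹ *
        ((1 / δ : ℝ) • (((x / δ : ℝ) : ℂ) ^ j * G₀))) x := by
    refine (hT.const_mul ((∏ l, ((ν l + j).factorial : ℂ))⁻¹ * (2 * Real.pi : ℂ)⁻¹)
      ).congr_of_eventuallyEq ?_
    filter_upwards [lt_mem_nhds hx] with z hz
    rw [gammaProd_real_Iic ν j hδ hσ hν hz]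
    simp only [Function.comp, id]
    ring
  refine ((hasDerivAt_binomialWeight m j hx).ofReal_comp.mul hF).congr_deriv ?_
  rw [gammaProd_real_Iic ν j hδ hσ hν hx, ← hB]
  have hP : (∏ l, ((ν l + j).factorial : ℂ)) ≠ 0 :=
    Finset.prod_ne_zero_iff.2 fun l _ => by exact_mod_cast (Nat.factorial_pos _).ne'
  have hπ : (Real.pi : ℂ) ≠ 0 := by exact_mod_cast Real.pi_ne_zero
  have hδc : (δ : ℂ) ≠ 0 := by exact_mod_cast hδ.ne'
  have hxc : (x : ℂ) ≠ 0 := by exact_mod_cast hx.ne'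
  have hx1 : (1 + x : ℂ) ≠ 0 := by exact_mod_cast (by positivity : (1 + x : ℝ) ≠ 0)
  have hx1' : (x + 1 : ℂ) ≠ 0 := by rwa [add_comm]
  rw [Complex.real_smul, sinrShift]
  push_cast
  rw [show (1 + x : ℂ) = x + 1 by ring]
  generalize (∏ l, ((ν l + j).factorial : ℂ)) = Q at *
  simp only [div_pow, one_pow, pow_add, pow_one]
  field_simp
  ring

theorem hasDerivAt_sinrCdf {n M : ℕ} (ν : Fin (M + 1) → ℕ) {δ x : ℝ} (hδ : 0 < δ) (hx : 0 < x) :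
    HasDerivAt (fun x => (sinrCdf n ν δ x : ℂ)) (((x : ℂ) / (x + 1)) ^ (n - 1) *
      ∑ j ∈ Finset.range n, ((n - 1).choose j : ℂ) * ((δ : ℂ) ^ (j + 1))⁻¹ /
        (∏ l, ((ν l + j).factorial : ℂ)) * (sinrParams n ν j x).G (x / δ)) x := by
  have h : ∀ j ∈ Finset.range n, HasDerivAt (fun x : ℝ => ((n - 1).choose j : ℂ) *
      ((((x / (1 + x)) ^ (n - 1 - j) * (1 / (1 + x)) ^ j : ℝ) : ℂ) *
        ((gammaProd (fun l => ν l + j) δ).real (Iic x) : ℂ)))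
      (((x : ℂ) / (x + 1)) ^ (n - 1) * (((n - 1).choose j : ℂ) * ((δ : ℂ) ^ (j + 1))⁻¹ /
        (∏ l, ((ν l + j).factorial : ℂ)) * (sinrParams n ν j x).G (x / δ))) x := by
    intro j hj
    have hj' := Finset.mem_range.1 hj
    have e1 : n - 1 - j + j = n - 1 := by omega
    have e2 : n - 1 - j + j + 1 = n := by omega
    have h0 := (hasDerivAt_sinrCdf_term ν (n - 1 - j) j hδ hx).const_mul ((n - 1).choose j : ℂ)
    rw [e2, e1] at h0
    refine h0.congr_deriv ?_
    ring
  rw [Finset.mul_sum]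
  refine (HasDerivAt.fun_sum h).congr_of_eventuallyEq (Eventually.of_forall fun z => ?_)
  simp only [sinrCdf]
  push_cast
  refine Finset.sum_congr rfl fun j _ => ?_
  ring

/-- A law on the positive half line whose distribution function is differentiable there has the
derivative as its density. -/
theorem eq_withDensity_of_hasDerivAt {L : Measure ℝ} [IsProbabilityMeasure L] {ρ : ℝ → ℝ}
    (h0 : L (Iic 0) = 0) (hρ0 : ∀ x ≤ 0, ρ x = 0) (hnn : ∀ x, 0 ≤ ρ x)
    (hd : ∀ x, 0 < x → HasDerivAt (fun y => L.real (Iic y)) (ρ x) x) :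
    L = volume.withDensity fun x => ENNReal.ofReal (ρ x) := by
  have hIic : ∀ x : ℝ, L (Iic x) = (volume.withDensity fun x => ENNReal.ofReal (ρ x)) (Iic x) := by
    intro x
    rw [withDensity_apply _ measurableSet_Iic]
    rcases le_or_gt x 0 with hx | hx
    · rw [measure_mono_null (Iic_subset_Iic.2 hx) h0, eq_comm]
      refine (setLIntegral_congr_fun measurableSet_Iic fun y (hy : y ≤ x) => ?_).trans
        lintegral_zero
      rw [hρ0 y (hy.trans hx), ENNReal.ofReal_zero]
    · have hcont : ContinuousOn (fun y => L.real (Iic y)) (Icc 0 x) := by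
        intro y hy
        rcases hy.1.eq_or_lt with rfl | hy0
        · have h1 : (fun y => L.real (Iic y)) = cdf L := by
            ext z; exact (cdf_eq_real L z).symm
          rw [h1]
          exact ((cdf L).right_continuous 0).mono Icc_subset_Ici_self
        · exact (hd y hy0).continuousAt.continuousWithinAt
      -- Boundedness of ρ near 0 is not known; integrability follows from its being the nonnegative
      -- derivative of a function continuous up to 0.
      have hint : IntegrableOn ρ (Ioc 0 x) :=
        intervalIntegral.integrableOn_deriv_of_nonneg hcont (fun y hy => hd y hy.1)
          fun y _ => hnn y
      have hFTC := intervalIntegral.integral_eq_sub_of_hasDerivAt_of_le hx.le hcont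
        (fun y hy => hd y hy.1) ((intervalIntegrable_iff_integrableOn_Ioc_of_le hx.le).2 hint)
      have h00 : L.real (Iic 0) = 0 := by rw [measureReal_def, h0]; rfl
      rw [h00, sub_zero, intervalIntegral.integral_of_le hx.le] at hFTC
      have e : ∫⁻ y in Iic x, ENNReal.ofReal (ρ y) = ∫⁻ y in Ioc 0 x, ENNReal.ofReal (ρ y) := by
        rw [← Iic_union_Ioc_eq_Iic hx.le, lintegral_union measurableSet_Ioc
          (Iic_disjoint_Ioc le_rfl)]
        have : ∫⁻ y in Iic (0 : ℝ), ENNReal.ofReal (ρ y) = 0 :=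
          (setLIntegral_congr_fun measurableSet_Iic fun y (hy : y ≤ 0) => by
            rw [hρ0 y hy, ENNReal.ofReal_zero]).trans lintegral_zero
        rw [this, zero_add]
      rw [e, ← ofReal_integral_eq_lintegral_ofReal hint (ae_of_all _ hnn), hFTC,
        ofReal_measureReal]
  exact Measure.ext_of_Iic L _ hIic

end SinrDensity

/-! ### The law of the SINR of one stream -/

section SinrLaw
open Complex Set Filter Topology
open scoped ENNReal Matrix

/-- The law of the SINR of stream `k`. -/
def sinrLaw {n M : ℕ} (ν : Fin M → ℕ) (δ : ℝ) (k : Fin n) : Measure ℝ :=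
  (chainLaw (chainDim n ν) : Measure (Matrix (Fin (chainDim n ν (Fin.last M))) (Fin n) ℂ)).map
    fun H => mmseSINR δ H k

theorem ae_mmseSINR_pos {n M : ℕ} (ν : Fin M → ℕ) {δ : ℝ} (hδ : 0 < δ) (k : Fin n) :
    ∀ᵐ H ∂(chainLaw (chainDim n ν) : Measure (Matrix (Fin (chainDim n ν (Fin.last M))) (Fin n) ℂ)),
      0 < mmseSINR δ H k := by
  have hpd := ae_posDef_chainLaw (chainDim n ν) fun j => Nat.le_add_right n (ν j)
  filter_upwards [hpd] with H hH
  exact mmseSINR_pos hδ hH k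

/-- Almost everywhere the SINR equals a quotient of polynomial expressions in the entries and their
conjugates, so measurability of matrix inversion is not needed. -/
theorem aemeasurable_mmseSINR {n M : ℕ} (ν : Fin M → ℕ) {δ : ℝ} (hδ : 0 < δ)
    (k : Fin n) : AEMeasurable (fun H => mmseSINR δ H k)
    (chainLaw (chainDim n ν) : Measure (Matrix (Fin (chainDim n ν (Fin.last M))) (Fin n) ℂ)) := by
  have hpd := ae_posDef_chainLaw (chainDim n ν) fun j => Nat.le_add_right n (ν j)
  have h1 : Measurable fun H : Matrix (Fin (chainDim n ν (Fin.last M))) (Fin n) ℂ =>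
    (δ : ℂ) • (Hᴴ * H) := Continuous.measurable (by fun_prop)
  refine ⟨_, (measurable_sir k (Finset.univ.erase k) ∅).comp h1, ?_⟩
  filter_upwards [hpd] with H hH
  exact mmseSINR_eq_sir hδ hH k

theorem isProbabilityMeasure_sinrLaw {n M : ℕ} (ν : Fin M → ℕ) {δ : ℝ} (hδ : 0 < δ)
    (k : Fin n) : IsProbabilityMeasure (sinrLaw ν δ k) := by
  refine ⟨?_⟩
  rw [sinrLaw, Measure.map_apply_of_aemeasurable (aemeasurable_mmseSINR ν hδ k) .univ]
  exact (isProbabilityMeasure_chainLaw (chainDim n ν)).measure_univ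

theorem ae_pos_sinrLaw {n M : ℕ} (ν : Fin M → ℕ) {δ : ℝ} (hδ : 0 < δ)
    (k : Fin n) : ∀ᵐ x ∂sinrLaw ν δ k, 0 < x :=
  (ae_map_iff (aemeasurable_mmseSINR ν hδ k) measurableSet_Ioi).2 (ae_mmseSINR_pos ν hδ k)

theorem sinrLaw_Iic_zero {n M : ℕ} (ν : Fin M → ℕ) {δ : ℝ} (hδ : 0 < δ)
    (k : Fin n) : sinrLaw ν δ k (Iic 0) = 0 := by
  refine measure_mono_null (fun x hx => ?_) (ae_iff.1 (ae_pos_sinrLaw ν hδ k))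
  exact not_lt.2 hx

theorem sinrLaw_real_Iic {n M : ℕ} (ν : Fin (M + 1) → ℕ) {δ : ℝ} (hδ : 0 < δ) (k : Fin n) {x : ℝ}
    (hx : 0 < x) : (sinrLaw ν δ k).real (Iic x) = sinrCdf n ν δ x := by
  have h := measure_mmseSINR_le ν hδ k hx
  have h1 : sinrLaw ν δ k (Iic x) = _ :=
    (Measure.map_apply_of_aemeasurable (aemeasurable_mmseSINR ν hδ k) measurableSet_Iic).trans h
  rw [measureReal_def, h1, ENNReal.toReal_sum fun j _ =>
    ENNReal.mul_ne_top ENNReal.ofReal_ne_top (measure_ne_top _ _), sinrCdf]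
  refine Finset.sum_congr rfl fun j _ => ?_
  rw [ENNReal.toReal_mul, ENNReal.toReal_ofReal (by positivity), measureReal_def]

theorem hasLaw_mmseSINR {n M : ℕ} (ν : Fin M → ℕ) {δ : ℝ} (hδ : 0 < δ)
    (k : Fin n) {Ω : Type*} [MeasurableSpace Ω] {P : Measure Ω}
    {A : (j : Fin M) → Ω →
      Matrix (Fin (chainDim n ν j.succ)) (Fin (chainDim n ν j.castSucc)) ℂ}
    (hlaw : ∀ j a b, HasLaw (fun ω => A j ω a b) stdComplexGaussian P)
    (hindep : iIndepFun
      (fun (i : (j : Fin M) × (Fin (chainDim n ν j.succ) × Fin (chainDim n ν j.castSucc))) (ω : Ω) =>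
        A i.1 ω i.2.1 i.2.2) P) :
    HasLaw (fun ω => mmseSINR δ (channelMatrix n ν fun j => A j ω) k) (sinrLaw ν δ k) P :=
  HasLaw.comp ⟨aemeasurable_mmseSINR ν hδ k, rfl⟩ (hasLaw_chainProd (chainDim n ν) hlaw hindep)

end SinrLaw

/-! ### The density of the SINR -/

section SinrDensity
open Complex Set Filter Topology

/-- The density of the SINR. -/
def sinrDensity (n : ℕ) {M : ℕ} (ν : Fin M → ℕ) (δ : ℝ) : ℝ → ℝ :=
  (Ioi 0).indicator (deriv (sinrCdf n ν δ))

theorem measurable_sinrDensity (n : ℕ) {M : ℕ} (ν : Fin M → ℕ) (δ : ℝ) :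
    Measurable (sinrDensity n ν δ) :=
  (measurable_deriv _).indicator measurableSet_Ioi

theorem sinrDensity_of_nonpos (n : ℕ) {M : ℕ} (ν : Fin M → ℕ) (δ : ℝ) {g : ℝ} (hg : g ≤ 0) :
    sinrDensity n ν δ g = 0 :=
  indicator_of_notMem (not_lt.2 hg) _

theorem hasDerivAt_sinrCdf_real {n M : ℕ} (ν : Fin (M + 1) → ℕ) {δ : ℝ} (hδ : 0 < δ)
    {x : ℝ} (hx : 0 < x) :
    HasDerivAt (sinrCdf n ν δ) (sinrDensity n ν δ x) x := by
  have h1 : HasDerivAt (sinrCdf n ν δ) _ x :=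
    Complex.reCLM.hasFDerivAt.comp_hasDerivAt x (hasDerivAt_sinrCdf (n := n) ν hδ hx)
  rw [sinrDensity, indicator_of_mem (mem_Ioi.2 hx)]
  exact h1.differentiableAt.hasDerivAt

/-- Uniqueness of derivatives identifies the real derivative with the complex expression, so reality
of the sum of G-functions needs no separate argument. Nonnegativity likewise comes from monotonicity
of the distribution function. -/
theorem sinrDensity_eq {n M : ℕ} (ν : Fin (M + 1) → ℕ) {δ : ℝ} (hδ : 0 < δ)
    {x : ℝ} (hx : 0 < x) : (sinrDensity n ν δ x : ℂ) =
    ((x : ℂ) / (x + 1)) ^ (n - 1) *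
      ∑ j ∈ Finset.range n, ((n - 1).choose j : ℂ) * ((δ : ℂ) ^ (j + 1))⁻¹ /
        (∏ l, ((ν l + j).factorial : ℂ)) * (sinrParams n ν j x).G (x / δ) :=
  (hasDerivAt_sinrCdf_real ν hδ hx).ofReal_comp.unique (hasDerivAt_sinrCdf ν hδ hx)

theorem sinrDensity_nonneg {n M : ℕ} (ν : Fin (M + 1) → ℕ) {δ : ℝ} (hδ : 0 < δ)
    (k : Fin n) (x : ℝ) : 0 ≤ sinrDensity n ν δ x := by
  rcases le_or_gt x 0 with hx | hx
  · rw [sinrDensity_of_nonpos n ν δ hx]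
  · have := isProbabilityMeasure_sinrLaw ν hδ k
    have h1 : HasDerivAt (fun y => (sinrLaw ν δ k).real (Iic y)) (sinrDensity n ν δ x) x :=
      (hasDerivAt_sinrCdf_real ν hδ hx).congr_of_eventuallyEq (by
        filter_upwards [lt_mem_nhds hx] with y hy
        exact sinrLaw_real_Iic ν hδ k hy)
    rw [← h1.deriv]
    refine Monotone.deriv_nonneg fun a b hab => ?_
    exact measureReal_mono (Iic_subset_Iic.2 hab)

theorem sinrLaw_eq_withDensity {n M : ℕ} (ν : Fin (M + 1) → ℕ) {δ : ℝ} (hδ : 0 < δ)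
    (k : Fin n) : sinrLaw ν δ k =
    volume.withDensity fun g => ENNReal.ofReal (sinrDensity n ν δ g) := by
  have := isProbabilityMeasure_sinrLaw ν hδ k
  refine eq_withDensity_of_hasDerivAt (sinrLaw_Iic_zero ν hδ k)
    (fun x hx => sinrDensity_of_nonpos n ν δ hx) (sinrDensity_nonneg ν hδ k) fun x hx => ?_
  refine (hasDerivAt_sinrCdf_real ν hδ hx).congr_of_eventuallyEq ?_
  filter_upwards [lt_mem_nhds hx] with y hy
  exact sinrLaw_real_Iic ν hδ k hy

end SinrDensity

/-! ### The Beta integral -/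

section BetaIntegral
open Complex Set

/-- Euler's Beta integral over the positive half line. -/
theorem integral_Ioi_cpow_mul_inv_one_add_pow {u : ℂ} (n : ℕ) (hu : 0 < u.re) (hun : u.re < n) :
    IntegrableOn (fun x : ℝ => (x : ℂ) ^ (u - 1) * ((1 + x : ℝ) : ℂ)⁻¹ ^ n) (Ioi 0) ∧
      ∫ x in Ioi (0 : ℝ), (x : ℂ) ^ (u - 1) * ((1 + x : ℝ) : ℂ)⁻¹ ^ n =
        Gamma u * Gamma (n - u) / Gamma n := by
  have hv : 0 < ((n : ℂ) - u).re := by simpa using hun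
  -- The substitution x = v/(1 - v), for which 1 + x = 1/(1 - v), leads to the Beta integral over
  -- (0, 1).
  set φ : ℝ → ℝ := fun v => v / (1 - v) with hφ
  have himg : φ '' Ioo 0 1 = Ioi 0 := by
    ext x
    constructor
    · rintro ⟨v, hv, rfl⟩
      exact div_pos hv.1 (sub_pos.2 hv.2)
    · intro (hx : 0 < x)
      refine ⟨x / (1 + x), ⟨by positivity, (div_lt_one (by positivity)).2 (by linarith)⟩, ?_⟩
      simp only [hφ]
      field_simp
      ring
  have hinj : InjOn φ (Ioo 0 1) := by
    intro a ha b hb h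
    simp only [hφ] at h
    rw [div_eq_div_iff (sub_pos.2 ha.2).ne' (sub_pos.2 hb.2).ne'] at h
    linarith
  have hder : ∀ v ∈ Ioo (0 : ℝ) 1, HasDerivWithinAt φ (1 / (1 - v) ^ 2) (Ioo 0 1) v := by
    intro v hv
    have h1 : (1 - v) ≠ 0 := (sub_pos.2 hv.2).ne'
    refine (((hasDerivAt_id v).div ((hasDerivAt_id v).const_sub 1) h1).congr_deriv
      ?_).hasDerivWithinAt
    simp only [id]
    field_simp
    ring
  have key : ∀ v ∈ Ioo (0 : ℝ) 1, |1 / (1 - v) ^ 2| • (((φ v : ℝ) : ℂ) ^ (u - 1) *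
      ((1 + φ v : ℝ) : ℂ)⁻¹ ^ n) = (v : ℂ) ^ (u - 1) * (1 - v : ℂ) ^ ((n : ℂ) - u - 1) := by
    intro v hv
    have h1 : 0 < 1 - v := sub_pos.2 hv.2
    have h1c : ((1 - v : ℝ) : ℂ) ≠ 0 := by exact_mod_cast h1.ne'
    have e1 : 1 + φ v = (1 - v)⁻¹ := by
      simp only [hφ]
      field_simp
      ring
    have e2 : ((φ v : ℝ) : ℂ) ^ (u - 1) =
        (v : ℂ) ^ (u - 1) / ((1 - v : ℝ) : ℂ) ^ (u - 1) := by
      simp only [hφ]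
      rw [Complex.ofReal_div, Complex.div_cpow_ofReal_nonneg hv.1.le h1.le]
    rw [e1, e2, abs_of_pos (by positivity), Complex.real_smul, Complex.ofReal_inv, inv_inv,
      show (1 - v : ℂ) = ((1 - v : ℝ) : ℂ) by push_cast; rfl,
      show (n : ℂ) - u - 1 = (n : ℂ) - (u - 1) - ((2 : ℕ) : ℂ) by push_cast; ring,
      Complex.cpow_sub ((n : ℂ) - (u - 1)) _ h1c,
      Complex.cpow_sub (n : ℂ) (u - 1) h1c, Complex.cpow_natCast,
      Complex.cpow_natCast]
    push_cast
    ring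
  have hconv := Complex.betaIntegral_convergent hu hv
  rw [intervalIntegrable_iff_integrableOn_Ioo_of_le zero_le_one] at hconv
  rw [← himg, integrableOn_image_iff_integrableOn_abs_deriv_smul measurableSet_Ioo hder hinj,
    integral_image_eq_integral_abs_deriv_smul measurableSet_Ioo hder hinj,
    setIntegral_congr_fun measurableSet_Ioo key]
  refine ⟨hconv.congr_fun (fun v hv => (key v hv).symm) measurableSet_Ioo, ?_⟩
  rw [← integral_Ioc_eq_integral_Ioo, ← intervalIntegral.integral_of_le zero_le_one]
  have h := Complex.betaIntegral_eq_Gamma_mul_div u (n - u) hu hv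
  rw [add_sub_cancel] at h
  exact h

end BetaIntegral

/-! ### The G-function of the rate -/

section RateMeijer
open Complex Set

/-- The Mellin-Barnes integrand of the rate. -/
def rateIntegrand (n : ℕ) {M : ℕ} (ν : Fin M → ℕ) (j : ℕ) (x : ℝ) (s : ℂ) : ℂ :=
  (-Gamma (-1 - s) * Gamma (1 + n + s)) * cdfIntegrand ν j x s

/-- Here Γ(-1-s)²/Γ(-s) = Γ(-1-s)/(-1-s) and Γ(2+s)/Γ(1+s) = 1+s combine to -Γ(-1-s), while
Γ(1+j+s)/Γ(2+j+s) supplies the factor of `cdfIntegrand`. -/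
theorem rateParams_integrand (n : ℕ) {M : ℕ} (ν : Fin M → ℕ) (j : ℕ) (x : ℝ) {s : ℂ}
    (hs : s.im ≠ 0) : (rateParams n ν j).integrand x s = rateIntegrand n ν j x s := by
  have him : ∀ r : ℝ, ((r : ℂ) + s).im ≠ 0 := fun r => by simpa using hs
  have hΓ : ∀ r : ℝ, Gamma ((r : ℂ) + s) ≠ 0 := fun r =>
    MeijerParams.Gamma_ne_zero_of_im_ne_zero (him r)
  have hne : ∀ r : ℝ, (r : ℂ) + s ≠ 0 := fun r h => him r (by rw [h]; rfl)
  have h5 := hne (1 + j)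
  have h6 := hΓ (1 + j)
  have h7 := hne 1
  have h8 := hΓ 1
  have hm : (-1 - s).im ≠ 0 := by simpa using hs
  have h9 : -1 - s ≠ 0 := fun h => hm (by rw [h]; rfl)
  have h10 := MeijerParams.Gamma_ne_zero_of_im_ne_zero hm
  have e1 : Gamma (1 - (-1 - (j : ℂ)) + s) = ((1 + j : ℝ) + s) * Gamma ((1 + j : ℝ) + s) := by
    rw [← Gamma_add_one _ h5]; congr 1; push_cast; ring
  have e2 : Gamma (1 - -(j : ℂ) + s) = Gamma ((1 + j : ℝ) + s) := by
    congr 1; push_cast; ring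
  have e3 : Gamma (1 - -1 + s) = ((1 : ℝ) + s) * Gamma ((1 : ℝ) + s) := by
    rw [← Gamma_add_one _ h7]; congr 1; push_cast; ring
  have e4 : Gamma (1 - 0 + s) = Gamma ((1 : ℝ) + s) := by congr 1; push_cast; ring
  have e5 : Gamma (0 - s) = (-1 - s) * Gamma (-1 - s) := by
    rw [← Gamma_add_one _ h9]; congr 1; ring
  have e6 : Gamma (1 - -(n : ℂ) + s) = Gamma (1 + n + s) := by congr 1; ring
  simp only [MeijerParams.integrand, rateParams, nuParams, Multiset.map_map, Multiset.map_add,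
    Multiset.prod_add, Multiset.insert_eq_cons, Multiset.map_cons, Multiset.map_singleton,
    Multiset.prod_cons, Multiset.prod_singleton, e1, e2, e3, e4, e5, e6, rateIntegrand,
    cdfIntegrand]
  have h11 : (Multiset.map ((fun c => Gamma (c - s)) ∘ fun l => (ν l : ℂ)) Finset.univ.val).prod =
    nuGamma ν s := rfl
  rw [h11]
  have h12 : -1 - s = -((1 : ℝ) + s) := by push_cast; ring
  rw [h12] at h10 ⊢
  field_simp

/-- The real parts of the lines that separate the poles of the rate integrand. -/
def rateStrip (n j : ℕ) : Set ℝ := if j = 0 then Ioo (-n - 1) (-1) else Ioo (-2) (-1)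

theorem rateStrip_ordConnected (n j : ℕ) : (rateStrip n j).OrdConnected := by
  unfold rateStrip
  split_ifs <;> exact ordConnected_Ioo

theorem mem_rateStrip {n j : ℕ} (hn : 2 ≤ n) {σ : ℝ} (h : σ ∈ rateStrip n j) :
    -n - 1 < σ ∧ σ < -1 := by
  have hn' : (2 : ℝ) ≤ n := by exact_mod_cast hn
  unfold rateStrip at h
  split_ifs at h
  · exact h
  · exact ⟨by linarith [h.1], h.2⟩

theorem neg_three_half_mem_rateStrip {n : ℕ} (hn : 2 ≤ n) (j : ℕ) :
    (-3 / 2 : ℝ) ∈ rateStrip n j := by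
  have hn' : (2 : ℝ) ≤ n := by exact_mod_cast hn
  unfold rateStrip
  split_ifs
  · constructor <;> linarith
  · constructor <;> norm_num

/-- The strip lies to the left of the pole s = -1-j for j = 0 and to its right for j ≥ 1. Hence j =
0 yields a tail and the other indices yield distribution functions. -/
theorem rateStrip_sign (n j : ℕ) : (∀ σ ∈ rateStrip n j, 0 < (1 + j : ℝ) + σ) ∨
    ∀ σ ∈ rateStrip n j, (1 + j : ℝ) + σ < 0 := by
  unfold rateStrip
  split_ifs with h
  · right
    intro σ hσ
    rw [h, Nat.cast_zero]
    linarith [hσ.2]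
  · left
    intro σ hσ
    have : (1 : ℝ) ≤ j := by exact_mod_cast Nat.one_le_iff_ne_zero.2 h
    linarith [hσ.1]

theorem rateStrip_subset_nuStrip {n : ℕ} (hn : 2 ≤ n) (j : ℕ) {M : ℕ} (ν : Fin M → ℕ) :
    rateStrip n j ⊆ nuStrip ν := fun σ hσ =>
  mem_nuStrip_of_neg ν (by linarith [(mem_rateStrip hn hσ).2])

theorem bounded_Gamma_rate {n : ℕ} (hn : 2 ≤ n) (j : ℕ) :
    ∀ σ₁ ∈ rateStrip n j, ∀ σ₂ ∈ rateStrip n j, ∃ C, ∀ s : ℂ, σ₁ ≤ s.re → s.re ≤ σ₂ →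
      ‖-Gamma (-1 - s) * Gamma (1 + n + s)‖ ≤ C := by
  intro σ₁ h1 σ₂ h2
  have a1 := mem_rateStrip hn h1
  have a2 := mem_rateStrip hn h2
  have hΓ : ∀ x : ℝ, ∀ C : ℝ, 0 ≤ C → C / (1 + x ^ 2) ≤ C := fun x C hC =>
    div_le_self hC (by nlinarith [sq_nonneg x])
  obtain ⟨C₁, hC₁0, hC₁⟩ := exists_norm_Gamma_le (α := -1 - σ₂) (by linarith) (-1 - σ₁)
  obtain ⟨C₂, hC₂0, hC₂⟩ := exists_norm_Gamma_le (α := 1 + n + σ₁) (by linarith) (1 + n + σ₂)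
  refine ⟨C₁ * C₂, fun s hs1 hs2 => ?_⟩
  rw [norm_mul, norm_neg]
  refine mul_le_mul ?_ ?_ (norm_nonneg _) hC₁0
  · refine (hC₁ _ ?_ ?_).trans (hΓ _ _ hC₁0) <;> simp <;> linarith
  · refine (hC₂ _ ?_ ?_).trans (hΓ _ _ hC₂0) <;> simp <;> linarith

/-- For j = 0 the upper parameters -1 and 0 cancel against the lower ones and only -n bounds the
line from the left. For j ≥ 1 the parameter -1 survives and forces Re s > -2. The line -3/2 serves
both cases. -/
theorem rateParams_isWellDefined_and_G_eq {n M : ℕ} (hn : 2 ≤ n) (ν : Fin (M + 1) → ℕ) (j : ℕ)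
    {x : ℝ} (hx : 0 < x) : (rateParams n ν j).IsWellDefined x ∧
      (rateParams n ν j).G x = (2 * Real.pi : ℂ)⁻¹ * ∫ t : ℝ,
        rateIntegrand n ν j x (((-3 / 2 : ℝ) : ℂ) + t * I) := by
  classical
  have hn' : (2 : ℝ) ≤ n := by exact_mod_cast hn
  have hb : ∀ z ∈ (rateParams n ν j).b, z.im = 0 := by simp [rateParams]
  have hd : ∀ z ∈ (rateParams n ν j).d, z.im = 0 := by simp [rateParams]
  have hsep : ∀ σ, (rateParams n ν j).reduce.Separates σ → σ ∈ rateStrip n j := by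
    intro σ hσ
    have h1 : σ < -1 := by
      have := hσ.1 (-1) (mem_reduce_c (by simp [rateParams]) (by simp [rateParams]))
      simpa using this
    unfold rateStrip
    split_ifs with hj
    · refine ⟨?_, h1⟩
      have := hσ.2 (-(n : ℂ)) (mem_reduce_a (by simp [rateParams]) (by
        simp only [rateParams, Multiset.insert_eq_cons, Multiset.mem_cons,
          Multiset.mem_singleton, not_or]
        constructor
        · intro h
          have := congrArg Complex.re h
          simp at this
          linarith
        · intro h
          have := congrArg Complex.re h
          simp [hj] at this
          linarith))
      simpa using this
    · refine ⟨?_, h1⟩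
      have hj1 : (1 : ℝ) ≤ j := by exact_mod_cast Nat.one_le_iff_ne_zero.2 hj
      have := hσ.2 (-1) (mem_reduce_a (by simp [rateParams]) (by
        simp only [rateParams, Multiset.insert_eq_cons, Multiset.mem_cons,
          Multiset.mem_singleton, not_or]
        constructor
        · intro h
          have := congrArg Complex.re h
          simp at this
        · intro h
          have := congrArg Complex.re h
          simp at this
          linarith))
      simp at this
      linarith
  have hne : (rateParams n ν j).reduce.Separates (-3 / 2) := by
    constructor
    · intro c hc
      have := reduce_c_mem hc
      simp only [rateParams, nuParams, Multiset.mem_add, Multiset.insert_eq_cons,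
        Multiset.mem_cons, Multiset.mem_singleton, Multiset.mem_map] at this
      rcases this with (rfl | rfl) | ⟨l, -, rfl⟩
      · simp; norm_num
      · simp; norm_num
      · have h0 : (0 : ℝ) ≤ ν l := (ν l).cast_nonneg
        simp only [natCast_re]
        linarith
    · intro a ha
      have := reduce_a_mem ha
      simp only [rateParams, Multiset.insert_eq_cons, Multiset.mem_cons,
        Multiset.mem_singleton] at this
      rcases this with rfl | rfl | rfl
      · simp; norm_num
      · simp; linarith
      -- For j = 0 the parameter -j = 0 would put the line to the right of -1, but it is cancelled
      -- by the lower parameter 0.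
      · by_cases hj : j = 0
        · exfalso
          subst hj
          have ha' : (-((0 : ℕ) : ℂ)) ∈ (rateParams n ν 0).a - (rateParams n ν 0).d := by
            unfold MeijerParams.reduce at ha
            convert ha
          rw [Multiset.mem_sub] at ha'
          have hn0 : n ≠ 0 := by omega
          simp [rateParams, hn0] at ha'
        · have hj1 : (1 : ℝ) ≤ j := by exact_mod_cast Nat.one_le_iff_ne_zero.2 hj
          simp
          linarith
  have hν := rateStrip_subset_nuStrip hn j ν
  have h := MeijerParams.isWellDefined_and_G_eq (x := x) hb hd (f := rateIntegrand n ν j x) hsep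
    ⟨_, hne⟩ (rateStrip_ordConnected n j)
    (DifferentiableOn.mul (fun s hs => DifferentiableAt.differentiableWithinAt (by
      have hs' := mem_rateStrip hn hs
      refine DifferentiableAt.mul (DifferentiableAt.neg ?_) ?_
      · exact (differentiableAt_Gamma_of_re_pos (by simp; linarith)).comp s (by fun_prop)
      · exact (differentiableAt_Gamma_of_re_pos (by simp; linarith)).comp s (by fun_prop)))
      (differentiableOn_cdfIntegrand ν j hx (rateStrip_sign n j) hν))
    ((quadraticDecayOn_cdfIntegrand ν j hx (rateStrip_sign n j) hν).bounded_mul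
      (bounded_Gamma_rate hn j))
    (fun s _ hs => rateParams_integrand n ν j x hs)
  exact ⟨h.1, h.2 _ (neg_three_half_mem_rateStrip hn j)⟩

end RateMeijer

/-! ### Integrals of the weighted distribution functions -/

section RateIntegral
open Complex Set

theorem norm_cpow_mul_I_le {x : ℝ} (hx : 0 < x) (t : ℝ) : ‖(x : ℂ) ^ ((t : ℂ) * I)‖ ≤ 1 := by
  rw [Complex.norm_cpow_eq_rpow_re_of_pos hx]
  simp

/-- Integration of the Mellin-Barnes representation of the distribution functions against the
weights `(x / (1 + x)) ^ n`. -/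
theorem integral_weight_mul_cdf {n M : ℕ} (hn : 2 ≤ n) (ν : Fin (M + 1) → ℕ) (j : ℕ) {δ : ℝ}
    (hδ : 0 < δ) :
    IntegrableOn (fun x : ℝ => ((x / (1 + x) : ℝ) : ℂ) ^ n * ((2 * Real.pi : ℂ)⁻¹ *
        ∫ t : ℝ, cdfIntegrand ν j (x / δ) (((-3 / 2 : ℝ) : ℂ) + t * I))) (Ioi 0) ∧
      ∫ x in Ioi (0 : ℝ), ((x / (1 + x) : ℝ) : ℂ) ^ n * ((2 * Real.pi : ℂ)⁻¹ *
        ∫ t : ℝ, cdfIntegrand ν j (x / δ) (((-3 / 2 : ℝ) : ℂ) + t * I)) =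
      -((rateParams n ν j).G (1 / δ) / Gamma n) := by
  have hn' : (2 : ℝ) ≤ n := by exact_mod_cast hn
  set S : ℝ → ℂ := fun t => ((-3 / 2 : ℝ) : ℂ) + t * I with hS
  have hSre : ∀ t, (S t).re = -3 / 2 := fun t => by simp [hS]
  have hmem := neg_three_half_mem_rateStrip hn j
  have hσ : (1 + j : ℝ) + (-3 / 2) ≠ 0 := by
    rcases rateStrip_sign n j with h | h
    · exact (h _ hmem).ne'
    · exact (h _ hmem).ne
  have hν : (-3 / 2 : ℝ) ∈ nuStrip ν := rateStrip_subset_nuStrip hn j ν hmem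
  have hδ1 : 0 < 1 / δ := one_div_pos.2 hδ
  have hb : Integrable fun t : ℝ => cdfIntegrand ν j (1 / δ) (S t) :=
    integrable_cdfIntegrand ν j hδ1 hσ hν
  have hbeta : ∀ t : ℝ, IntegrableOn (fun x : ℝ => (x : ℂ) ^ ((n : ℂ) + S t + 1 - 1) *
        ((1 + x : ℝ) : ℂ)⁻¹ ^ n) (Ioi 0) ∧
      ∫ x in Ioi (0 : ℝ), (x : ℂ) ^ ((n : ℂ) + S t + 1 - 1) * ((1 + x : ℝ) : ℂ)⁻¹ ^ n =
        Gamma (n + S t + 1) * Gamma (n - (n + S t + 1)) / Gamma n := fun t =>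
    integral_Ioi_cpow_mul_inv_one_add_pow n (by simp [hSre]; linarith) (by simp [hSre]; linarith)
  set f : ℝ × ℝ → ℂ := fun q => ((q.1 : ℂ) ^ ((n : ℂ) + S q.2) * ((1 + q.1 : ℝ) : ℂ)⁻¹ ^ n) *
    cdfIntegrand ν j (1 / δ) (S q.2) with hf
  have ha := (hbeta 0).1
  have hprod := Integrable.mul_prod ha hb
  have hfint : Integrable f ((volume.restrict (Ioi (0 : ℝ))).prod volume) := by
    have hm : AEStronglyMeasurable (fun q : ℝ × ℝ => (q.1 : ℂ) ^ ((q.2 : ℂ) * I))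
        ((volume.restrict (Ioi (0 : ℝ))).prod volume) :=
      Measurable.aestronglyMeasurable (by fun_prop)
    have hpos : ∀ᵐ q ∂(volume.restrict (Ioi (0 : ℝ))).prod (volume : Measure ℝ), 0 < q.1 :=
      Measure.quasiMeasurePreserving_fst.ae (ae_restrict_mem measurableSet_Ioi)
    -- On the fixed line x^(it) has modulus at most 1, so joint integrability reduces to that of a
    -- product of a function of x and a function of t.
    refine (hprod.bdd_mul (c := 1) hm ?_).congr ?_
    · filter_upwards [hpos] with q hq
      exact norm_cpow_mul_I_le hq _
    · filter_upwards [hpos] with q hq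
      have hq0 : (q.1 : ℂ) ≠ 0 := by exact_mod_cast hq.ne'
      simp only [hf]
      rw [show (n : ℂ) + S q.2 = (q.2 : ℂ) * I + ((n : ℂ) + S 0 + 1 - 1) by simp [hS]; ring,
        Complex.cpow_add _ _ hq0]
      ring
  have hx : ∀ x ∈ Ioi (0 : ℝ), ∫ t, f (x, t) =
      ((x / (1 + x) : ℝ) : ℂ) ^ n * ∫ t : ℝ, cdfIntegrand ν j (x / δ) (S t) := by
    intro x (hx : 0 < x)
    have hx0 : (x : ℂ) ≠ 0 := by exact_mod_cast hx.ne'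
    rw [← integral_const_mul]
    refine integral_congr_ae (ae_of_all _ fun t => ?_)
    simp only [hf, cdfIntegrand]
    rw [Complex.cpow_add (n : ℂ) _ hx0, Complex.cpow_natCast,
      show x / δ = x * (1 / δ) by ring, Complex.ofReal_mul,
      Complex.mul_cpow_ofReal_nonneg hx.le hδ1.le, Complex.ofReal_div x (1 + x), div_pow, inv_pow]
    ring
  have hleft := hfint.integral_prod_left
  constructor
  · refine IntegrableOn.congr_fun (hleft.const_mul (2 * Real.pi : ℂ)⁻¹) (fun x hx' => ?_)
      measurableSet_Ioi
    simp only [hx x hx']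
    ring
  · have h1 : ∫ x in Ioi (0 : ℝ), ((x / (1 + x) : ℝ) : ℂ) ^ n * ((2 * Real.pi : ℂ)⁻¹ *
        ∫ t : ℝ, cdfIntegrand ν j (x / δ) (S t)) =
        (2 * Real.pi : ℂ)⁻¹ * ∫ x in Ioi (0 : ℝ), ∫ t, f (x, t) := by
      rw [← integral_const_mul]
      refine setIntegral_congr_fun measurableSet_Ioi fun x hx' => ?_
      simp only [hx x hx']
      ring
    rw [h1, integral_integral_swap (f := fun x t => f (x, t)) hfint,
      (rateParams_isWellDefined_and_G_eq hn ν j hδ1).2]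
    -- The Beta integral with exponent u = n + s + 1, for which n - u = -1 - s.
    have h2 : ∀ t : ℝ, ∫ x in Ioi (0 : ℝ), f (x, t) =
        -(Gamma n)⁻¹ * rateIntegrand n ν j (1 / δ) (S t) := by
      intro t
      have := (hbeta t).2
      simp only [hf, integral_mul_const]
      rw [add_sub_cancel_right] at this
      rw [this, rateIntegrand, show (n : ℂ) - (n + S t + 1) = -1 - S t by ring,
        show (n : ℂ) + S t + 1 = 1 + n + S t by ring]
      ring
    simp only [h2, integral_const_mul]
    ring

/-- The power of x in front of the Barnes integral compensates for the index j in the weight, so one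
integral over x handles all j. -/
theorem weight_mul_pow {n j : ℕ} (hj : j < n) {δ x : ℝ} (hδ : 0 < δ) (hx : 0 < x) :
    (x / (1 + x)) ^ (n - 1 - j) * (1 / (1 + x)) ^ j * (x / δ) ^ (j + 1) / (1 + x) =
      (δ ^ (j + 1))⁻¹ * (x / (1 + x)) ^ n := by
  obtain ⟨m, rfl⟩ : ∃ m, n = m + j + 1 := ⟨n - 1 - j, by omega⟩
  rw [show m + j + 1 - 1 - j = m by omega]
  simp only [div_pow, one_pow, pow_add, pow_one]
  field_simp

theorem integrableOn_and_integral_ofReal {f : ℝ → ℝ} {g : ℝ → ℂ} {s : Set ℝ}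
    (hs : MeasurableSet s) (hfg : ∀ x ∈ s, (f x : ℂ) = g x) (hg : IntegrableOn g s) :
    IntegrableOn f s ∧ ((∫ x in s, f x : ℝ) : ℂ) = ∫ x in s, g x := by
  constructor
  · have h : IntegrableOn (fun x => (g x).re) s := hg.re
    exact h.congr_fun (fun x hx => (congrArg re (hfg x hx)).symm.trans (Complex.ofReal_re _)) hs
  · rw [← integral_complex_ofReal]
    exact setIntegral_congr_fun hs hfg

/-- The contribution of the distribution functions with `j ≥ 1`. -/
theorem integral_weight_mul_real_Iic {n M : ℕ} (hn : 2 ≤ n) (ν : Fin (M + 1) → ℕ) {j : ℕ}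
    (hj0 : j ≠ 0) (hj : j < n) {δ : ℝ} (hδ : 0 < δ) :
    IntegrableOn (fun x : ℝ => (x / (1 + x)) ^ (n - 1 - j) * (1 / (1 + x)) ^ j *
        (gammaProd (fun l => ν l + j) δ).real (Iic x) / (1 + x)) (Ioi 0) ∧
      ((∫ x in Ioi (0 : ℝ), (x / (1 + x)) ^ (n - 1 - j) * (1 / (1 + x)) ^ j *
        (gammaProd (fun l => ν l + j) δ).real (Iic x) / (1 + x) : ℝ) : ℂ) =
      -(((δ : ℂ) ^ (j + 1))⁻¹ / (∏ l, ((ν l + j).factorial : ℂ)) *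
        ((rateParams n ν j).G (1 / δ) / Gamma n)) := by
  have h := integral_weight_mul_cdf hn ν j hδ
  have hj1 : (1 : ℝ) ≤ j := by exact_mod_cast Nat.one_le_iff_ne_zero.2 hj0
  have hint := h.1.const_mul (((δ : ℂ) ^ (j + 1))⁻¹ / (∏ l, ((ν l + j).factorial : ℂ)))
  refine (integrableOn_and_integral_ofReal measurableSet_Ioi (fun x hx => ?_) hint).imp_right
    fun h1 => ?_
  · have hx' : 0 < x := hx
    have hw := congrArg (fun r : ℝ => (r : ℂ)) (weight_mul_pow hj hδ hx')
    have hF := gammaProd_real_Iic ν j hδ (σ := -3 / 2) (by linarith)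
      (rateStrip_subset_nuStrip hn j ν (neg_three_half_mem_rateStrip hn j)) hx'
    push_cast at hw hF ⊢
    rw [hF]
    linear_combination ((∏ l, ((ν l + j).factorial : ℂ))⁻¹ * ((2 * Real.pi : ℂ)⁻¹ *
      ∫ t : ℝ, cdfIntegrand ν j (x / δ) (-3 / 2 + t * I))) * hw
  · rw [h1, integral_const_mul, h.2]
    ring

/-- For j = 0 the line -3/2 has passed the pole s = -1, so the same integral represents minus the
tail. -/
theorem integral_weight_mul_real_Ioi {n M : ℕ} (hn : 2 ≤ n) (ν : Fin (M + 1) → ℕ) {δ : ℝ}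
    (hδ : 0 < δ) :
    IntegrableOn (fun x : ℝ => (x / (1 + x)) ^ (n - 1) *
        (gammaProd (fun l => ν l + 0) δ).real (Ioi x) / (1 + x)) (Ioi 0) ∧
      ((∫ x in Ioi (0 : ℝ), (x / (1 + x)) ^ (n - 1) *
        (gammaProd (fun l => ν l + 0) δ).real (Ioi x) / (1 + x) : ℝ) : ℂ) =
      ((δ : ℂ) ^ (0 + 1))⁻¹ / (∏ l, ((ν l + 0).factorial : ℂ)) *
        ((rateParams n ν 0).G (1 / δ) / Gamma n) := by
  have h := integral_weight_mul_cdf hn ν 0 hδ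
  have hint := h.1.const_mul (-(((δ : ℂ) ^ (0 + 1))⁻¹ / (∏ l, ((ν l + 0).factorial : ℂ))))
  refine (integrableOn_and_integral_ofReal measurableSet_Ioi (fun x hx => ?_) hint).imp_right
    fun h1 => ?_
  · have hx' : 0 < x := hx
    have hw := congrArg (fun r : ℝ => (r : ℂ))
      (weight_mul_pow (n := n) (j := 0) (by omega) hδ hx')
    have hF := gammaProd_real_Ioi ν 0 hδ (σ := -3 / 2) (by norm_num) hx'
    rw [Nat.sub_zero, pow_zero, mul_one] at hw
    push_cast at hw hF ⊢
    rw [hF]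
    linear_combination -((∏ l, ((ν l + 0).factorial : ℂ))⁻¹ * ((2 * Real.pi : ℂ)⁻¹ *
      ∫ t : ℝ, cdfIntegrand ν 0 (x / δ) (-3 / 2 + t * I))) * hw
  · rw [h1, integral_const_mul, h.2]
    ring

/-- Geometric summation gives the terms x^k/(1+x)^(k+2) with k < m, whose Beta integrals are
1/(k+1). -/
theorem integral_one_sub_pow_div (m : ℕ) :
    IntegrableOn (fun x : ℝ => (1 - (x / (1 + x)) ^ m) / (1 + x)) (Ioi 0) ∧
      ∫ x in Ioi (0 : ℝ), (1 - (x / (1 + x)) ^ m) / (1 + x) = (harmonic m : ℝ) := by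
  have hk : ∀ k : ℕ, IntegrableOn (fun x : ℝ => x ^ k * (1 + x)⁻¹ ^ (k + 2)) (Ioi 0) ∧
      ((∫ x in Ioi (0 : ℝ), x ^ k * (1 + x)⁻¹ ^ (k + 2) : ℝ) : ℂ) = ((k : ℂ) + 1)⁻¹ := by
    intro k
    have h := integral_Ioi_cpow_mul_inv_one_add_pow (u := k + 1) (k + 2)
      (by simp; positivity) (by simp)
    refine (integrableOn_and_integral_ofReal measurableSet_Ioi (fun x hx => ?_) h.1).imp_right
      fun h1 => ?_
    · rw [add_sub_cancel_right, Complex.cpow_natCast]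
      push_cast
      rfl
    · have hk1 : (k : ℂ) + 1 ≠ 0 := by exact_mod_cast k.succ_ne_zero
      rw [h1, h.2, show ((k + 2 : ℕ) : ℂ) - (k + 1) = 1 by push_cast; ring, Complex.Gamma_one,
        show ((k + 2 : ℕ) : ℂ) = (k + 1 : ℂ) + 1 by push_cast; ring, Complex.Gamma_add_one _ hk1]
      have : Gamma ((k : ℂ) + 1) ≠ 0 := Complex.Gamma_ne_zero_of_re_pos (by simp; positivity)
      field_simp
  have hsum : ∀ x ∈ Ioi (0 : ℝ), ∑ k ∈ Finset.range m, x ^ k * (1 + x)⁻¹ ^ (k + 2) =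
      (1 - (x / (1 + x)) ^ m) / (1 + x) := by
    intro x (hx : 0 < x)
    have h1 : 1 - x / (1 + x) = (1 + x)⁻¹ := by field_simp; ring
    rw [← mul_neg_geom_sum, h1, Finset.mul_sum, Finset.sum_div]
    refine Finset.sum_congr rfl fun k _ => ?_
    rw [div_pow, inv_pow, pow_add]
    field_simp
  have hI := integrable_finsetSum (Finset.range m) fun k _ => (hk k).1
  refine ⟨IntegrableOn.congr_fun hI hsum measurableSet_Ioi, ?_⟩
  rw [← setIntegral_congr_fun measurableSet_Ioi hsum, integral_finsetSum _ fun k _ => (hk k).1,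
    harmonic, Rat.cast_sum]
  refine Finset.sum_congr rfl fun k _ => ?_
  have := (hk k).2
  rw [← Complex.ofReal_inj, this]
  push_cast
  rfl

end RateIntegral

/-! ### The ergodic rate -/

section Rate
open Complex Set

/-- The integral of the tail of the SINR against the derivative of `log (1 + x)`. -/
theorem integral_one_sub_sinrCdf {n M : ℕ} (hn : 2 ≤ n) (ν : Fin (M + 1) → ℕ) {δ : ℝ}
    (hδ : 0 < δ) :
    IntegrableOn (fun x : ℝ => (1 - sinrCdf n ν δ x) / (1 + x)) (Ioi 0) ∧
      ((∫ x in Ioi (0 : ℝ), (1 - sinrCdf n ν δ x) / (1 + x) : ℝ) : ℂ) =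
        (harmonic (n - 1) : ℂ) + ∑ j ∈ Finset.range n, ((n - 1).choose j : ℂ) *
          (((δ : ℂ) ^ (j + 1))⁻¹ / (∏ l, ((ν l + j).factorial : ℂ)) *
            ((rateParams n ν j).G (1 / δ) / Gamma n)) := by
  obtain ⟨m, rfl⟩ : ∃ m, n = m + 1 := ⟨n - 1, by omega⟩
  set φ : ℕ → ℝ → ℝ := fun j x => (x / (1 + x)) ^ (m - j) * (1 / (1 + x)) ^ j *
    (gammaProd (fun l => ν l + j) δ).real (Iic x) / (1 + x) with hφ
  have hj : ∀ j ∈ Finset.range m, IntegrableOn (φ (j + 1)) (Ioi 0) ∧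
      ((∫ x in Ioi (0 : ℝ), φ (j + 1) x : ℝ) : ℂ) =
      -(((δ : ℂ) ^ (j + 1 + 1))⁻¹ / (∏ l, ((ν l + (j + 1)).factorial : ℂ)) *
        ((rateParams (m + 1) ν (j + 1)).G (1 / δ) / Gamma ((m + 1 : ℕ) : ℂ))) := fun j hjm =>
    integral_weight_mul_real_Iic hn ν j.succ_ne_zero
      (by have := Finset.mem_range.1 hjm; omega) hδ
  have h0 := integral_weight_mul_real_Ioi hn ν hδ
  rw [Nat.add_sub_cancel] at h0
  have hH := integral_one_sub_pow_div m
  have hsumI : IntegrableOn (fun x => ∑ j ∈ Finset.range m, (m.choose (j + 1) : ℝ) * φ (j + 1) x)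
      (Ioi 0) := integrable_finsetSum _ fun j hjm => (hj j hjm).1.const_mul _
  -- The term j = 0 of the distribution function is rewritten as weight minus weight times tail. One
  -- minus the weight then yields the harmonic number.
  have heq : ∀ x ∈ Ioi (0 : ℝ), (1 - (x / (1 + x)) ^ m) / (1 + x) +
      (x / (1 + x)) ^ m * (gammaProd (fun l => ν l + 0) δ).real (Ioi x) / (1 + x) -
        ∑ j ∈ Finset.range m, (m.choose (j + 1) : ℝ) * φ (j + 1) x =
      (1 - sinrCdf (m + 1) ν δ x) / (1 + x) := by
    intro x hx
    have hc : (gammaProd (fun l => ν l + 0) δ).real (Ioi x) =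
        1 - (gammaProd (fun l => ν l + 0) δ).real (Iic x) := by
      rw [← compl_Iic, probReal_compl_eq_one_sub measurableSet_Iic]
    rw [hc, sinrCdf, Finset.sum_range_succ']
    simp only [hφ, Nat.add_sub_cancel, Nat.choose_zero_right, Nat.cast_one, Nat.sub_zero, pow_zero,
      mul_one, one_mul]
    have hs : ∑ j ∈ Finset.range m, (m.choose (j + 1) : ℝ) *
        ((x / (1 + x)) ^ (m - (j + 1)) * (1 / (1 + x)) ^ (j + 1) *
          (gammaProd (fun l => ν l + (j + 1)) δ).real (Iic x) / (1 + x)) =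
        (∑ j ∈ Finset.range m, (m.choose (j + 1) : ℝ) *
        ((x / (1 + x)) ^ (m - (j + 1)) * (1 / (1 + x)) ^ (j + 1)) *
          (gammaProd (fun l => ν l + (j + 1)) δ).real (Iic x)) / (1 + x) := by
      rw [Finset.sum_div]
      exact Finset.sum_congr rfl fun j _ => by ring
    rw [hs]
    ring
  have hadd : IntegrableOn (fun x => (1 - (x / (1 + x)) ^ m) / (1 + x) +
      (x / (1 + x)) ^ m * (gammaProd (fun l => ν l + 0) δ).real (Ioi x) / (1 + x)) (Ioi 0) :=
    hH.1.add h0.1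
  refine ⟨IntegrableOn.congr_fun (hadd.sub hsumI) heq measurableSet_Ioi, ?_⟩
  rw [← setIntegral_congr_fun measurableSet_Ioi heq,
    integral_sub hadd hsumI, integral_add hH.1 h0.1, hH.2,
    integral_finsetSum _ fun j hjm => (hj j hjm).1.const_mul _]
  simp only [integral_const_mul]
  rw [Finset.sum_range_succ', Nat.add_sub_cancel]
  push_cast
  rw [h0.2]
  have hs : ∑ j ∈ Finset.range m, (m.choose (j + 1) : ℂ) *
      ((∫ x in Ioi (0 : ℝ), φ (j + 1) x : ℝ) : ℂ) =
      -∑ j ∈ Finset.range m, (m.choose (j + 1) : ℂ) *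
        (((δ : ℂ) ^ (j + 1 + 1))⁻¹ / (∏ l, ((ν l + (j + 1)).factorial : ℂ)) *
          ((rateParams (m + 1) ν (j + 1)).G (1 / δ) / Gamma ((m + 1 : ℕ) : ℂ))) := by
    rw [← Finset.sum_neg_distrib]
    exact Finset.sum_congr rfl fun j hjm => by rw [(hj j hjm).2]; ring
  rw [hs]
  simp only [Nat.choose_zero_right, Nat.cast_one, one_mul]
  push_cast
  ring

/-- Layer cake formula for `log (1 + x)`. -/
theorem integrable_log_one_add_and_integral_eq {L : Measure ℝ} [IsProbabilityMeasure L]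
    (hpos : ∀ᵐ x ∂L, 0 < x)
    (hint : IntegrableOn (fun t => (1 - L.real (Iic t)) / (1 + t)) (Ioi 0)) :
    Integrable (fun x => Real.log (1 + x)) L ∧
      ∫ x, Real.log (1 + x) ∂L = ∫ t in Ioi (0 : ℝ), (1 - L.real (Iic t)) / (1 + t) := by
  -- Truncation at 0 makes the derivative of log(1 + t) continuous and nonnegative on the whole line
  -- without changing it for t ≥ 0.
  have hlog : ∀ x : ℝ, 0 < x → ∫ t in (0 : ℝ)..x, (1 + max t 0)⁻¹ = Real.log (1 + x) := by
    intro x hx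
    have h1 : ∫ t in (0 : ℝ)..x, (1 + max t 0)⁻¹ = ∫ t in (0 : ℝ)..x, (1 + t)⁻¹ := by
      refine intervalIntegral.integral_congr fun t ht => ?_
      rw [uIcc_of_le hx.le] at ht
      simp only [max_eq_left ht.1]
    rw [h1, intervalIntegral.integral_comp_add_left (fun t => t⁻¹), add_zero,
      integral_inv_of_pos one_pos (by linarith), div_one]
  have hcont : Continuous fun t : ℝ => (1 + max t 0)⁻¹ :=
    Continuous.inv₀ (by fun_prop) fun t => by positivity
  have hlc := lintegral_comp_eq_lintegral_meas_lt_mul L (f := fun x : ℝ => x)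
    (g := fun t => (1 + max t 0)⁻¹) (hpos.mono fun x hx => hx.le) aemeasurable_id
    (fun t _ => hcont.intervalIntegrable _ _)
    (ae_of_all _ fun t => by positivity)
  have hnn : ∀ t ∈ Ioi (0 : ℝ), 0 ≤ (1 - L.real (Iic t)) / (1 + t) := fun t (ht : 0 < t) =>
    div_nonneg (sub_nonneg.2 measureReal_le_one) (by linarith)
  have hright : ∫⁻ t in Ioi (0 : ℝ), L {a | t < a} * ENNReal.ofReal (1 + max t 0)⁻¹ =
      ENNReal.ofReal (∫ t in Ioi (0 : ℝ), (1 - L.real (Iic t)) / (1 + t)) := by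
    rw [ofReal_integral_eq_lintegral_ofReal hint
      ((ae_restrict_iff' measurableSet_Ioi).2 (ae_of_all _ hnn))]
    refine setLIntegral_congr_fun measurableSet_Ioi fun t (ht : 0 < t) => ?_
    have h1 : L {a | t < a} = ENNReal.ofReal (1 - L.real (Iic t)) := by
      rw [← probReal_compl_eq_one_sub measurableSet_Iic, compl_Iic, ofReal_measureReal]
      rfl
    rw [h1, max_eq_left ht.le, ← ENNReal.ofReal_mul (sub_nonneg.2 measureReal_le_one),
      div_eq_mul_inv]
  have hleft : ∫⁻ x, ENNReal.ofReal (Real.log (1 + x)) ∂L =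
      ENNReal.ofReal (∫ t in Ioi (0 : ℝ), (1 - L.real (Iic t)) / (1 + t)) := by
    rw [← hright, ← hlc]
    refine lintegral_congr_ae ?_
    filter_upwards [hpos] with x hx
    rw [hlog x hx]
  have hlognn : ∀ᵐ x ∂L, 0 ≤ Real.log (1 + x) :=
    hpos.mono fun x hx => Real.log_nonneg (by linarith)
  have hm : AEStronglyMeasurable (fun x => Real.log (1 + x)) L :=
    (Real.measurable_log.comp (measurable_const.add measurable_id)).aestronglyMeasurable
  constructor
  · refine ⟨hm, ?_⟩
    rw [hasFiniteIntegral_iff_ofReal hlognn, hleft]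
    exact ENNReal.ofReal_lt_top
  · rw [integral_eq_lintegral_of_nonneg_ae hlognn hm, hleft,
      ENNReal.toReal_ofReal (setIntegral_nonneg measurableSet_Ioi hnn)]

theorem integral_log_sinrLaw {n M : ℕ} (hn : 2 ≤ n) (ν : Fin (M + 1) → ℕ) {δ : ℝ}
    (hδ : 0 < δ) (k : Fin n) :
    Integrable (fun x => Real.log (1 + x)) (sinrLaw ν δ k) ∧
      ((∫ x, Real.log (1 + x) ∂sinrLaw ν δ k : ℝ) : ℂ) =
        (harmonic (n - 1) : ℂ) + ∑ j ∈ Finset.range n, ((n - 1).choose j : ℂ) *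
          (((δ : ℂ) ^ (j + 1))⁻¹ / (∏ l, ((ν l + j).factorial : ℂ)) *
            ((rateParams n ν j).G (1 / δ) / Gamma n)) := by
  have := isProbabilityMeasure_sinrLaw ν hδ k
  have h := integral_one_sub_sinrCdf hn ν hδ
  have hcongr : ∀ t ∈ Ioi (0 : ℝ), (1 - sinrCdf n ν δ t) / (1 + t) =
      (1 - (sinrLaw ν δ k).real (Iic t)) / (1 + t) := fun t ht => by
    rw [sinrLaw_real_Iic ν hδ k ht]
  have h1 := integrable_log_one_add_and_integral_eq (ae_pos_sinrLaw ν hδ k)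
    (h.1.congr_fun hcongr measurableSet_Ioi)
  exact ⟨h1.1, by rw [h1.2, ← setIntegral_congr_fun measurableSet_Ioi hcongr, h.2]⟩

theorem eulerMascheroni_add_digamma_natCast {n : ℕ} (hn : n ≠ 0) :
    (Real.eulerMascheroniConstant : ℂ) + Complex.digamma n = (harmonic (n - 1) : ℂ) := by
  obtain ⟨m, rfl⟩ := Nat.exists_eq_succ_of_ne_zero hn
  have h1 : (m.factorial : ℂ) ≠ 0 := by exact_mod_cast m.factorial_ne_zero
  rw [Complex.digamma_def, logDeriv_apply, Nat.succ_eq_add_one, Nat.cast_add_one,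
    Complex.deriv_Gamma_nat, Complex.Gamma_nat_eq_factorial, Nat.add_sub_cancel]
  field_simp
  ring

end Rate

end

theorem mainTheorem5 {Ω : Type*} [MeasurableSpace Ω] (P : Measure Ω) [IsProbabilityMeasure P]
    (n M : ℕ) (hn : 2 ≤ n) (hM : 1 ≤ M) (ν : Fin M → ℕ) (δ : ℝ) (hδ : 0 < δ)
    (A : (j : Fin M) → Ω →
      Matrix (Fin (chainDim n ν j.succ)) (Fin (chainDim n ν j.castSucc)) ℂ)
    (hlaw : ∀ j a b, HasLaw (fun ω => A j ω a b) stdComplexGaussian P)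
    (hindep : iIndepFun
      (fun (i : (j : Fin M) × (Fin (chainDim n ν j.succ) × Fin (chainDim n ν j.castSucc))) (ω : Ω) =>
        A i.1 ω i.2.1 i.2.2) P) :
    -- the Meijer G-functions in the two formulas are given by convergent contour integrals
    (∀ j ∈ Finset.range n, ∀ g : ℝ, 0 < g → (sinrParams n ν j g).IsWellDefined (g / δ)) ∧
    (∀ j ∈ Finset.range n, (rateParams n ν j).IsWellDefined (1 / δ)) ∧
    -- the density of the SINR of each stream
    (∃ ρ : ℝ → ℝ, Measurable ρ ∧ (∀ g, 0 ≤ ρ g) ∧ (∀ g ≤ 0, ρ g = 0) ∧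
      (∀ g : ℝ, 0 < g →
        (ρ g : ℂ) = ((g : ℂ) / (g + 1)) ^ (n - 1) *
          ∑ j ∈ Finset.range n,
            ((n - 1).choose j : ℂ) * ((δ : ℂ) ^ (j + 1))⁻¹ /
                (∏ l : Fin M, ((ν l + j).factorial : ℂ)) *
              (sinrParams n ν j g).G (g / δ)) ∧
      ∀ k : Fin n,
        HasLaw (fun ω => mmseSINR δ (channelMatrix n ν fun j => A j ω) k)
          (volume.withDensity fun g => ENNReal.ofReal (ρ g)) P) ∧
    -- the ergodic sum rate
    (∀ k : Fin n, Integrable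
      (fun ω => Real.log (1 + mmseSINR δ (channelMatrix n ν fun j => A j ω) k)) P) ∧
    ((∑ k : Fin n,
        ∫ ω, Real.log (1 + mmseSINR δ (channelMatrix n ν fun j => A j ω) k) ∂P : ℝ) : ℂ) =
      (n : ℂ) * ((Real.eulerMascheroniConstant : ℂ) + Complex.digamma n) +
        ∑ j ∈ Finset.range n,
          (n : ℂ) * ((δ : ℂ) ^ (j + 1))⁻¹ /
              ((j.factorial : ℂ) * ((n - 1 - j).factorial : ℂ) *
                ∏ l : Fin M, ((ν l + j).factorial : ℂ)) *
            (rateParams n ν j).G (1 / δ) := by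
  obtain ⟨M, rfl⟩ : ∃ m, M = m + 1 := ⟨M - 1, by omega⟩
  have hX := fun k : Fin n => hasLaw_mmseSINR ν hδ k hlaw hindep
  have hlog : Measurable fun x : ℝ => Real.log (1 + x) :=
    Real.measurable_log.comp (measurable_const.add measurable_id)
  refine ⟨fun j _ g hg => (sinrParams_isWellDefined_and_G_eq ν j hg (div_pos hg hδ)).1,
    fun j _ => (rateParams_isWellDefined_and_G_eq hn ν j (one_div_pos.2 hδ)).1,
    ⟨sinrDensity n ν δ, measurable_sinrDensity n ν δ,
      sinrDensity_nonneg ν hδ ⟨0, by omega⟩, fun g hg => sinrDensity_of_nonpos n ν δ hg,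
      fun g hg => sinrDensity_eq ν hδ hg, fun k => ?_⟩, fun k => ?_, ?_⟩
  · rw [← sinrLaw_eq_withDensity ν hδ k]
    exact hX k
  · have h := (integral_log_sinrLaw hn ν hδ k).1
    rw [← (hX k).map_eq] at h
    exact (integrable_map_measure hlog.aestronglyMeasurable (hX k).aemeasurable).1 h
  · have hk : ∀ k : Fin n,
        ((∫ ω, Real.log (1 + mmseSINR δ (channelMatrix n ν fun j => A j ω) k) ∂P : ℝ) : ℂ) =
          ((∫ x, Real.log (1 + x) ∂sinrLaw ν δ k : ℝ) : ℂ) := fun k => by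
      rw [← (hX k).map_eq, integral_map (hX k).aemeasurable hlog.aestronglyMeasurable]
    rw [Complex.ofReal_sum, Finset.sum_congr rfl fun k _ => (hk k).trans (integral_log_sinrLaw hn ν hδ k).2, Finset.sum_const,
      Finset.card_univ, Fintype.card_fin, nsmul_eq_mul,
      eulerMascheroni_add_digamma_natCast (by omega), mul_add, Finset.mul_sum]
    congr 1
    refine Finset.sum_congr rfl fun j hj => ?_
    obtain ⟨m, rfl⟩ : ∃ m, n = m + 1 := ⟨n - 1, by omega⟩
    have hjm : j ≤ m := by have := Finset.mem_range.1 hj; omega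
    -- Dividing C(n-1, j) by Γ(n) = (n-1)! leaves the factorials in the denominator of the stated
    -- formula.
    have hc : (m.choose j : ℂ) * j.factorial * (m - j).factorial = m.factorial := by
      exact_mod_cast Nat.choose_mul_factorial_mul_factorial hjm
    have f1 : (m.factorial : ℂ) ≠ 0 := by exact_mod_cast m.factorial_ne_zero
    have f2 : (j.factorial : ℂ) ≠ 0 := by exact_mod_cast j.factorial_ne_zero
    have f3 : ((m - j).factorial : ℂ) ≠ 0 := by exact_mod_cast (m - j).factorial_ne_zero
    have hc' : (m.choose j : ℂ) / m.factorial = (j.factorial * (m - j).factorial : ℂ)⁻¹ := by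
      rw [div_eq_iff f1, ← hc]
      field_simp
    rw [Nat.add_sub_cancel, Nat.cast_add_one, Complex.Gamma_nat_eq_factorial]
    rw [div_eq_mul_inv _ (((j.factorial : ℂ) * _) * _), mul_inv, ← hc']
    ring
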